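/- **Setting.** Let $n,p\ge 1$, let $X\in\mathbb R^{n\times p}$ have columns $X_j$ with $\|X_j\|_2^2=n$, and let $y=X\beta^*+\epsilon$ with fixed $\beta^*\in\mathbb R^p$ of support $z^*$, $k=\|\beta^*\|_0=|z^*|$. Models $z\in\{0,1\}^p$ are identified with subsets of $[p]$. Let $\sigma>0$, $\delta>0$, $q\in(0,1)$ with $$\frac{q}{1-q}=\frac1{p^{\delta+1}},\qquad \tau_1=\frac{\sigma p}{\sqrt n},\qquad \tau_0=\frac{\sigma}{\sqrt n},$$ and consider the sparsified-likelihood posterior $$\pi(\beta,z\mid y)\propto \mathcal N(y;X_z\beta_z,\sigma^2I_n)\prod_{j\in z}q\,\mathcal N(\beta_j;0,\tau_1^2)\prod_{j\notin z}(1-q)\,\mathcal N(\beta_j;0,\tau_0^2).$$ The lazy blocked Gibbs sampler has the transition kernel $$K(\beta,\cdot)=\sum_{z}\pi(z\mid\beta,y)\bigl(\tfrac12\delta_\beta+\tfrac12\pi(\cdot\mid z,y)\bigr).$$ Put $A_z=I_n+\frac{\tau_1^2}{\sigma^2}X_zX_z^\top$ and $$\mathcal C(m)=\max_{\|z\|_0\le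 m}\ \max_{j\ne i,\ j\notin z}|X_j^\top A_z^{-1}X_i|,\qquad \omega(m)=\min\bigl\{(Xv)^\top A_z^{-1}Xv:\ \|z\|_0\le m,\ \mathrm{supp}(v)\cap z=\emptyset,\ \|v\|_0\le m,\ \|v\|_2=1\bigr\}.$$ For an integer $s\ge 0$ let $\mathcal E_s$ be the event (for the noise $\epsilon$) that $\pi(z:\ z^*\subset z,\ \|z\|_0\le k+s\mid y)\ge 1-4p^{-\frac\delta2(s+1)}$, that $\pi(z^*\mid y)\ge\frac12$, and that $|\langle A_z^{-1}X_j,\epsilon\rangle|\le\sigma\sqrt{2(s+1)n\log p}$ for all $z\supset z^*$ with $\|z\|_0\le k+s$ and all $j\notin z$. Assume $\omega(k+s)>0$ and set $$\eta=\frac{\sigma}{\sqrt{\omega(k+s)}}+\frac{\sigma\sqrt{2(s+1)n\log p}+\|\beta^*\|_1\,\mathcal C(k+s)}{\omega(k+s)}.$$ **Claim 1 (convergence rate).** For every constant $c_0>0$ there is a constant $C>0$, depending on $c_0$ only, such that the following holds. Suppose that $\mathcal E_s$ occurs, that $|\beta^*_j|\ge c_0\,\sigma\sqrt{\log(p)/n}$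 for all $j\in z^*$, and that the chain is started from $\pi_0=\pi(\beta\mid z_0,y)$ with $z_0\supset z^*$ and at most $t\ge 0$ false positives, $|z_0\setminus z^*|\le t$, where for the tolerance $\zeta_0\in(0,1)$ $$\Bigl(\frac1p\Bigr)^{2(1+\delta)t}\Bigl(\frac1{1+tp^2}\Bigr)^t\ \ge\ \frac{20}{p^{\frac\delta2(s+1)}\zeta_0^2}.$$ Then $\|\pi_0K^N-\pi(\beta\mid y)\|_{\mathrm{TV}}\le\zeta_0$ for every number of steps $$N\ \ge\ C\,(s+1)\,p^{(1+\delta)t}(1+tp^2)^{t/2}\exp\Bigl(\frac{ns^2}{\sigma^2}\eta^2+\frac{2\sqrt{n\log p}}{\sigma}\eta+\frac{n}{2\sigma^2}\eta^2\Bigr)\log\frac1{\zeta_0}.$$ If $s=0$ and $\delta=1$, then the same conclusion also holds for every $$N\ \ge\ C\,p^{2t}(1+tp^2)^{t/2}\exp\Bigl(\Bigl(\tfrac{\sqrt n}{\sqrt{\omega(k)}}\vee\tfrac{n^2}{\omega(k)^2}\Bigr)\log p+\Bigl(\tfrac{k\,\mathcal C(k)}{\omega(k)}\vee\tfrac{k^2\mathcal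 C(k)^2}{\omega(k)^2}\Bigr)\log p\Bigr)\log\frac1{\zeta_0}.$$ **Claim 2 (cost of an iteration).** In a non-lazy iteration from a model $z$, let the active coefficients be drawn from $\pi(\beta_z\mid z,y)$ as follows: draw $r\sim\mathcal N(0,\frac{\tau_1^2}{\sigma^2}I)$ and $\zeta\sim\mathcal N(0,I_n)$, set $v=X_zr+\zeta$, form $A_z$ by direct matrix multiplication and invert it by Gauss–Jordan elimination, set $u=A_z^{-1}(y/\sigma-v)$, and return $\sigma(r+\frac{\tau_1^2}{\sigma^2}X_z^\top u)$. Count one unit per real arithmetic operation and per scalar normal draw. With absolute constants $c',C'>0$, this procedure computes the stated vector, costs at most $C'\max\{n^2\|z\|_0,n^3\}$ and, whenever $z^*\subset z$, at least $c'\max\{n^2k,n^3\}$ (so the whole iteration costs at least that much). -/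

import Mathlib

open MeasureTheory ProbabilityTheory Matrix
open scoped ENNReal BigOperators

noncomputable section

namespace SpikeSlab

/-- Total variation distance `sup_A |μ(A) - ν(A)|` over measurable sets `A`. -/
def tvDist {Ω : Type*} [MeasurableSpace Ω] (μ ν : Measure Ω) : ℝ :=
  sSup {d : ℝ | ∃ A : Set Ω, MeasurableSet A ∧ d = |μ.real A - ν.real A|}

/-- Design matrix, noise level, spike and slab standard deviations, prior inclusion
probability. A model `z ∈ {0,1}^p` is represented by its set of active coordinates,
a `Finset (Fin p)`, so that `‖z‖₀` is `z.card`. -/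
structure Design (n p : ℕ) where
  X : Matrix (Fin n) (Fin p) ℝ
  σ : ℝ
  τ₀ : ℝ
  τ₁ : ℝ
  q : ℝ

/-- The `n × ‖z‖₀` matrix of active columns. -/
def activeCols {n p : ℕ} (X : Matrix (Fin n) (Fin p) ℝ) (z : Finset (Fin p)) :
    Matrix (Fin n) z ℝ :=
  X.submatrix id (fun j : z => (j : Fin p))

namespace Design

variable {n p : ℕ} (D : Design n p)

/-- The density at `x` of the centred or shifted normal law `N(m, τ²)` on `ℝ`. -/
def normalDensity (m τ x : ℝ) : ℝ := gaussianPDFReal m (Real.toNNReal (τ ^ 2)) x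

/-- The unnormalised posterior density of `(β, z)` with the sparsified likelihood:
`N(y; X_z β_z, σ² I_n) ∏_{j ∈ z} q N(β_j; 0, τ₁²) ∏_{j ∉ z} (1 - q) N(β_j; 0, τ₀²)`. -/
def joint (y : Fin n → ℝ) (z : Finset (Fin p)) (β : Fin p → ℝ) : ℝ :=
  (∏ i, normalDensity (∑ j ∈ z, D.X i j * β j) D.σ (y i)) *
    ((∏ j ∈ z, D.q * normalDensity 0 D.τ₁ (β j)) *
      ∏ j ∈ zᶜ, (1 - D.q) * normalDensity 0 D.τ₀ (β j))

/-- The unnormalised posterior weight of a model. -/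
def mass (y : Fin n → ℝ) (z : Finset (Fin p)) : ℝ := ∫ β : Fin p → ℝ, D.joint y z β

/-- `π(z | y)`. -/
def modelProb (y : Fin n → ℝ) (z : Finset (Fin p)) : ℝ :=
  D.mass y z / ∑ z' : Finset (Fin p), D.mass y z'

/-- `π(z | β, y)`. -/
def modelGivenBeta (y : Fin n → ℝ) (β : Fin p → ℝ) (z : Finset (Fin p)) : ℝ :=
  D.joint y z β / ∑ z' : Finset (Fin p), D.joint y z' β

/-- `π(β | z, y)`, as a measure on `ℝ^p`. -/
def betaGivenModel (y : Fin n → ℝ) (z : Finset (Fin p)) : Measure (Fin p → ℝ) :=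
  volume.withDensity fun β => ENNReal.ofReal (D.joint y z β / D.mass y z)

/-- The target `π(β | y)`, as a measure on `ℝ^p`. -/
def betaPosterior (y : Fin n → ℝ) : Measure (Fin p → ℝ) :=
  volume.withDensity fun β => ENNReal.ofReal
    ((∑ z : Finset (Fin p), D.joint y z β) / ∑ z : Finset (Fin p), D.mass y z)

lemma measurable_joint (y : Fin n → ℝ) (z : Finset (Fin p)) : Measurable (D.joint y z) := by
  unfold joint normalDensity gaussianPDFReal
  fun_prop

lemma measurable_modelGivenBeta (y : Fin n → ℝ) (z : Finset (Fin p)) :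
    Measurable fun β => D.modelGivenBeta y β z :=
  (D.measurable_joint y z).div
    (Finset.measurable_sum _ fun z' _ => D.measurable_joint y z')

/-- The lazy blocked Gibbs kernel
`K(β, ·) = ∑_z π(z | β, y) (½ δ_β + ½ π(· | z, y))`. -/
def gibbsKernel (y : Fin n → ℝ) : Kernel (Fin p → ℝ) (Fin p → ℝ) where
  toFun β := ∑ z : Finset (Fin p), ENNReal.ofReal (D.modelGivenBeta y β z) •
    ((2⁻¹ : ℝ≥0∞) • Measure.dirac β + (2⁻¹ : ℝ≥0∞) • D.betaGivenModel y z)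
  measurable' := by
    refine Measure.measurable_of_measurable_coe _ fun A hA => ?_
    simp only [Measure.coe_finsetSum, Finset.sum_apply, Measure.smul_apply, Measure.add_apply,
      smul_eq_mul]
    refine Finset.measurable_sum _ fun z _ => ?_
    refine (D.measurable_modelGivenBeta y z).ennreal_ofReal.mul ?_
    exact ((Measure.measurable_coe hA).comp Measure.measurable_dirac |>.const_mul _).add_const _

/-- The law `π₀ K^N` of the coefficients after `N` steps. -/
def gibbsLaw (y : Fin n → ℝ) (π₀ : Measure (Fin p → ℝ)) (N : ℕ) : Measure (Fin p → ℝ) :=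
  (fun μ => μ.bind (D.gibbsKernel y))^[N] π₀

/-- `I_n + (τ₁² / σ²) X_z X_zᵀ`. -/
def A (z : Finset (Fin p)) : Matrix (Fin n) (Fin n) ℝ :=
  1 + (D.τ₁ ^ 2 / D.σ ^ 2) • (activeCols D.X z * (activeCols D.X z)ᵀ)

/-- The coherence `C(m)`. -/
def coherence (m : ℕ) : ℝ :=
  sSup {c : ℝ | ∃ (z : Finset (Fin p)) (i j : Fin p), z.card ≤ m ∧ j ≠ i ∧ j ∉ z ∧
    c = |D.X.col j ⬝ᵥ ((D.A z)⁻¹ *ᵥ D.X.col i)|}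

/-- The restricted eigenvalue `ω(m)`: the least value of
`vᵀ X_{1-z}ᵀ (I_n + (τ₁²/σ²) X_z X_zᵀ)⁻¹ X_{1-z} v` over models `z` with `‖z‖₀ ≤ m` and
Euclidean unit vectors `v` supported off `z` with `‖v‖₀ ≤ m`. -/
def restrictedEigenvalue (m : ℕ) : ℝ :=
  sInf {e : ℝ | ∃ (z : Finset (Fin p)) (v : Fin p → ℝ), z.card ≤ m ∧ (∀ j ∈ z, v j = 0) ∧
    (Finset.univ.filter fun j => v j ≠ 0).card ≤ m ∧ ∑ j, v j ^ 2 = 1 ∧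
    e = (D.X *ᵥ v) ⬝ᵥ ((D.A z)⁻¹ *ᵥ (D.X *ᵥ v))}

/-- The support of a coefficient vector, i.e. the model `z*` when applied to `β*`. -/
def supp (β : Fin p → ℝ) : Finset (Fin p) := Finset.univ.filter fun j => β j ≠ 0

/-- The event `𝓔_s`, as a set of noise vectors `ε`, for data `y = X β* + ε`. -/
def event (βs : Fin p → ℝ) (s : ℕ) (δ : ℝ) : Set (Fin n → ℝ) :=
  {ε | 1 - 4 / (p : ℝ) ^ (δ / 2 * (s + 1)) ≤
        ∑ z ∈ Finset.univ.filter (fun z : Finset (Fin p) =>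
          supp βs ⊆ z ∧ z.card ≤ (supp βs).card + s), D.modelProb (D.X *ᵥ βs + ε) z ∧
      1 / 2 ≤ D.modelProb (D.X *ᵥ βs + ε) (supp βs) ∧
      ∀ z : Finset (Fin p), supp βs ⊆ z → z.card ≤ (supp βs).card + s → ∀ j, j ∉ z →
        |((D.A z)⁻¹ *ᵥ D.X.col j) ⬝ᵥ ε| ≤ D.σ * √(2 * (s + 1) * n * Real.log p)}

/-- The prior scaling and the normalisation of the columns. -/
structure Scaling (δ : ℝ) : Prop where
  odds : D.q / (1 - D.q) = 1 / (p : ℝ) ^ (δ + 1)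
  slab : D.τ₁ = D.σ * p / √n
  spike : D.τ₀ = D.σ / √n
  cols : ∀ j, ∑ i, D.X i j ^ 2 = n

/-- The `β`-min condition with constant `c`. -/
def BetaMin (c : ℝ) (βs : Fin p → ℝ) : Prop :=
  ∀ j ∈ supp βs, c * (D.σ * √(Real.log p / n)) ≤ |βs j|

/-- `η = σ/√ω + (σ √(2(s+1) n log p) + ‖β*‖₁ C)/ω`, with `C`, `ω` taken at `‖β*‖₀ + s`. -/
def eta (βs : Fin p → ℝ) (s : ℕ) : ℝ :=
  D.σ / √(D.restrictedEigenvalue ((supp βs).card + s)) +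
    (D.σ * √(2 * (s + 1) * n * Real.log p) +
      (∑ j, |βs j|) * D.coherence ((supp βs).card + s)) /
        D.restrictedEigenvalue ((supp βs).card + s)

end Design

/-- A value computed together with the number of elementary operations spent on it. -/
structure Counted (α : Type) where
  val : α
  cost : ℕ

namespace Counted

instance : Monad Counted where
  pure a := ⟨a, 0⟩
  bind x f := ⟨(f x.val).val, x.cost + (f x.val).cost⟩

/-- The elementary operations, at unit cost: real arithmetic, and one normal draw (`x` is the
value drawn). -/
def add (a b : ℝ) : Counted ℝ := ⟨a + b, 1⟩
def sub (a b : ℝ) : Counted ℝ := ⟨a - b, 1⟩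
def mul (a b : ℝ) : Counted ℝ := ⟨a * b, 1⟩
def div (a b : ℝ) : Counted ℝ := ⟨a / b, 1⟩
def draw (x : ℝ) : Counted ℝ := ⟨x, 1⟩

/-- Compute all entries of a table, one after the other. -/
def forAll {ι α : Type} [Fintype ι] (f : ι → Counted α) : Counted (ι → α) :=
  ⟨fun i => (f i).val, ∑ i, (f i).cost⟩

/-- Add up all entries of a vector, one addition per entry. -/
def sumAll {ι : Type} [Fintype ι] (v : ι → ℝ) : Counted ℝ := ⟨∑ i, v i, Fintype.card ι⟩

def dot {ι : Type} [Fintype ι] (u v : ι → ℝ) : Counted ℝ := do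
  let w ← forAll fun i => mul (u i) (v i)
  sumAll w

def mulVec {ι κ : Type} [Fintype ι] [Fintype κ] (B : ι → κ → ℝ) (v : κ → ℝ) :
    Counted (ι → ℝ) :=
  forAll fun i => dot (B i) v

/-- One in-place Gauss–Jordan step with pivot `k`. -/
def pivotStep {n : ℕ} (B : Fin n → Fin n → ℝ) (k : Fin n) : Counted (Fin n → Fin n → ℝ) :=
  forAll fun i => forAll fun j =>
    if i = k then
      if j = k then div 1 (B k k) else do
        let a ← div (B k j) (B k k)
        sub 0 a
    else
      if j = k then div (B i k) (B k k) else do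
        let a ← mul (B i k) (B k j)
        let b ← div a (B k k)
        sub (B i j) b

/-- Gauss–Jordan inversion (without pivot search, as for positive definite matrices). -/
def invert {n : ℕ} (B : Fin n → Fin n → ℝ) : Counted (Fin n → Fin n → ℝ) :=
  (List.finRange n).foldlM pivotStep B

end Counted

open Counted in
/-- The draw of the active coefficients of `π(β | z, y)`, i.e. from
`N(Σ⁻¹ X̄ᵀ y, σ² Σ⁻¹)` with `X̄ = X_z` and `Σ = X̄ᵀ X̄ + D`, `D = (σ²/τ₁²) I`:
draw `r ~ N(0, D⁻¹)` and `ζ ~ N(0, I_n)`, set `v = X̄ r + ζ`, form and invert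
`I_n + X̄ D⁻¹ X̄ᵀ`, set `u = (I_n + X̄ D⁻¹ X̄ᵀ)⁻¹ (y/σ - v)`, return `σ (r + D⁻¹ X̄ᵀ u)`.
The arguments `r`, `ζ` are the values drawn. -/
def sampleActive {n p : ℕ} (D : Design n p) (y : Fin n → ℝ) (z : Finset (Fin p))
    (r : z → ℝ) (ζ : Fin n → ℝ) : Counted (z → ℝ) := do
  let r ← forAll fun j => draw (r j)
  let ζ ← forAll fun i => draw (ζ i)
  let a ← mul D.τ₁ D.τ₁
  let b ← mul D.σ D.σ
  let d ← div a b
  let w ← mulVec (activeCols D.X z) r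
  let v ← forAll fun i => add (w i) (ζ i)
  let Y ← forAll fun i => forAll fun j => mul d (activeCols D.X z i j)
  let M ← forAll fun i => forAll fun i' => do
    let g ← dot (Y i) (activeCols D.X z i')
    add (if i = i' then 1 else 0) g
  let R ← invert M
  let h ← forAll fun i => do
    let c ← div (y i) D.σ
    sub c (v i)
  let u ← mulVec R h
  let x ← mulVec (fun j i => Y i j) u
  forAll fun j => do
    let c ← add (r j) (x j)
    mul D.σ c

end SpikeSlab

end

/-! The posterior of the coefficients is a mixture of the laws `betaGivenModel` over models, and the
lazy Gibbs kernel is reversible with respect to it. If a law has density `f` relative to the target,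
one step therefore replaces `f` by half of itself plus half of the posterior average of its
component means. By Jensen the second moment of `f` drops by at least half of the weighted variance
within components (`second_moment_step_le`).

A Poincaré inequality with an additive error turns this drop into geometric decay (`variance_le`).
The variance between components is compared with the mean under the single model `z*`, which has
weight at least 1/2. For a good model, one containing `z*` with at most `k + s` elements, the
difference of the two means is controlled by the two within-component variances and the
Bhattacharyya overlap of the two laws (`sq_mean_sub_mul_sq_overlap_le`). The remaining models have
total mass at most `e`, and since `f` is bounded by `B` they cost at most `B ^ 2 * e`. The initial
law has density at most the inverse of the posterior weight of `z₀`, and the condition on the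
tolerance makes this error harmless.

The overlap comes from Gaussian computations. Integrating out the coefficients in `z*` by completing
the square leaves a product prior on the other coefficients, tilted by the exponential of a linear
form minus a quadratic form. Bounding the quadratic form by multiples of the squared norm (the
restricted eigenvalue from below, column norms and Cauchy–Schwarz from above) makes the integrals
factor into one-dimensional ones. In the squared overlap the prior odds and the powers of `p`
cancel, and what remains is at least `exp (-n s² η² / σ²)` (`Scaling.sq_mean_sub_le`). The other
factors in the stated numbers of steps are at least 1.

For the cost, `A z` is positive definite, so Gauss–Jordan elimination meets only positive pivots.
Forming `A z` takes of order `n² |z|` operations and inverting it of order `n³`; the rest is of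
lower order. -/

noncomputable section

/-! ### Variance inequalities and mixing of the lazy Gibbs chain on an abstract mixture. -/

namespace SpikeSlab

/-- Cauchy–Schwarz for real integrals. -/
lemma sq_integral_mul_le {Ω : Type*} [MeasurableSpace Ω] {μ : Measure Ω} {a b : Ω → ℝ}
    (ha : Integrable (fun x => a x ^ 2) μ) (hb : Integrable (fun x => b x ^ 2) μ)
    (hab : Integrable (fun x => a x * b x) μ) :
    (∫ x, a x * b x ∂μ) ^ 2 ≤ (∫ x, a x ^ 2 ∂μ) * ∫ x, b x ^ 2 ∂μ := by
  -- The integral of `(t a + b) ^ 2` is a nonnegative quadratic in `t`, so its discriminant is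
  -- nonpositive.
  have key : ∀ t : ℝ, 0 ≤ (∫ x, a x ^ 2 ∂μ) * (t * t) + (2 * ∫ x, a x * b x ∂μ) * t
      + ∫ x, b x ^ 2 ∂μ := by
    intro t
    have h : ∫ x, (t * a x + b x) ^ 2 ∂μ = (∫ x, a x ^ 2 ∂μ) * (t * t)
        + (2 * ∫ x, a x * b x ∂μ) * t + ∫ x, b x ^ 2 ∂μ := by
      have : (fun x => (t * a x + b x) ^ 2) =
          fun x => (t * t) * a x ^ 2 + (2 * t) * (a x * b x) + b x ^ 2 := by
        ext x; ring
      have h1 : Integrable (fun x => (t * t) * a x ^ 2) μ := ha.const_mul _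
      have h2 : Integrable (fun x => (2 * t) * (a x * b x)) μ := hab.const_mul _
      have h3 : Integrable (fun x => (t * t) * a x ^ 2 + (2 * t) * (a x * b x)) μ := h1.add h2
      rw [this, integral_add h3 hb, integral_add h1 h2, integral_const_mul, integral_const_mul]
      ring
    rw [← h]
    exact integral_nonneg fun x => sq_nonneg _
  have := discrim_le_zero key
  rw [discrim] at this
  nlinarith

lemma integrable_of_mem_Icc {Ω : Type*} [MeasurableSpace Ω] {μ : Measure Ω} [IsFiniteMeasure μ]
    {f : Ω → ℝ} {B : ℝ} (hf : Measurable f) (h0 : ∀ x, 0 ≤ f x) (hB : ∀ x, f x ≤ B) :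
    Integrable f μ :=
  Integrable.of_bound hf.aestronglyMeasurable B
    (.of_forall fun x => by rw [Real.norm_of_nonneg (h0 x)]; exact hB x)

lemma integrable_sq_of_mem_Icc {Ω : Type*} [MeasurableSpace Ω] {μ : Measure Ω}
    [IsFiniteMeasure μ] {f : Ω → ℝ} {B : ℝ} (hf : Measurable f) (h0 : ∀ x, 0 ≤ f x)
    (hB : ∀ x, f x ≤ B) : Integrable (fun x => f x ^ 2) μ :=
  integrable_of_mem_Icc (B := B ^ 2) (hf.pow_const 2) (fun _ => sq_nonneg _)
    fun x => pow_le_pow_left₀ (h0 x) (hB x) 2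

lemma integral_sub_const_sq {Ω : Type*} [MeasurableSpace Ω] {μ : Measure Ω}
    [IsProbabilityMeasure μ] {f : Ω → ℝ} (hf : Integrable f μ)
    (hf2 : Integrable (fun x => f x ^ 2) μ) (c : ℝ) :
    ∫ x, (f x - c) ^ 2 ∂μ = ∫ x, f x ^ 2 ∂μ - 2 * c * ∫ x, f x ∂μ + c ^ 2 := by
  have : (fun x => (f x - c) ^ 2) = fun x => f x ^ 2 - (2 * c) * f x + c ^ 2 := by
    ext x; ring
  have h1 : Integrable (fun x => (2 * c) * f x) μ := hf.const_mul _
  have h2 : Integrable (fun x => f x ^ 2 - (2 * c) * f x) μ := hf2.sub h1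
  rw [this, integral_add h2 (integrable_const _), integral_sub hf2 h1, integral_const_mul]
  simp

lemma integrable_sub_const_sq {Ω : Type*} [MeasurableSpace Ω] {μ : Measure Ω}
    [IsProbabilityMeasure μ] {f : Ω → ℝ} (hf : Integrable f μ)
    (hf2 : Integrable (fun x => f x ^ 2) μ) (c : ℝ) :
    Integrable (fun x => (f x - c) ^ 2) μ := by
  have : (fun x => (f x - c) ^ 2) = fun x => f x ^ 2 - (2 * c) * f x + c ^ 2 := by
    ext x; ring
  rw [this]
  exact (hf2.sub (hf.const_mul _)).add (integrable_const _)

/-- The means of a function under two densities are close when its variances are small and the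
densities overlap, the overlap being measured by the Bhattacharyya coefficient. -/
lemma sq_mean_sub_mul_sq_overlap_le {Ω : Type*} [MeasurableSpace Ω] {μ : Measure Ω}
    {g₁ g₂ f : Ω → ℝ} (hg₁ : Measurable g₁) (hg₂ : Measurable g₂)
    (h₁ : ∀ x, 0 ≤ g₁ x) (h₂ : ∀ x, 0 ≤ g₂ x) (hi₁ : Integrable g₁ μ) (hi₂ : Integrable g₂ μ)
    (hu₁ : ∫ x, g₁ x ∂μ = 1) (hu₂ : ∫ x, g₂ x ∂μ = 1)
    (hf : Measurable f) {B : ℝ} (hB : ∀ x, |f x| ≤ B) (m₁ m₂ : ℝ) :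
    (m₁ - m₂) ^ 2 * (∫ x, √(g₁ x * g₂ x) ∂μ) ^ 2 ≤
      2 * ((∫ x, g₁ x * (f x - m₁) ^ 2 ∂μ) + ∫ x, g₂ x * (f x - m₂) ^ 2 ∂μ) := by
  have bdd : ∀ m x, ‖f x - m‖ ≤ B + |m| := fun m x => by
    rw [Real.norm_eq_abs]; exact (abs_sub _ _).trans (by linarith [hB x])
  have bdd2 : ∀ m x, ‖(f x - m) ^ 2‖ ≤ (B + |m|) ^ 2 := fun m x => by
    rw [norm_pow]; exact pow_le_pow_left₀ (norm_nonneg _) (bdd m x) 2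
  have hρ : Integrable (fun x => √(g₁ x * g₂ x)) μ := by
    refine Integrable.mono' (hi₁.add hi₂) (by fun_prop) (.of_forall fun x => ?_)
    rw [Real.norm_of_nonneg (Real.sqrt_nonneg _)]
    refine Real.sqrt_le_iff.2 ⟨add_nonneg (h₁ x) (h₂ x), ?_⟩
    have := h₁ x; have := h₂ x
    simp only [Pi.add_apply]
    nlinarith [mul_nonneg (h₁ x) (h₂ x)]
  have hρf : ∀ m, Integrable (fun x => √(g₁ x * g₂ x) * (f x - m)) μ := fun m =>
    hρ.mul_bdd (hf.sub_const m).aestronglyMeasurable (.of_forall (bdd m))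
  have hv₁ : Integrable (fun x => g₁ x * (f x - m₁) ^ 2) μ :=
    hi₁.mul_bdd ((hf.sub_const m₁).pow_const 2).aestronglyMeasurable (.of_forall (bdd2 m₁))
  have hv₂ : Integrable (fun x => g₂ x * (f x - m₂) ^ 2) μ :=
    hi₂.mul_bdd ((hf.sub_const m₂).pow_const 2).aestronglyMeasurable (.of_forall (bdd2 m₂))
  have e₁ : (fun x => (√(g₁ x) * (f x - m₁)) ^ 2) = fun x => g₁ x * (f x - m₁) ^ 2 := by
    ext x; rw [mul_pow, Real.sq_sqrt (h₁ x)]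
  have e₂ : (fun x => (√(g₂ x) * (f x - m₂)) ^ 2) = fun x => g₂ x * (f x - m₂) ^ 2 := by
    ext x; rw [mul_pow, Real.sq_sqrt (h₂ x)]
  have s₁ : (fun x => √(g₁ x) ^ 2) = g₁ := by ext x; exact Real.sq_sqrt (h₁ x)
  have s₂ : (fun x => √(g₂ x) ^ 2) = g₂ := by ext x; exact Real.sq_sqrt (h₂ x)
  have c₁ := sq_integral_mul_le (μ := μ) (a := fun x => √(g₁ x) * (f x - m₁))
    (b := fun x => √(g₂ x)) (by rw [e₁]; exact hv₁) (by rw [s₂]; exact hi₂)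
    ((hρf m₁).congr (.of_forall fun x => by
      simp only [Real.sqrt_mul (h₁ x)]; ring))
  have c₂ := sq_integral_mul_le (μ := μ) (a := fun x => √(g₂ x) * (f x - m₂))
    (b := fun x => √(g₁ x)) (by rw [e₂]; exact hv₂) (by rw [s₁]; exact hi₁)
    ((hρf m₂).congr (.of_forall fun x => by
      simp only [Real.sqrt_mul (h₁ x)]; ring))
  rw [e₁, s₂, hu₂, mul_one] at c₁
  rw [e₂, s₁, hu₁, mul_one] at c₂
  have i₁ : ∫ x, √(g₁ x) * (f x - m₁) * √(g₂ x) ∂μ = ∫ x, √(g₁ x * g₂ x) * (f x - m₁) ∂μ :=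
    integral_congr_ae (.of_forall fun x => by
      show _ = √(g₁ x * g₂ x) * (f x - m₁); rw [Real.sqrt_mul (h₁ x)]; ring)
  have i₂ : ∫ x, √(g₂ x) * (f x - m₂) * √(g₁ x) ∂μ = ∫ x, √(g₁ x * g₂ x) * (f x - m₂) ∂μ :=
    integral_congr_ae (.of_forall fun x => by
      show _ = √(g₁ x * g₂ x) * (f x - m₂); rw [Real.sqrt_mul (h₁ x)]; ring)
  rw [i₁] at c₁
  rw [i₂] at c₂
  -- The mean difference times the overlap is a difference of two overlap-weighted integrals.
  -- Cauchy–Schwarz bounds the square of each by one variance, because the other density has mass 1;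
  -- the factor 2 is `(u - v) ^ 2 ≤ 2 * (u ^ 2 + v ^ 2)`.
  have hd : (m₁ - m₂) * ∫ x, √(g₁ x * g₂ x) ∂μ =
      (∫ x, √(g₁ x * g₂ x) * (f x - m₂) ∂μ) - ∫ x, √(g₁ x * g₂ x) * (f x - m₁) ∂μ := by
    rw [← integral_sub (hρf m₂) (hρf m₁), ← integral_const_mul]
    exact integral_congr_ae (.of_forall fun x => by ring)
  rw [← mul_pow, hd]
  nlinarith [sq_nonneg ((∫ x, √(g₁ x * g₂ x) * (f x - m₂) ∂μ) +
    ∫ x, √(g₁ x * g₂ x) * (f x - m₁) ∂μ)]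

/-- A mixture of the probability measures `ν z` with weights `w z` and posterior component
probabilities `r z`. -/
structure Mixture (ι Ω : Type*) [Fintype ι] [MeasurableSpace Ω] where
  w : ι → ℝ
  ν : ι → Measure Ω
  r : ι → Ω → ℝ
  target : Measure Ω
  prob : ∀ z, IsProbabilityMeasure (ν z)
  w_nonneg : ∀ z, 0 ≤ w z
  sum_w : ∑ z, w z = 1
  measurable_r : ∀ z, Measurable (r z)
  r_nonneg : ∀ z x, 0 ≤ r z x
  sum_r : ∀ x, ∑ z, r z x = 1
  bayes : ∀ z, target.withDensity (fun x => ENNReal.ofReal (r z x)) = ENNReal.ofReal (w z) • ν z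

namespace Mixture

variable {ι Ω : Type*} [Fintype ι] [MeasurableSpace Ω] (M : Mixture ι Ω)

instance (z : ι) : IsProbabilityMeasure (M.ν z) := M.prob z

lemma r_le_one (z : ι) (x : Ω) : M.r z x ≤ 1 :=
  (M.sum_r x) ▸ Finset.single_le_sum (fun z _ => M.r_nonneg z x) (Finset.mem_univ z)

lemma target_eq : M.target = ∑ z, ENNReal.ofReal (M.w z) • M.ν z := by
  simp_rw [← M.bayes]
  ext A hA
  rw [Measure.coe_finsetSum, Finset.sum_apply]
  simp_rw [withDensity_apply _ hA]
  rw [← lintegral_finsetSum _ fun z _ => (M.measurable_r z).ennreal_ofReal]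
  simp_rw [← ENNReal.ofReal_sum_of_nonneg fun z _ => M.r_nonneg z _, M.sum_r]
  simp

instance : IsProbabilityMeasure M.target := ⟨by
  rw [target_eq, Measure.coe_finsetSum, Finset.sum_apply]
  simp [← ENNReal.ofReal_sum_of_nonneg fun z _ => M.w_nonneg z, M.sum_w]⟩

lemma integral_target {f : Ω → ℝ} (hf : ∀ z, Integrable f (M.ν z)) :
    ∫ x, f x ∂M.target = ∑ z, M.w z * ∫ x, f x ∂M.ν z := by
  rw [target_eq, integral_finsetSum_measure fun z _ =>
    (hf z).smul_measure ENNReal.ofReal_ne_top]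
  refine Finset.sum_congr rfl fun z _ => ?_
  rw [integral_smul_measure, ENNReal.toReal_ofReal (M.w_nonneg z), smul_eq_mul]

/-- Bayes' rule in integrated form. This is what makes the kernel reversible: weighting the target
by `r z` and integrating returns the component `z`. -/
lemma lintegral_r_mul (z : ι) {f : Ω → ℝ≥0∞} (hf : Measurable f) :
    ∫⁻ x, ENNReal.ofReal (M.r z x) * f x ∂M.target = ENNReal.ofReal (M.w z) * ∫⁻ x, f x ∂M.ν z := by
  rw [← smul_eq_mul, ← lintegral_smul_measure, ← M.bayes,
    lintegral_withDensity_eq_lintegral_mul _ (M.measurable_r z).ennreal_ofReal hf]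
  rfl

lemma integral_r (z : ι) : ∫ x, M.r z x ∂M.target = M.w z := by
  rw [integral_eq_lintegral_of_nonneg_ae (.of_forall (M.r_nonneg z))
    (M.measurable_r z).aestronglyMeasurable]
  have := M.lintegral_r_mul z (f := fun _ => 1) measurable_const
  simp only [mul_one, lintegral_const, measure_univ] at this
  rw [this, ENNReal.toReal_ofReal (M.w_nonneg z)]

/-- The action of the lazy Gibbs kernel on densities relative to the target. -/
def step (f : Ω → ℝ) (x : Ω) : ℝ := 2⁻¹ * f x + 2⁻¹ * ∑ z, M.r z x * ∫ x', f x' ∂M.ν z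

/-- Densities bounded by `B`. -/
structure IsDensity (B : ℝ) (f : Ω → ℝ) : Prop where
  meas : Measurable f
  nonneg : ∀ x, 0 ≤ f x
  le : ∀ x, f x ≤ B
  one : ∫ x, f x ∂M.target = 1

variable {M} {B : ℝ} {f : Ω → ℝ}

namespace IsDensity

lemma integrable (h : M.IsDensity B f) (μ : Measure Ω) [IsFiniteMeasure μ] : Integrable f μ :=
  integrable_of_mem_Icc h.meas h.nonneg h.le

lemma integrable_sq (h : M.IsDensity B f) (μ : Measure Ω) [IsFiniteMeasure μ] :
    Integrable (fun x => f x ^ 2) μ :=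
  integrable_sq_of_mem_Icc h.meas h.nonneg h.le

lemma mean_nonneg (h : M.IsDensity B f) (z : ι) : 0 ≤ ∫ x, f x ∂M.ν z :=
  integral_nonneg h.nonneg

lemma mean_le (h : M.IsDensity B f) (z : ι) : ∫ x, f x ∂M.ν z ≤ B := by
  simpa using integral_mono (h.integrable (M.ν z)) (integrable_const B) h.le

lemma sum_mean (h : M.IsDensity B f) : ∑ z, M.w z * ∫ x, f x ∂M.ν z = 1 := by
  rw [← M.integral_target fun z => h.integrable _, h.one]

lemma step (h : M.IsDensity B f) : M.IsDensity B (M.step f) where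
  meas := by
    have := M.measurable_r
    unfold Mixture.step
    exact (h.meas.const_mul _).add ((Finset.measurable_sum _ fun z _ =>
      (M.measurable_r z).mul_const _).const_mul _)
  nonneg x := by
    have h1 : 0 ≤ ∑ z, M.r z x * ∫ x', f x' ∂M.ν z :=
      Finset.sum_nonneg fun z _ => mul_nonneg (M.r_nonneg z x) (h.mean_nonneg z)
    have := h.nonneg x
    unfold Mixture.step
    positivity
  le x := by
    have h1 : ∑ z, M.r z x * ∫ x', f x' ∂M.ν z ≤ ∑ z, M.r z x * B :=
      Finset.sum_le_sum fun z _ => mul_le_mul_of_nonneg_left (h.mean_le z) (M.r_nonneg z x)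
    rw [← Finset.sum_mul, M.sum_r, one_mul] at h1
    have := h.le x
    unfold Mixture.step
    linarith
  one := by
    have hr : ∀ z, Integrable (fun x => M.r z x * ∫ x', f x' ∂M.ν z) M.target := fun z =>
      (integrable_of_mem_Icc (M.measurable_r z) (M.r_nonneg z) (M.r_le_one z)).mul_const _
    unfold Mixture.step
    rw [integral_add ((h.integrable _).const_mul _)
      ((integrable_finsetSum _ fun z _ => hr z).const_mul _), integral_const_mul,
      integral_const_mul, h.one, integral_finsetSum _ fun z _ => hr z]
    simp_rw [integral_mul_const, M.integral_r, h.sum_mean]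
    norm_num

/-- The variance of a density within a component. -/
lemma var_eq (h : M.IsDensity B f) (z : ι) :
    ∫ x, (f x - ∫ x', f x' ∂M.ν z) ^ 2 ∂M.ν z =
      ∫ x, f x ^ 2 ∂M.ν z - (∫ x, f x ∂M.ν z) ^ 2 := by
  rw [integral_sub_const_sq (h.integrable _) (h.integrable_sq _)]
  ring

/-- Convexity of the square is used twice: for the half-half average of staying and resampling, and
for the average over models. After integration the resampled half contributes the weighted squares
of the component means, which fall short of the second moment by exactly the within-component
variances. -/
lemma second_moment_step_le (h : M.IsDensity B f) :
    ∫ x, M.step f x ^ 2 ∂M.target ≤ ∫ x, f x ^ 2 ∂M.target -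
      2⁻¹ * ∑ z, M.w z * ∫ x, (f x - ∫ x', f x' ∂M.ν z) ^ 2 ∂M.ν z := by
  have hr : ∀ z, Integrable (fun x => M.r z x * (∫ x', f x' ∂M.ν z) ^ 2) M.target := fun z =>
    (integrable_of_mem_Icc (M.measurable_r z) (M.r_nonneg z) (M.r_le_one z)).mul_const _
  have hpt : ∀ x, M.step f x ^ 2 ≤ 2⁻¹ * f x ^ 2 +
      2⁻¹ * ∑ z, M.r z x * (∫ x', f x' ∂M.ν z) ^ 2 := by
    intro x
    have h1 : (∑ z, M.r z x * ∫ x', f x' ∂M.ν z) ^ 2 ≤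
        ∑ z, M.r z x * (∫ x', f x' ∂M.ν z) ^ 2 := by
      have := (convexOn_pow 2).map_sum_le (t := Finset.univ) (w := fun z => M.r z x)
        (p := fun z => ∫ x', f x' ∂M.ν z) (fun z _ => M.r_nonneg z x) (M.sum_r x)
        (fun z _ => h.mean_nonneg z)
      simpa [smul_eq_mul] using this
    unfold Mixture.step
    nlinarith [sq_nonneg (f x - ∑ z, M.r z x * ∫ x', f x' ∂M.ν z)]
  have h2 : ∫ x, M.step f x ^ 2 ∂M.target ≤ ∫ x, (2⁻¹ * f x ^ 2 +
      2⁻¹ * ∑ z, M.r z x * (∫ x', f x' ∂M.ν z) ^ 2) ∂M.target :=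
    integral_mono (h.step.integrable_sq _) (((h.integrable_sq _).const_mul _).add
      ((integrable_finsetSum _ fun z _ => hr z).const_mul _)) hpt
  rw [integral_add ((h.integrable_sq _).const_mul _)
      ((integrable_finsetSum _ fun z _ => hr z).const_mul _), integral_const_mul,
      integral_const_mul, integral_finsetSum _ fun z _ => hr z] at h2
  simp_rw [integral_mul_const, M.integral_r] at h2
  refine h2.trans (le_of_eq ?_)
  have h3 := M.integral_target fun z => h.integrable_sq (M.ν z)
  simp_rw [h.var_eq, mul_sub, Finset.sum_sub_distrib]
  rw [← h3]
  ring

/-- Poincaré inequality up to an error for a mixture whose components in `G` all overlap with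
the component `a`. -/
lemma variance_le (h : M.IsDensity B f) (G : Finset ι) {a : ι}
    (hwa : 1 / 2 ≤ M.w a) {R e : ℝ} (hR : 0 ≤ R)
    (hG : ∀ z ∈ G, (∫ x, f x ∂M.ν z - ∫ x, f x ∂M.ν a) ^ 2 ≤
      R * ((∫ x, (f x - ∫ x', f x' ∂M.ν z) ^ 2 ∂M.ν z) +
        ∫ x, (f x - ∫ x', f x' ∂M.ν a) ^ 2 ∂M.ν a))
    (hw : 1 - e ≤ ∑ z ∈ G, M.w z) :
    ∫ x, f x ^ 2 ∂M.target - 1 ≤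
      (1 + 3 * R) * ∑ z, M.w z * ∫ x, (f x - ∫ x', f x' ∂M.ν z) ^ 2 ∂M.ν z + B ^ 2 * e := by
  classical
  set m : ι → ℝ := fun z => ∫ x, f x ∂M.ν z with hm
  set V : ι → ℝ := fun z => ∫ x, (f x - m z) ^ 2 ∂M.ν z with hV
  have hV0 : ∀ z, 0 ≤ V z := fun z => integral_nonneg fun x => sq_nonneg _
  have hw0 := M.w_nonneg
  have hwV : ∀ z, M.w z * V z ≤ ∑ z, M.w z * V z := fun z =>
    Finset.single_le_sum (f := fun z => M.w z * V z)
      (fun z _ => mul_nonneg (hw0 z) (hV0 z)) (Finset.mem_univ z)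
  -- The weight of `a` is at least 1/2, so its own variance is at most twice the weighted total.
  have hVa : V a ≤ 2 * ∑ z, M.w z * V z := by
    have := hwV a
    nlinarith [hV0 a]
  have e1 : ∫ x, f x ^ 2 ∂M.target = ∑ z, M.w z * V z + ∑ z, M.w z * m z ^ 2 := by
    rw [M.integral_target fun z => h.integrable_sq _, ← Finset.sum_add_distrib]
    refine Finset.sum_congr rfl fun z _ => ?_
    have := h.var_eq z
    simp only [hV, hm]
    rw [this]; ring
  -- The component means average to 1, and a mean square deviation is least about the average;
  -- recentring at `m a` only increases it.
  have e2 : ∑ z, M.w z * m z ^ 2 - 1 ≤ ∑ z, M.w z * (m z - m a) ^ 2 := by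
    have : ∑ z, M.w z * (m z - m a) ^ 2 = ∑ z, M.w z * m z ^ 2 - 2 * m a * ∑ z, M.w z * m z
        + m a ^ 2 * ∑ z, M.w z := by
      rw [Finset.mul_sum, Finset.mul_sum, ← Finset.sum_sub_distrib, ← Finset.sum_add_distrib]
      exact Finset.sum_congr rfl fun z _ => by ring
    rw [this, h.sum_mean, M.sum_w]
    nlinarith [sq_nonneg (m a - 1)]
  -- The constant 3 is 1 for the variances of the `z` plus 2 for the variance at the common endpoint
  -- `a`.
  have e3 : ∑ z ∈ G, M.w z * (m z - m a) ^ 2 ≤ 3 * R * ∑ z, M.w z * V z := by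
    have h1 : ∑ z ∈ G, M.w z * (m z - m a) ^ 2 ≤ ∑ z ∈ G, M.w z * (R * (V z + V a)) :=
      Finset.sum_le_sum fun z hz => mul_le_mul_of_nonneg_left (hG z hz) (hw0 z)
    have h2 : ∑ z ∈ G, M.w z * (R * (V z + V a)) ≤ ∑ z, M.w z * (R * (V z + V a)) :=
      Finset.sum_le_sum_of_subset_of_nonneg (Finset.subset_univ G) fun z _ _ =>
        mul_nonneg (hw0 z) (mul_nonneg hR (add_nonneg (hV0 z) (hV0 a)))
    have h3 : ∑ z, M.w z * (R * (V z + V a)) = R * (∑ z, M.w z * V z) + R * V a * ∑ z, M.w z := by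
      rw [Finset.mul_sum, Finset.mul_sum, ← Finset.sum_add_distrib]
      exact Finset.sum_congr rfl fun z _ => by ring
    rw [M.sum_w] at h3
    nlinarith [mul_le_mul_of_nonneg_left hVa hR]
  -- Both means lie in `[0, B]`, so each squared difference is at most `B ^ 2`; the weight outside
  -- `G` is at most `e`.
  have e4 : ∑ z ∈ Gᶜ, M.w z * (m z - m a) ^ 2 ≤ B ^ 2 * e := by
    have h1 : ∑ z ∈ Gᶜ, M.w z * (m z - m a) ^ 2 ≤ ∑ z ∈ Gᶜ, M.w z * B ^ 2 := by
      refine Finset.sum_le_sum fun z _ => mul_le_mul_of_nonneg_left ?_ (hw0 z)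
      have := h.mean_nonneg z; have := h.mean_le z
      have := h.mean_nonneg a; have := h.mean_le a
      exact sq_le_sq' (by simp only [hm]; linarith) (by simp only [hm]; linarith)
    have h2 := Finset.sum_add_sum_compl G M.w
    rw [M.sum_w] at h2
    rw [← Finset.sum_mul] at h1
    nlinarith [sq_nonneg B]
  have e5 := Finset.sum_add_sum_compl G fun z => M.w z * (m z - m a) ^ 2
  have : ∑ z, M.w z * V z = ∑ z, M.w z * ∫ x, (f x - ∫ x', f x' ∂M.ν z) ^ 2 ∂M.ν z := rfl
  rw [← this]
  nlinarith

lemma iterate (h : M.IsDensity B f) (N : ℕ) : M.IsDensity B (M.step^[N] f) := by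
  induction N with
  | zero => exact h
  | succ N ih => rw [Function.iterate_succ_apply']; exact ih.step

/-- Geometric decay of the second moment, up to an error, along the chain. -/
lemma second_moment_iterate_le (h : M.IsDensity B f) (hB : 0 ≤ B) (G : Finset ι) {a : ι}
    (hwa : 1 / 2 ≤ M.w a) {R e : ℝ} (hR : 0 ≤ R)
    (hG : ∀ g, M.IsDensity B g → ∀ z ∈ G, (∫ x, g x ∂M.ν z - ∫ x, g x ∂M.ν a) ^ 2 ≤
      R * ((∫ x, (g x - ∫ x', g x' ∂M.ν z) ^ 2 ∂M.ν z) +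
        ∫ x, (g x - ∫ x', g x' ∂M.ν a) ^ 2 ∂M.ν a))
    (he : 0 ≤ e) (hw : 1 - e ≤ ∑ z ∈ G, M.w z) (N : ℕ) :
    ∫ x, (M.step^[N] f) x ^ 2 ∂M.target ≤
      1 + B ^ 2 * e + B * Real.exp (-(N / (2 * (1 + 3 * R)))) := by
  -- The contraction rate: laziness keeps half of the variance drop, and the Poincaré constant is `1
  -- + 3 * R`.
  set l : ℝ := 1 / (2 * (1 + 3 * R)) with hl
  have hl0 : 0 < l := by positivity
  have hl1 : l ≤ 1 := by
    rw [hl, div_le_one (by positivity)]; linarith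
  have key : ∫ x, (M.step^[N] f) x ^ 2 ∂M.target ≤ 1 + B ^ 2 * e + B * (1 - l) ^ N := by
    induction N with
    | zero =>
      simp only [Function.iterate_zero, id, pow_zero, mul_one]
      have h1 : ∫ x, f x ^ 2 ∂M.target ≤ ∫ x, B * f x ∂M.target :=
        integral_mono (h.integrable_sq _) ((h.integrable _).const_mul _) fun x => by
          have := h.nonneg x; have := h.le x
          simp only
          nlinarith
      rw [integral_const_mul, h.one] at h1
      nlinarith [mul_nonneg (sq_nonneg B) he]
    | succ N ih =>
      rw [Function.iterate_succ_apply']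
      set g := M.step^[N] f with hg
      have hgd : M.IsDensity B g := h.iterate N
      have h1 := hgd.second_moment_step_le
      have h2 := hgd.variance_le G hwa hR (hG g hgd) hw
      set S := ∑ z, M.w z * ∫ x, (g x - ∫ x', g x' ∂M.ν z) ^ 2 ∂M.ν z
      -- What contracts is the excess over the fixed level `1 + B ^ 2 * e`, so the error term does
      -- not accumulate along the chain.
      have h3 : l * (∫ x, g x ^ 2 ∂M.target - 1 - B ^ 2 * e) ≤ 2⁻¹ * S := by
        have : 2⁻¹ * S = l * ((1 + 3 * R) * S) := by rw [hl]; field_simp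
        rw [this]
        exact mul_le_mul_of_nonneg_left (by linarith) hl0.le
      have h4 : (1 - l) * (∫ x, g x ^ 2 ∂M.target - 1 - B ^ 2 * e) ≤ (1 - l) * (B * (1 - l) ^ N) :=
        mul_le_mul_of_nonneg_left (by linarith) (by linarith)
      have h5 : B * (1 - l) ^ (N + 1) = (1 - l) * (B * (1 - l) ^ N) := by ring
      rw [h5]
      linarith
  refine key.trans ?_
  have h5 : (1 - l) ^ N ≤ Real.exp (-(N / (2 * (1 + 3 * R)))) := by
    have h6 : (1 - l) ^ N ≤ Real.exp (-l) ^ N :=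
      pow_le_pow_left₀ (by linarith) (by linarith [Real.add_one_le_exp (-l)]) N
    rw [← Real.exp_nat_mul] at h6
    refine h6.trans (le_of_eq ?_)
    rw [hl]; congr 1; ring
  have := mul_le_mul_of_nonneg_left h5 hB
  linarith

/-- Total variation bounds from the second moment: the chi-square bound. -/
lemma abs_setIntegral_sub_le (h : M.IsDensity B f) {A : Set Ω} (hA : MeasurableSet A) {x : ℝ}
    (hx : 0 < x) (hV : ∫ x, f x ^ 2 ∂M.target ≤ 1 + 4 * x ^ 2) :
    |∫ y in A, f y ∂M.target - M.target.real A| ≤ x := by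
  have hi := h.integrable M.target
  have hi1 : Integrable (fun y => f y - 1) M.target := hi.sub (integrable_const _)
  have hsq := integrable_sub_const_sq hi (h.integrable_sq _) 1
  have e1 : ∫ y in A, f y ∂M.target - M.target.real A = ∫ y in A, (f y - 1) ∂M.target := by
    rw [integral_sub hi.integrableOn (integrable_const _)]; simp
  have e2 : ∫ y in A, (f y - 1) ∂M.target = -∫ y in Aᶜ, (f y - 1) ∂M.target := by
    have h1 := integral_add_compl hA hi1
    have h2 : ∫ y, (f y - 1) ∂M.target = 0 := by
      rw [integral_sub hi (integrable_const _), h.one]; simp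
    linarith
  -- This is `√(χ²) ≤ 2 x` without a square root, by integrating `|u| ≤ u ^ 2 / (4 x) + x`. Since `f
  -- - 1` has integral 0, a set sees at most half of it.
  have e3 : ∫ y, |f y - 1| ∂M.target ≤ 2 * x := by
    have h1 : ∫ y, |f y - 1| ∂M.target ≤ ∫ y, ((4 * x)⁻¹ * (f y - 1) ^ 2 + x) ∂M.target :=
      integral_mono hi1.abs ((hsq.const_mul _).add (integrable_const _)) fun y => by
        simp only
        rw [← sq_abs, ← sub_nonneg]
        have : (4 * x)⁻¹ * |f y - 1| ^ 2 + x - |f y - 1| =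
            (4 * x)⁻¹ * (|f y - 1| - 2 * x) ^ 2 := by field_simp; ring
        rw [this]; positivity
    rw [integral_add (hsq.const_mul _) (integrable_const _), integral_const_mul,
      integral_sub_const_sq hi (h.integrable_sq _), h.one] at h1
    have h2 : (4 * x)⁻¹ * (∫ y, f y ^ 2 ∂M.target - 2 * 1 * 1 + 1 ^ 2) ≤ (4 * x)⁻¹ * (4 * x ^ 2) :=
      mul_le_mul_of_nonneg_left (by linarith) (by positivity)
    have h3 : (4 * x)⁻¹ * (4 * x ^ 2) = x := by field_simp
    simp at h1
    simp at h2 h3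
    linarith
  have e4 : |∫ y in A, (f y - 1) ∂M.target| ≤ ∫ y in A, |f y - 1| ∂M.target :=
    abs_integral_le_integral_abs
  have e5 : |∫ y in Aᶜ, (f y - 1) ∂M.target| ≤ ∫ y in Aᶜ, |f y - 1| ∂M.target :=
    abs_integral_le_integral_abs
  have e6 := integral_add_compl hA hi1.abs
  rw [e1]
  have e7 : |∫ y in A, (f y - 1) ∂M.target| = |∫ y in Aᶜ, (f y - 1) ∂M.target| := by
    rw [e2, abs_neg]
  linarith

/-- Total variation bounds from the second moment: the overlap bound. -/
lemma abs_setIntegral_sub_le_one_sub (h : M.IsDensity B f) {A : Set Ω} (hA : MeasurableSet A)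
    {x : ℝ} (hx : 0 < x) (hx2 : x ≤ 1 / 2) (hV : ∫ x, f x ^ 2 ∂M.target ≤ 1 / x) :
    |∫ y in A, f y ∂M.target - M.target.real A| ≤ 1 - x := by
  have hi := h.integrable M.target
  have hi1 : Integrable (fun y => f y - 1) M.target := hi.sub (integrable_const _)
  have hsq := h.integrable_sq M.target
  have e1 : ∫ y in A, f y ∂M.target - M.target.real A = ∫ y in A, (f y - 1) ∂M.target := by
    rw [integral_sub hi.integrableOn (integrable_const _)]; simp
  have e2 : ∫ y in A, (f y - 1) ∂M.target = -∫ y in Aᶜ, (f y - 1) ∂M.target := by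
    have h1 := integral_add_compl hA hi1
    have h2 : ∫ y, (f y - 1) ∂M.target = 0 := by
      rw [integral_sub hi (integrable_const _), h.one]; simp
    linarith
  have hφ : Integrable (fun y => (1 - 2 * x) * f y + x ^ 2 * f y ^ 2) M.target :=
    (hi.const_mul _).add (hsq.const_mul _)
  have hφ0 : ∀ y, 0 ≤ (1 - 2 * x) * f y + x ^ 2 * f y ^ 2 := fun y =>
    add_nonneg (mul_nonneg (by linarith) (h.nonneg y)) (by positivity)
  -- This is `(x f - 1) ^ 2 ≥ 0`. For `x ≤ 1/2` the right side is nonnegative, so restricting to a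
  -- set only lowers its integral, which is at most `1 - 2 x + x`.
  have hle : ∀ y, f y - 1 ≤ (1 - 2 * x) * f y + x ^ 2 * f y ^ 2 := fun y => by
    nlinarith [sq_nonneg (x * f y - 1)]
  have hint : ∫ y, ((1 - 2 * x) * f y + x ^ 2 * f y ^ 2) ∂M.target ≤ 1 - x := by
    rw [integral_add (hi.const_mul _) (hsq.const_mul _), integral_const_mul, integral_const_mul,
      h.one]
    have : x ^ 2 * ∫ y, f y ^ 2 ∂M.target ≤ x ^ 2 * (1 / x) :=
      mul_le_mul_of_nonneg_left hV (by positivity)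
    have h3 : x ^ 2 * (1 / x) = x := by field_simp
    linarith
  have bound : ∀ S : Set Ω, ∫ y in S, (f y - 1) ∂M.target ≤ 1 - x := fun S =>
    ((integral_mono hi1.integrableOn hφ.integrableOn hle).trans
      (setIntegral_le_integral hφ (.of_forall hφ0))).trans hint
  rw [e1, abs_le]
  refine ⟨?_, bound A⟩
  rw [e2]
  linarith [bound Aᶜ]

end IsDensity

/-- One step of the lazy Gibbs sampler acts on densities through `step`. -/
lemma bind_withDensity (h : M.IsDensity B f) (K : Kernel Ω Ω)
    (hK : ∀ x, K x = ∑ z, ENNReal.ofReal (M.r z x) •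
      ((2⁻¹ : ℝ≥0∞) • Measure.dirac x + (2⁻¹ : ℝ≥0∞) • M.ν z)) :
    (M.target.withDensity fun x => ENNReal.ofReal (f x)).bind K =
      M.target.withDensity fun x => ENNReal.ofReal (M.step f x) := by
  have hfm := h.meas.ennreal_ofReal
  have hrm := fun z => (M.measurable_r z).ennreal_ofReal
  ext A hA
  rw [Measure.bind_apply hA K.measurable.aemeasurable, withDensity_apply _ hA,
    lintegral_withDensity_eq_lintegral_mul _ hfm (K.measurable_coe hA)]
  have hK' : ∀ x, K x A = 2⁻¹ * A.indicator 1 x +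
      ∑ z, ENNReal.ofReal (M.r z x) * (2⁻¹ * M.ν z A) := by
    intro x
    rw [hK]
    simp only [Measure.coe_finsetSum, Finset.sum_apply, Measure.smul_apply, Measure.add_apply,
      smul_eq_mul, mul_add, Finset.sum_add_distrib, Measure.dirac_apply' _ hA]
    rw [← Finset.sum_mul, ← ENNReal.ofReal_sum_of_nonneg fun z _ => M.r_nonneg z x, M.sum_r]
    simp
  -- Both sides evaluate on `A` to half the integral of `f` over `A` plus half the sum over `z` of
  -- `w z * ν z A` times the mean of `f` under `ν z`, an expression symmetric in `f` and the
  -- indicator of `A`.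
  have hm : ∀ z, ∫⁻ x, ENNReal.ofReal (f x) ∂M.ν z = ENNReal.ofReal (∫ x, f x ∂M.ν z) := fun z =>
    (ofReal_integral_eq_lintegral_ofReal (h.integrable _) (.of_forall h.nonneg)).symm
  have hL : ∀ x, ((fun x => ENNReal.ofReal (f x)) * fun a => K a A) x =
      2⁻¹ * A.indicator (fun x => ENNReal.ofReal (f x)) x +
        ∑ z, (2⁻¹ * M.ν z A) * (ENNReal.ofReal (M.r z x) * ENNReal.ofReal (f x)) := by
    intro x
    simp only [Pi.mul_apply, hK' x, mul_add, Finset.mul_sum]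
    congr 1
    · by_cases hx : x ∈ A <;> simp [hx, mul_comm]
    · exact Finset.sum_congr rfl fun z _ => by ring
  have hR : ∀ x, ENNReal.ofReal (M.step f x) = 2⁻¹ * ENNReal.ofReal (f x) +
      ∑ z, 2⁻¹ * ENNReal.ofReal (∫ x, f x ∂M.ν z) * ENNReal.ofReal (M.r z x) := by
    intro x
    have h2 : ENNReal.ofReal (2⁻¹ : ℝ) = 2⁻¹ := by
      rw [ENNReal.ofReal_inv_of_pos two_pos]; simp
    unfold step
    rw [ENNReal.ofReal_add (by have := h.nonneg x; positivity)
      (mul_nonneg (by norm_num) (Finset.sum_nonneg fun z _ =>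
        mul_nonneg (M.r_nonneg z x) (h.mean_nonneg z))),
      ENNReal.ofReal_mul (by norm_num), ENNReal.ofReal_mul (by norm_num), h2,
      ENNReal.ofReal_sum_of_nonneg fun z _ => mul_nonneg (M.r_nonneg z x) (h.mean_nonneg z),
      Finset.mul_sum]
    congr 1
    refine Finset.sum_congr rfl fun z _ => ?_
    rw [ENNReal.ofReal_mul (M.r_nonneg z x)]
    ring
  have hset : ∀ z, ∫⁻ x in A, ENNReal.ofReal (M.r z x) ∂M.target =
      ENNReal.ofReal (M.w z) * M.ν z A := by
    intro z
    rw [← withDensity_apply _ hA, M.bayes]; rfl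
  have hm1 : ∀ z, Measurable fun x => 2⁻¹ * M.ν z A *
      (ENNReal.ofReal (M.r z x) * ENNReal.ofReal (f x)) := fun z => ((hrm z).mul hfm).const_mul _
  have hm2 : ∀ z, Measurable fun x => 2⁻¹ * ENNReal.ofReal (∫ x, f x ∂M.ν z) *
      ENNReal.ofReal (M.r z x) := fun z => (hrm z).const_mul _
  have hm3 : ∀ z, Measurable fun x => ENNReal.ofReal (M.r z x) * ENNReal.ofReal (f x) :=
    fun z => (hrm z).mul hfm
  simp_rw [hL, hR]
  rw [lintegral_add_left ((hfm.indicator hA).const_mul _),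
    lintegral_add_left (hfm.const_mul _),
    lintegral_const_mul _ (hfm.indicator hA), lintegral_const_mul _ hfm,
    lintegral_indicator hA,
    lintegral_finsetSum _ fun z _ => hm1 z, lintegral_finsetSum _ fun z _ => hm2 z]
  congr 1
  refine Finset.sum_congr rfl fun z _ => ?_
  rw [lintegral_const_mul _ (hm3 z), lintegral_const_mul _ (hrm z),
    M.lintegral_r_mul z hfm, hm, hset]
  ring

lemma iterate_bind_withDensity (h : M.IsDensity B f) (K : Kernel Ω Ω)
    (hK : ∀ x, K x = ∑ z, ENNReal.ofReal (M.r z x) •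
      ((2⁻¹ : ℝ≥0∞) • Measure.dirac x + (2⁻¹ : ℝ≥0∞) • M.ν z)) (N : ℕ) :
    (fun μ => μ.bind K)^[N] (M.target.withDensity fun x => ENNReal.ofReal (f x)) =
      M.target.withDensity fun x => ENNReal.ofReal ((M.step^[N] f) x) := by
  induction N with
  | zero => rfl
  | succ N ih =>
    rw [Function.iterate_succ_apply', ih, Function.iterate_succ_apply',
      bind_withDensity (h.iterate N) K hK]

lemma tvDist_withDensity_le (h : M.IsDensity B f) {x : ℝ}
    (hx : ∀ A, MeasurableSet A → |∫ y in A, f y ∂M.target - M.target.real A| ≤ x) :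
    tvDist (M.target.withDensity fun x => ENNReal.ofReal (f x)) M.target ≤ x := by
  unfold tvDist
  refine csSup_le ⟨_, ∅, MeasurableSet.empty, rfl⟩ ?_
  rintro d ⟨A, hA, rfl⟩
  have : (M.target.withDensity fun x => ENNReal.ofReal (f x)).real A = ∫ y in A, f y ∂M.target := by
    rw [Measure.real, withDensity_apply _ hA,
      ← ofReal_integral_eq_lintegral_ofReal (h.integrable _) (.of_forall h.nonneg),
      ENNReal.toReal_ofReal (integral_nonneg h.nonneg)]
  rw [this]
  exact hx A hA

/-- Mixing of the lazy Gibbs sampler, when `b` bounds half the density of the initial law. -/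
theorem tvDist_iterate_le {b : ℝ} (hb : 1 ≤ b) (h : M.IsDensity (2 * b) f) (G : Finset ι) {a : ι}
    (hwa : 1 / 2 ≤ M.w a) {R e : ℝ} (hR : 1 ≤ R)
    (hG : ∀ g, M.IsDensity (2 * b) g → ∀ z ∈ G, (∫ x, g x ∂M.ν z - ∫ x, g x ∂M.ν a) ^ 2 ≤
      2 * R * ((∫ x, (g x - ∫ x', g x' ∂M.ν z) ^ 2 ∂M.ν z) +
        ∫ x, (g x - ∫ x', g x' ∂M.ν a) ^ 2 ∂M.ν a))
    (he : 0 ≤ e) (hw : 1 - e ≤ ∑ z ∈ G, M.w z) {x : ℝ} (hx : 0 < x) (hx1 : x < 1)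
    (hex : (2 * b) ^ 2 * e ≤ 4 / 5 * x ^ 2) {N : ℕ}
    (hN : 280 * (b * R * Real.log (1 / x)) ≤ N) :
    tvDist (M.target.withDensity fun y => ENNReal.ofReal ((M.step^[N] f) y)) M.target ≤ x := by
  have h2 := h.second_moment_iterate_le (by linarith) G hwa (R := 2 * R) (by linarith) hG he hw N
  set L := Real.log (1 / x) with hL
  have hL0 : 0 < L := Real.log_pos (by rw [lt_div_iff₀ hx]; linarith)
  have hxL : x = Real.exp (-L) := by
    rw [hL, Real.log_div one_ne_zero hx.ne', Real.log_one, zero_sub, neg_neg, Real.exp_log hx]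
  -- With `R` replaced by `2 * R`, the decay time `2 * (1 + 6 * R)` is at most `14 * R`, and `280 =
  -- 14 * 20`.
  have hexp : Real.exp (-(N / (2 * (1 + 3 * (2 * R))))) ≤ Real.exp (-(20 * (b * L))) := by
    refine Real.exp_le_exp.2 (neg_le_neg ?_)
    rw [le_div_iff₀ (by positivity)]
    have : 0 < b * L := by positivity
    nlinarith
  have h3 : ∫ y, (M.step^[N] f) y ^ 2 ∂M.target ≤
      1 + 4 / 5 * x ^ 2 + 2 * b * Real.exp (-(20 * (b * L))) := by
    have := mul_le_mul_of_nonneg_left hexp (show 0 ≤ 2 * b by linarith)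
    linarith
  have hd := h.iterate N
  refine tvDist_withDensity_le hd fun A hA => ?_
  -- For `L ≥ 1/2` the exponential beats both `b` and `x ^ 2`, and the chi-square bound applies. As
  -- `x` tends to 1 the number of steps need not make the chi-square distance small; then the
  -- overlap bound with parameter `L` is used, together with `1 - L ≤ x`.
  rcases le_or_gt (1 / 2) L with hc | hc
  · refine hd.abs_setIntegral_sub_le hA hx (h3.trans ?_)
    have h4 : b * Real.exp (-(20 * (b * L))) ≤ x ^ 2 := by
      have h5 : b ≤ Real.exp (2 * (b * L)) := by
        have := Real.add_one_le_exp (2 * (b * L))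
        nlinarith
      have h6 : x ^ 2 = Real.exp (-(2 * L)) := by
        rw [hxL, ← Real.exp_nat_mul]; congr 1; push_cast; ring
      rw [h6]
      calc b * Real.exp (-(20 * (b * L)))
          ≤ Real.exp (2 * (b * L)) * Real.exp (-(20 * (b * L))) :=
            mul_le_mul_of_nonneg_right h5 (Real.exp_pos _).le
        _ = Real.exp (-(18 * (b * L))) := by rw [← Real.exp_add]; congr 1; ring
        _ ≤ Real.exp (-(2 * L)) := Real.exp_le_exp.2 (by nlinarith)
    nlinarith [sq_nonneg x]
  · have h4 : 1 - L ≤ x := by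
      have := Real.add_one_le_exp (-L)
      linarith
    refine (hd.abs_setIntegral_sub_le_one_sub hA hL0 hc.le (h3.trans ?_)).trans h4
    -- From `u * exp (-u) ≤ 1` at `u = 20 * (b * L)`. The budget then closes exactly: `(1 + 4/5) / 2
    -- + 2 / 20 = 1`.
    have h5 : b * L * Real.exp (-(20 * (b * L))) ≤ 1 / 20 := by
      have h6 := Real.add_one_le_exp (20 * (b * L))
      rw [Real.exp_neg, ← div_eq_mul_inv, div_le_iff₀ (Real.exp_pos _)]
      linarith
    rw [le_div_iff₀ hL0]
    have h7 : x ^ 2 ≤ 1 := by nlinarith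
    nlinarith [sq_nonneg x]

end Mixture

end SpikeSlab

end

/-! ### Gauss–Jordan elimination, correctness and cost of the sampling step. -/

noncomputable section

namespace SpikeSlab

namespace Counted

@[simp] lemma val_bind {α β : Type} (x : Counted α) (f : α → Counted β) :
    (x >>= f).val = (f x.val).val := rfl

@[simp] lemma cost_bind {α β : Type} (x : Counted α) (f : α → Counted β) :
    (x >>= f).cost = x.cost + (f x.val).cost := rfl

@[simp] lemma val_forAll {ι α : Type} [Fintype ι] (f : ι → Counted α) :
    (forAll f).val = fun i => (f i).val := rfl

@[simp] lemma cost_forAll {ι α : Type} [Fintype ι] (f : ι → Counted α) :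
    (forAll f).cost = ∑ i, (f i).cost := rfl

@[simp] lemma val_dot {ι : Type} [Fintype ι] (u v : ι → ℝ) : (dot u v).val = u ⬝ᵥ v := rfl

@[simp] lemma cost_dot {ι : Type} [Fintype ι] (u v : ι → ℝ) :
    (dot u v).cost = 2 * Fintype.card ι := by
  simp [dot, mul, sumAll]; ring

@[simp] lemma val_mulVec {ι κ : Type} [Fintype ι] [Fintype κ] (B : ι → κ → ℝ) (v : κ → ℝ) :
    (mulVec B v).val = (Matrix.of B) *ᵥ v := rfl

@[simp] lemma cost_mulVec {ι κ : Type} [Fintype ι] [Fintype κ] (B : ι → κ → ℝ) (v : κ → ℝ) :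
    (mulVec B v).cost = Fintype.card ι * (2 * Fintype.card κ) := by
  simp [mulVec]

lemma val_mulVec_matrix {ι κ : Type} [Fintype ι] [Fintype κ] (B : Matrix ι κ ℝ) (v : κ → ℝ) :
    (mulVec B v).val = B *ᵥ v := rfl

lemma cost_mulVec_matrix {ι κ : Type} [Fintype ι] [Fintype κ] (B : Matrix ι κ ℝ) (v : κ → ℝ) :
    (mulVec B v).cost = Fintype.card ι * (2 * Fintype.card κ) := by
  simp [mulVec]

lemma val_pivotStep {n : ℕ} (B : Fin n → Fin n → ℝ) (k i j : Fin n) :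
    (pivotStep B k).val i j =
      if i = k then if j = k then 1 / B k k else 0 - B k j / B k k
      else if j = k then B i k / B k k else B i j - B i k * B k j / B k k := by
  simp only [pivotStep, val_forAll]
  split_ifs <;> rfl

lemma cost_pivotStep {n : ℕ} (B : Fin n → Fin n → ℝ) (k : Fin n) :
    n * n ≤ (pivotStep B k).cost ∧ (pivotStep B k).cost ≤ 3 * (n * n) := by
  have h : ∀ i j : Fin n, 1 ≤ (if i = k then if j = k then div 1 (B k k) else do
        let a ← div (B k j) (B k k)
        sub 0 a
      else if j = k then div (B i k) (B k k) else do
        let a ← mul (B i k) (B k j)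
        let b ← div a (B k k)
        sub (B i j) b : Counted ℝ).cost ∧ (if i = k then if j = k then div 1 (B k k) else do
        let a ← div (B k j) (B k k)
        sub 0 a
      else if j = k then div (B i k) (B k k) else do
        let a ← mul (B i k) (B k j)
        let b ← div a (B k k)
        sub (B i j) b : Counted ℝ).cost ≤ 3 := by
    intro i j
    split_ifs <;> simp [div, sub, mul]
  simp only [pivotStep, cost_forAll]
  constructor
  · calc n * n = ∑ _i : Fin n, ∑ _j : Fin n, 1 := by simp
      _ ≤ _ := Finset.sum_le_sum fun i _ => Finset.sum_le_sum fun j _ => (h i j).1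
  · calc _ ≤ ∑ _i : Fin n, ∑ _j : Fin n, 3 :=
          Finset.sum_le_sum fun i _ => Finset.sum_le_sum fun j _ => (h i j).2
      _ = 3 * (n * n) := by simp; ring

lemma cost_foldlM_pivotStep {n : ℕ} (l : List (Fin n)) (B : Fin n → Fin n → ℝ) :
    l.length * (n * n) ≤ (l.foldlM pivotStep B).cost ∧
      (l.foldlM pivotStep B).cost ≤ l.length * (3 * (n * n)) := by
  induction l generalizing B with
  | nil => simp [List.foldlM, pure]
  | cons k l ih =>
    rw [List.foldlM_cons, cost_bind, List.length_cons]
    have h1 := cost_pivotStep B k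
    have h2 := ih (pivotStep B k).val
    rw [add_mul, add_mul]
    omega

/-- The table `B` exchanges the coordinates in `P` of `x` and `A x`. -/
def Exchanges {n : ℕ} (A : Matrix (Fin n) (Fin n) ℝ) (P : Finset (Fin n))
    (B : Fin n → Fin n → ℝ) : Prop :=
  ∀ u : Fin n → ℝ, ∃ x : Fin n → ℝ, (∀ i, u i = if i ∈ P then (A *ᵥ x) i else x i) ∧
    ∀ i, (Matrix.of B *ᵥ u) i = if i ∈ P then x i else (A *ᵥ x) i

/-- The pivot is a value of the quadratic form. For the input `e_k`, every coordinate other than `k`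
has either `x i` or `(A x) i` equal to 0, and `x k = 1`, so `x ⬝ᵥ A x` collapses to `(A x) k`, the
pivot. -/
lemma Exchanges.pivot_pos {n : ℕ} {A : Matrix (Fin n) (Fin n) ℝ} {P : Finset (Fin n)}
    {B : Fin n → Fin n → ℝ} (hA : ∀ x : Fin n → ℝ, x ≠ 0 → 0 < x ⬝ᵥ (A *ᵥ x))
    (h : Exchanges A P B) {k : Fin n} (hk : k ∉ P) : 0 < B k k := by
  obtain ⟨x, hx, hv⟩ := h (Pi.single k 1)
  have hxk : x k = 1 := by simpa [hk] using (hx k).symm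
  have hBk : B k k = (A *ᵥ x) k := by simpa [hk] using hv k
  have h0 : x ⬝ᵥ (A *ᵥ x) = (A *ᵥ x) k := by
    rw [dotProduct, Finset.sum_eq_single k]
    · rw [hxk, one_mul]
    · intro i _ hik
      have := hx i
      rw [Pi.single_eq_of_ne hik] at this
      split_ifs at this with hi
      · rw [← this, mul_zero]
      · rw [← this, zero_mul]
    · simp
  rw [hBk, ← h0]
  exact hA x fun h => by simp [h] at hxk

/-- A pivot solves equation `k` for `x k` and substitutes the solution into the other equations,
which moves `k` into the exchanged set. -/
lemma Exchanges.pivotStep {n : ℕ} {A : Matrix (Fin n) (Fin n) ℝ} {P : Finset (Fin n)}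
    {B : Fin n → Fin n → ℝ} (h : Exchanges A P B) {k : Fin n} (hk : k ∉ P) (hB : B k k ≠ 0) :
    Exchanges A (insert k P) (Counted.pivotStep B k).val := by
  intro u
  set c : ℝ := ∑ j ∈ Finset.univ.erase k, B k j * u j with hc
  -- The value of `x k` forced by row `k` when `u k` now prescribes `(A x) k`.
  set t : ℝ := (u k - c) / B k k with ht
  have hsum : ∀ f : Fin n → ℝ, ∑ j, f j = f k + ∑ j ∈ Finset.univ.erase k, f j := fun f =>
    (Finset.add_sum_erase _ _ (Finset.mem_univ k)).symm
  have hB' : ∀ i, (Matrix.of B *ᵥ Function.update u k t) i =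
      B i k * t + ∑ j ∈ Finset.univ.erase k, B i j * u j := by
    intro i
    rw [Matrix.mulVec, dotProduct, hsum]
    simp only [of_apply, Function.update_self]
    congr 1
    refine Finset.sum_congr rfl fun j hj => ?_
    rw [Function.update_of_ne (Finset.ne_of_mem_erase hj)]
  obtain ⟨x, hx, hv⟩ := h (Function.update u k t)
  refine ⟨x, fun i => ?_, fun i => ?_⟩
  · by_cases hik : i = k
    · subst hik
      have := hv i
      rw [hB', if_neg hk] at this
      rw [if_pos (Finset.mem_insert_self _ _), ← this, ht]
      field_simp
      ring
    · have := hx i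
      rw [Function.update_of_ne hik] at this
      simp [this, hik]
  · have hR : (Matrix.of (Counted.pivotStep B k).val *ᵥ u) i = (Counted.pivotStep B k).val i k * u k +
        ∑ j ∈ Finset.univ.erase k, (Counted.pivotStep B k).val i j * u j := by
      rw [Matrix.mulVec, dotProduct, hsum]; rfl
    rw [hR]
    by_cases hik : i = k
    · subst hik
      have hxk := hx i
      rw [Function.update_self, if_neg hk] at hxk
      have : ∑ j ∈ Finset.univ.erase i, (Counted.pivotStep B i).val i j * u j = - c / B i i := by
        rw [hc, neg_div, Finset.sum_div, ← Finset.sum_neg_distrib]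
        refine Finset.sum_congr rfl fun j hj => ?_
        rw [val_pivotStep, if_pos rfl, if_neg (Finset.ne_of_mem_erase hj)]
        ring
      rw [this, val_pivotStep, if_pos rfl, if_pos rfl, if_pos (Finset.mem_insert_self _ _), ← hxk,
        ht]
      ring
    · have hvi := hv i
      rw [hB'] at hvi
      have : ∑ j ∈ Finset.univ.erase k, (Counted.pivotStep B k).val i j * u j =
          ∑ j ∈ Finset.univ.erase k, B i j * u j - B i k / B k k * c := by
        rw [hc, Finset.mul_sum, ← Finset.sum_sub_distrib]
        refine Finset.sum_congr rfl fun j hj => ?_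
        rw [val_pivotStep, if_neg hik, if_neg (Finset.ne_of_mem_erase hj)]
        ring
      rw [this, val_pivotStep, if_neg hik, if_pos rfl]
      simp only [Finset.mem_insert, hik, false_or]
      rw [← hvi, ht]
      ring

lemma Exchanges.foldlM {n : ℕ} {A : Matrix (Fin n) (Fin n) ℝ}
    (hA : ∀ x : Fin n → ℝ, x ≠ 0 → 0 < x ⬝ᵥ (A *ᵥ x)) (l : List (Fin n)) (hl : l.Nodup)
    {P : Finset (Fin n)} {B : Fin n → Fin n → ℝ} (h : Exchanges A P B)
    (hP : ∀ i ∈ l, i ∉ P) :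
    Exchanges A (P ∪ l.toFinset) (l.foldlM Counted.pivotStep B).val := by
  induction l generalizing B P with
  | nil => simpa [List.foldlM, pure] using h
  | cons k l ih =>
    rw [List.foldlM_cons, val_bind]
    have hk : k ∉ P := hP k (by simp)
    have h' := h.pivotStep hk (h.pivot_pos hA hk).ne'
    rw [List.nodup_cons] at hl
    have := ih hl.2 h' fun i hi hiP => by
      rcases Finset.mem_insert.1 hiP with rfl | hiP
      · exact hl.1 hi
      · exact hP i (by simp [hi]) hiP
    rwa [List.toFinset_cons, Finset.union_insert, ← Finset.insert_union]

/-- Gauss–Jordan elimination without pivot search inverts positive definite matrices. -/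
lemma val_invert {n : ℕ} (A : Matrix (Fin n) (Fin n) ℝ)
    (hA : ∀ x : Fin n → ℝ, x ≠ 0 → 0 < x ⬝ᵥ (A *ᵥ x)) :
    Matrix.of (invert (fun i j => A i j)).val = A⁻¹ := by
  have h0 : Exchanges A ∅ (fun i j => A i j) := fun u => ⟨u, by simp, fun i => by
    rw [if_neg (Finset.notMem_empty i)]; rfl⟩
  have h := h0.foldlM hA (List.finRange n) (List.nodup_finRange n) (by simp)
  -- Once all coordinates are exchanged the table sends `A x` to `x`; on basis vectors this says
  -- that it is a right inverse.
  refine (inv_eq_right_inv ?_).symm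
  refine ext_of_mulVec_single fun j => ?_
  obtain ⟨x, hx, hv⟩ := h (Pi.single j 1)
  have hv' : Matrix.of (invert (fun i j => A i j)).val *ᵥ Pi.single j 1 = x := by
    ext i; simpa [invert] using hv i
  rw [← mulVec_mulVec, hv', one_mulVec]
  ext i
  simpa using (hx i).symm

lemma cost_invert {n : ℕ} (B : Fin n → Fin n → ℝ) :
    n * (n * n) ≤ (invert B).cost ∧ (invert B).cost ≤ n * (3 * (n * n)) := by
  simpa [invert] using cost_foldlM_pivotStep (List.finRange n) B

end Counted

namespace Design

variable {n p : ℕ} (D : Design n p)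

lemma A_mulVec (z : Finset (Fin p)) (x : Fin n → ℝ) :
    D.A z *ᵥ x = x + (D.τ₁ ^ 2 / D.σ ^ 2) • (activeCols D.X z *ᵥ ((activeCols D.X z)ᵀ *ᵥ x)) := by
  rw [A, add_mulVec, one_mulVec, smul_mulVec, mulVec_mulVec]

lemma dotProduct_A_mulVec (z : Finset (Fin p)) (x : Fin n → ℝ) :
    x ⬝ᵥ (D.A z *ᵥ x) = x ⬝ᵥ x + (D.τ₁ ^ 2 / D.σ ^ 2) *
      (((activeCols D.X z)ᵀ *ᵥ x) ⬝ᵥ ((activeCols D.X z)ᵀ *ᵥ x)) := by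
  rw [A_mulVec, dotProduct_add, dotProduct_smul, dotProduct_mulVec x, ← mulVec_transpose,
    smul_eq_mul]

lemma dotProduct_self_nonneg' {ι : Type*} [Fintype ι] (x : ι → ℝ) : 0 ≤ x ⬝ᵥ x :=
  Finset.sum_nonneg fun i _ => mul_self_nonneg (x i)

lemma dotProduct_A_mulVec_pos (z : Finset (Fin p)) {x : Fin n → ℝ} (hx : x ≠ 0) :
    0 < x ⬝ᵥ (D.A z *ᵥ x) := by
  rw [dotProduct_A_mulVec]
  have h1 : 0 < x ⬝ᵥ x :=
    lt_of_le_of_ne (dotProduct_self_nonneg' x) fun h => hx (dotProduct_self_eq_zero.1 h.symm)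
  have h2 := dotProduct_self_nonneg' ((activeCols D.X z)ᵀ *ᵥ x)
  positivity

end Design

open Counted in
lemma val_sampleActive {n p : ℕ} (D : Design n p) (y : Fin n → ℝ) (z : Finset (Fin p))
    (r : z → ℝ) (ζ : Fin n → ℝ) :
    (sampleActive D y z r ζ).val =
      D.σ • (r + (D.τ₁ ^ 2 / D.σ ^ 2) • ((activeCols D.X z)ᵀ *ᵥ
        ((D.A z)⁻¹ *ᵥ ((1 / D.σ) • y - (activeCols D.X z *ᵥ r + ζ))))) := by
  rw [← val_invert (D.A z) fun x hx => D.dotProduct_A_mulVec_pos z hx]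
  have hA : (fun i i' => (if i = i' then (1 : ℝ) else 0) + (fun j => D.τ₁ * D.τ₁ / (D.σ * D.σ) *
      activeCols D.X z i j) ⬝ᵥ activeCols D.X z i') = fun i i' => D.A z i i' := by
    ext i i'
    rw [Design.A, Matrix.add_apply, Matrix.one_apply, Matrix.smul_apply, Matrix.mul_apply, dotProduct, smul_eq_mul,
      Finset.mul_sum]
    congr 1
    exact Finset.sum_congr rfl fun j _ => by simp only [transpose_apply]; ring
  simp only [sampleActive, val_bind, val_forAll, draw, Counted.mul, Counted.div, Counted.add,
    Counted.sub, val_mulVec_matrix, val_mulVec, val_dot]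
  rw [hA]
  ext j
  simp only [Pi.smul_apply, Pi.add_apply, smul_eq_mul]
  congr 2
  rw [Matrix.mulVec, Matrix.mulVec, dotProduct, dotProduct, Finset.mul_sum]
  refine Finset.sum_congr rfl fun i _ => ?_
  have hv : (fun i => y i / D.σ - ((activeCols D.X z *ᵥ r) i + ζ i)) =
      (1 / D.σ) • y - (activeCols D.X z *ᵥ r + ζ) := by
    ext i
    simp only [Pi.sub_apply, Pi.smul_apply, Pi.add_apply, smul_eq_mul]
    rw [one_div_mul_eq_div]
  rw [hv]
  simp only [of_apply, transpose_apply]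
  ring

open Counted in
lemma cost_sampleActive {n p : ℕ} (D : Design n p) (y : Fin n → ℝ) (z : Finset (Fin p))
    (r : z → ℝ) (ζ : Fin n → ℝ) :
    n * n * z.card + n * (n * n) ≤ (sampleActive D y z r ζ).cost ∧
      (sampleActive D y z r ζ).cost ≤ 2 * (n * n * z.card) + 3 * (n * (n * n)) + 3 * (n * n) +
        5 * (n * z.card) + 3 * z.card + 4 * n + 3 := by
  -- The cost of inversion is bounded for every table, so it can be replaced by a number `c`
  -- whatever table is inverted.
  have h : ∀ B : Fin n → Fin n → ℝ, ∃ c, (invert B).cost = c ∧ n * (n * n) ≤ c ∧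
      c ≤ n * (3 * (n * n)) := fun B => ⟨_, rfl, cost_invert B⟩
  simp only [sampleActive, cost_bind, cost_forAll, cost_mulVec, cost_mulVec_matrix,
    draw, Counted.mul, Counted.div, Counted.add, Counted.sub, cost_dot, Finset.sum_const, Finset.card_univ, Fintype.card_fin, Fintype.card_coe, smul_eq_mul]
  obtain ⟨c, hc, h1, h2⟩ := h _
  rw [hc]
  constructor <;> nlinarith [Nat.zero_le (n * z.card), Nat.zero_le (n * n * z.card)]

lemma sampleActive_spec : ∃ c C : ℝ, 0 < c ∧ 0 < C ∧
      ∀ (n p : ℕ) (D : Design n p) (y : Fin n → ℝ) (z : Finset (Fin p))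
        (r : z → ℝ) (ζ : Fin n → ℝ), 0 < n → 0 < D.σ → 0 < D.τ₁ →
        (sampleActive D y z r ζ).val =
          D.σ • (r + (D.τ₁ ^ 2 / D.σ ^ 2) • ((activeCols D.X z)ᵀ *ᵥ
            ((D.A z)⁻¹ *ᵥ ((1 / D.σ) • y - (activeCols D.X z *ᵥ r + ζ))))) ∧
        ((sampleActive D y z r ζ).cost : ℝ) ≤
          C * max ((n : ℝ) ^ 2 * z.card) ((n : ℝ) ^ 3) ∧
        ∀ zs : Finset (Fin p), zs ⊆ z →
          c * max ((n : ℝ) ^ 2 * zs.card) ((n : ℝ) ^ 3) ≤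
            ((sampleActive D y z r ζ).cost : ℝ) := by
  -- The coefficients of the upper count sum to 23, and for `n ≥ 1` each monomial is at most the
  -- maximum, so 30 suffices. The lower count already has coefficients 1.
  refine ⟨1, 30, one_pos, by norm_num, fun n p D y z r ζ hn _ _ => ?_⟩
  obtain ⟨h1, h2⟩ := cost_sampleActive D y z r ζ
  refine ⟨val_sampleActive D y z r ζ, ?_, fun zs hzs => ?_⟩
  all_goals generalize (sampleActive D y z r ζ).cost = c at h1 h2 ⊢
  · have h3 : (c : ℝ) ≤ 2 * (n * n * z.card) + 3 * (n * (n * n)) + 3 * (n * n) +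
        5 * (n * z.card) + 3 * z.card + 4 * n + 3 := by exact_mod_cast h2
    have hn1 : (1 : ℝ) ≤ n := by exact_mod_cast hn
    have hk : (0 : ℝ) ≤ z.card := Nat.cast_nonneg _
    generalize (z.card : ℝ) = k at h3 hk ⊢
    generalize (n : ℝ) = m at h3 hn1 ⊢
    have e1 : k ≤ m * k := le_mul_of_one_le_left hk hn1
    have e2 : m * k ≤ m * (m * k) := le_mul_of_one_le_left (by positivity) hn1
    have e3 : m * m ≤ m * (m * m) := le_mul_of_one_le_left (by positivity) hn1
    have e4 : m ≤ m * m := le_mul_of_one_le_left (by positivity) hn1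
    have e5 : m ^ 2 * k = m * (m * k) := by ring
    have e6 : m ^ 3 = m * (m * m) := by ring
    have := le_max_left (m ^ 2 * k) (m ^ 3)
    have := le_max_right (m ^ 2 * k) (m ^ 3)
    rw [mul_assoc m m k] at h3
    linarith
  · rw [one_mul]
    have h3 : (n * n * z.card + n * (n * n) : ℝ) ≤ c := by exact_mod_cast h1
    have hk : (zs.card : ℝ) ≤ z.card := by exact_mod_cast Finset.card_le_card hzs
    have e1 : (n : ℝ) ^ 2 * zs.card ≤ (n : ℝ) ^ 2 * z.card :=
      mul_le_mul_of_nonneg_left hk (by positivity)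
    have e2 : 0 ≤ (n : ℝ) ^ 2 * z.card := by positivity
    have e3 : 0 ≤ (n : ℝ) ^ 3 := by positivity
    have e4 : (n : ℝ) ^ 2 * z.card = n * n * z.card := by ring
    have e5 : (n : ℝ) ^ 3 = n * (n * n) := by ring
    exact max_le (by linarith) (by linarith)

end SpikeSlab

end

/-! ### Gaussian integrals, completion of the square, positivity and integrability of the joint
density. -/

noncomputable section

namespace SpikeSlab

lemma integrable_exp_quadratic {α : ℝ} (hα : 0 < α) (β : ℝ) :
    Integrable fun x : ℝ => Real.exp (-α * x ^ 2 + β * x) := by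
  have h : (fun x : ℝ => Real.exp (-α * x ^ 2 + β * x)) =
      fun x => Real.exp (-α * (x - β / (2 * α)) ^ 2) * Real.exp (β ^ 2 / (4 * α)) := by
    ext x
    rw [← Real.exp_add]; congr 1; field_simp; ring
  rw [h]
  exact ((integrable_exp_neg_mul_sq hα).comp_sub_right (β / (2 * α))).mul_const _

lemma integral_exp_quadratic {α : ℝ} (hα : 0 < α) (β : ℝ) :
    ∫ x : ℝ, Real.exp (-α * x ^ 2 + β * x) = √(Real.pi / α) * Real.exp (β ^ 2 / (4 * α)) := by
  have h : (fun x : ℝ => Real.exp (-α * x ^ 2 + β * x)) =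
      fun x => Real.exp (-α * (x - β / (2 * α)) ^ 2) * Real.exp (β ^ 2 / (4 * α)) := by
    ext x
    rw [← Real.exp_add]; congr 1; field_simp; ring
  rw [h, integral_mul_const,
    integral_sub_right_eq_self (fun x => Real.exp (-α * x ^ 2)) (β / (2 * α)), integral_gaussian]

namespace Design

variable {n p : ℕ} (D : Design n p)

lemma A_transpose (z : Finset (Fin p)) : (D.A z)ᵀ = D.A z := by
  simp [A, transpose_mul]

lemma isUnit_det_A (z : Finset (Fin p)) : IsUnit (D.A z).det := by
  rw [isUnit_iff_ne_zero]
  intro h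
  obtain ⟨v, hv, h0⟩ := exists_mulVec_eq_zero_iff.2 h
  have := D.dotProduct_A_mulVec_pos z hv
  simp [h0] at this

lemma A_mulVec_inv (z : Finset (Fin p)) (y : Fin n → ℝ) : D.A z *ᵥ ((D.A z)⁻¹ *ᵥ y) = y := by
  rw [mulVec_mulVec, mul_nonsing_inv _ (D.isUnit_det_A z), one_mulVec]

lemma dotProduct_inv_comm (z : Finset (Fin p)) (x y : Fin n → ℝ) :
    x ⬝ᵥ ((D.A z)⁻¹ *ᵥ y) = ((D.A z)⁻¹ *ᵥ x) ⬝ᵥ y := by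
  rw [dotProduct_mulVec, ← mulVec_transpose, transpose_nonsing_inv, A_transpose]

/-- The quadratic form of `(I_n + (τ₁² / σ²) X_z X_zᵀ)⁻¹`. -/
def quad (z : Finset (Fin p)) (y : Fin n → ℝ) : ℝ := y ⬝ᵥ ((D.A z)⁻¹ *ᵥ y)

lemma quad_nonneg (z : Finset (Fin p)) (y : Fin n → ℝ) : 0 ≤ D.quad z y := by
  have h : D.quad z y = ((D.A z)⁻¹ *ᵥ y) ⬝ᵥ (D.A z *ᵥ ((D.A z)⁻¹ *ᵥ y)) := by
    rw [A_mulVec_inv, quad, dotProduct_comm]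
  rw [h, dotProduct_A_mulVec]
  have := dotProduct_self_nonneg' ((D.A z)⁻¹ *ᵥ y)
  have := dotProduct_self_nonneg' ((activeCols D.X z)ᵀ *ᵥ ((D.A z)⁻¹ *ᵥ y))
  positivity

lemma quad_sub (z : Finset (Fin p)) (y u : Fin n → ℝ) :
    D.quad z (y - u) = D.quad z y - 2 * (((D.A z)⁻¹ *ᵥ y) ⬝ᵥ u) + D.quad z u := by
  have h : u ⬝ᵥ ((D.A z)⁻¹ *ᵥ y) = ((D.A z)⁻¹ *ᵥ y) ⬝ᵥ u := dotProduct_comm _ _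
  have h' := D.dotProduct_inv_comm z y u
  simp only [quad, mulVec_sub, dotProduct_sub, sub_dotProduct]
  rw [h, h']
  ring

lemma quad_smul (z : Finset (Fin p)) (c : ℝ) (u : Fin n → ℝ) :
    D.quad z (c • u) = c ^ 2 * D.quad z u := by
  simp only [quad, mulVec_smul, dotProduct_smul, smul_dotProduct, smul_eq_mul]
  ring

/-- The posterior mean of the active coefficients. -/
def center (z : Finset (Fin p)) (y : Fin n → ℝ) : z → ℝ :=
  (D.τ₁ ^ 2 / D.σ ^ 2) • ((activeCols D.X z)ᵀ *ᵥ ((D.A z)⁻¹ *ᵥ y))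

/-- Put `e = (A z)⁻¹ y`, `g = Xᵀ e` and `κ = τ₁² / σ²`, so that `y = e + κ X g` and the centre is `κ
g`. With `b = d + κ g` the residual is `e - X d`, and the cross terms in `d ⬝ᵥ g` cancel because `κ
/ τ₁² = 1 / σ²`. Only the defining equation of `A z` enters; the posterior precision matrix is never
inverted. -/
lemma complete_square (hσ : D.σ ≠ 0) (hτ : D.τ₁ ≠ 0) (z : Finset (Fin p)) (y : Fin n → ℝ)
    (b : z → ℝ) :
    (y - activeCols D.X z *ᵥ b) ⬝ᵥ (y - activeCols D.X z *ᵥ b) / D.σ ^ 2 + b ⬝ᵥ b / D.τ₁ ^ 2 =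
      D.quad z y / D.σ ^ 2 +
      ((activeCols D.X z *ᵥ (b - D.center z y)) ⬝ᵥ (activeCols D.X z *ᵥ (b - D.center z y)) /
        D.σ ^ 2 + (b - D.center z y) ⬝ᵥ (b - D.center z y) / D.τ₁ ^ 2) := by
  set X := activeCols D.X z with hX
  set e := (D.A z)⁻¹ *ᵥ y with he
  set g := Xᵀ *ᵥ e with hg
  set κ := D.τ₁ ^ 2 / D.σ ^ 2 with hκ
  have hm : D.center z y = κ • g := rfl
  have hy : y = e + κ • (X *ᵥ g) := by
    rw [hg, hX, ← A_mulVec, he, A_mulVec_inv]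
  have hadj : ∀ d : z → ℝ, (X *ᵥ d) ⬝ᵥ e = d ⬝ᵥ g := fun d => by
    rw [hg, dotProduct_mulVec d, vecMul_transpose]
  have hQ : D.quad z y = e ⬝ᵥ e + κ * (g ⬝ᵥ g) := by
    rw [quad, ← he]
    nth_rewrite 1 [hy]
    rw [add_dotProduct, smul_dotProduct, hadj, smul_eq_mul]
  obtain ⟨d, hd⟩ : ∃ d, d = b - D.center z y := ⟨_, rfl⟩
  have hb : b = d + κ • g := by rw [hd, hm]; simp
  rw [← hd, hQ]
  have hres : y - X *ᵥ b = e - X *ᵥ d := by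
    rw [hb, mulVec_add, mulVec_smul]
    nth_rewrite 1 [hy]
    abel
  rw [hres, hb]
  simp only [dotProduct_sub, sub_dotProduct, dotProduct_add, add_dotProduct, dotProduct_smul,
    smul_dotProduct, smul_eq_mul]
  have hc : e ⬝ᵥ (X *ᵥ d) = d ⬝ᵥ g := by rw [dotProduct_comm, hadj]
  rw [hc, hadj, dotProduct_comm g d, hκ]
  field_simp
  ring

/-- The completed square at `b = 0` exhibits the difference of the two sides as a sum of squares. -/
lemma quad_le (hσ : D.σ ≠ 0) (hτ : D.τ₁ ≠ 0) (z : Finset (Fin p)) (y : Fin n → ℝ) :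
    D.quad z y ≤ y ⬝ᵥ y := by
  have h := D.complete_square hσ hτ z y 0
  simp only [mulVec_zero, sub_zero, dotProduct_zero, zero_div, add_zero] at h
  have h1 := dotProduct_self_nonneg' (activeCols D.X z *ᵥ (0 - D.center z y))
  have h2 := dotProduct_self_nonneg' (0 - D.center z y)
  have h3 : D.quad z y / D.σ ^ 2 ≤ y ⬝ᵥ y / D.σ ^ 2 := by
    rw [h]
    have : 0 ≤ (activeCols D.X z *ᵥ (0 - D.center z y)) ⬝ᵥ (activeCols D.X z *ᵥ (0 - D.center z y)) /
        D.σ ^ 2 + (0 - D.center z y) ⬝ᵥ (0 - D.center z y) / D.τ₁ ^ 2 := by positivity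
    linarith
  exact (div_le_div_iff_of_pos_right (by positivity)).1 h3

/-! ### Densities -/

lemma normalDensity_eq (m τ x : ℝ) :
    normalDensity m τ x = (√(2 * Real.pi * τ ^ 2))⁻¹ * Real.exp (-(x - m) ^ 2 / (2 * τ ^ 2)) := by
  rw [normalDensity, gaussianPDFReal, Real.coe_toNNReal _ (sq_nonneg τ)]

lemma normalDensity_pos {τ : ℝ} (hτ : 0 < τ) (m x : ℝ) : 0 < normalDensity m τ x := by
  rw [normalDensity_eq]; positivity

lemma integrable_normalDensity (m τ : ℝ) : Integrable (normalDensity m τ) :=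
  integrable_gaussianPDFReal _ _

lemma integral_normalDensity {τ : ℝ} (hτ : 0 < τ) (m : ℝ) : ∫ x, normalDensity m τ x = 1 :=
  integral_gaussianPDFReal_eq_one _ (by simpa using hτ.ne')

/-- The likelihood as a function of the residual. -/
def lik (v : Fin n → ℝ) : ℝ := ∏ i, normalDensity 0 D.σ (v i)

lemma lik_eq (v : Fin n → ℝ) :
    D.lik v = (√(2 * Real.pi * D.σ ^ 2))⁻¹ ^ n * Real.exp (-(v ⬝ᵥ v) / (2 * D.σ ^ 2)) := by
  simp only [lik, normalDensity_eq, sub_zero]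
  rw [Finset.prod_mul_distrib, ← Real.exp_sum, dotProduct, ← Finset.sum_div,
    Finset.sum_neg_distrib]
  simp [sq]

/-- The prior density of a coefficient under a model, with its model weight. -/
def prior (z : Finset (Fin p)) (j : Fin p) (x : ℝ) : ℝ :=
  if j ∈ z then D.q * normalDensity 0 D.τ₁ x else (1 - D.q) * normalDensity 0 D.τ₀ x

/-- The fitted values of the coefficients in `z`. -/
def fit (z : Finset (Fin p)) (β : Fin p → ℝ) : Fin n → ℝ := fun i => ∑ j ∈ z, D.X i j * β j

lemma joint_eq (y : Fin n → ℝ) (z : Finset (Fin p)) (β : Fin p → ℝ) :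
    D.joint y z β = D.lik (y - D.fit z β) * ∏ j, D.prior z j (β j) := by
  rw [joint, lik]
  congr 1
  · refine Finset.prod_congr rfl fun i _ => ?_
    rw [normalDensity_eq, normalDensity_eq]
    simp [fit]
  · rw [← Finset.prod_mul_prod_compl z]
    congr 1
    · exact Finset.prod_congr rfl fun j hj => by rw [prior, if_pos hj]
    · exact Finset.prod_congr rfl fun j hj => by rw [prior, if_neg (Finset.mem_compl.1 hj)]

/-- Admissible values of the parameters. -/
structure Pos : Prop where
  σ : 0 < D.σ
  τ₀ : 0 < D.τ₀
  τ₁ : 0 < D.τ₁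
  q : 0 < D.q
  q' : 0 < 1 - D.q

variable {D}

lemma Pos.prior_pos (h : D.Pos) (z : Finset (Fin p)) (j : Fin p) (x : ℝ) : 0 < D.prior z j x := by
  rw [prior]
  split_ifs
  · exact mul_pos h.q (normalDensity_pos h.τ₁ _ _)
  · exact mul_pos h.q' (normalDensity_pos h.τ₀ _ _)

lemma Pos.lik_pos (h : D.Pos) (v : Fin n → ℝ) : 0 < D.lik v :=
  Finset.prod_pos fun _ _ => normalDensity_pos h.σ _ _

lemma integrable_prior (z : Finset (Fin p)) (j : Fin p) : Integrable (D.prior z j) := by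
  by_cases hj : j ∈ z
  · exact ((integrable_normalDensity 0 D.τ₁).const_mul D.q).congr
      (.of_forall fun x => by simp [prior, hj])
  · exact ((integrable_normalDensity 0 D.τ₀).const_mul (1 - D.q)).congr
      (.of_forall fun x => by simp [prior, hj])

lemma Pos.joint_pos (h : D.Pos) (y : Fin n → ℝ) (z : Finset (Fin p)) (β : Fin p → ℝ) :
    0 < D.joint y z β := by
  rw [joint_eq]
  exact mul_pos (h.lik_pos _) (Finset.prod_pos fun j _ => h.prior_pos z j _)

lemma Pos.integrable_joint (h : D.Pos) (y : Fin n → ℝ) (z : Finset (Fin p)) :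
    Integrable (D.joint y z) := by
  have h1 : Integrable (fun β : Fin p → ℝ => ∏ j, D.prior z j (β j)) :=
    Integrable.fintype_prod fun j => integrable_prior z j
  refine Integrable.mono' (h1.const_mul ((√(2 * Real.pi * D.σ ^ 2))⁻¹ ^ n))
    (D.measurable_joint y z).aestronglyMeasurable (.of_forall fun β => ?_)
  rw [Real.norm_of_nonneg (h.joint_pos y z β).le, joint_eq]
  refine mul_le_mul_of_nonneg_right ?_ (Finset.prod_nonneg fun j _ => (h.prior_pos z j _).le)
  rw [lik_eq]
  refine mul_le_of_le_one_right (by positivity) (Real.exp_le_one_iff.2 ?_)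
  have := dotProduct_self_nonneg' (y - D.fit z β)
  rw [neg_div]
  have := h.σ
  exact neg_nonpos.2 (by positivity)

lemma Pos.mass_pos (h : D.Pos) (y : Fin n → ℝ) (z : Finset (Fin p)) : 0 < D.mass y z := by
  rw [mass, integral_pos_iff_support_of_nonneg (fun β => (h.joint_pos y z β).le)
    (h.integrable_joint y z)]
  have : Function.support (D.joint y z) = Set.univ :=
    Set.eq_univ_of_forall fun β => (h.joint_pos y z β).ne'
  rw [this]
  exact Measure.measure_univ_pos.2 (NeZero.ne _)

end Design

end SpikeSlab

end

/-! ### Integrating out the coefficients of a submodel, and product bounds for masses and overlaps.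
-/

noncomputable section

namespace SpikeSlab

namespace Design

variable {n p : ℕ}

/-! ### Splitting the coordinates along a model -/

lemma prod_eq_prod_mem_mul {M : Type*} [CommMonoid M] (a : Finset (Fin p)) (f : Fin p → M) :
    ∏ j, f j = (∏ j : a, f j) * ∏ j : {j // j ∉ a}, f j := by
  rw [← Fintype.prod_subtype_mul_prod_subtype (· ∈ a)]
  congr!

lemma sum_eq_sum_mem_add {M : Type*} [AddCommMonoid M] (a : Finset (Fin p)) (f : Fin p → M) :
    ∑ j, f j = (∑ j : a, f j) + ∑ j : {j // j ∉ a}, f j := by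
  rw [← Fintype.sum_subtype_add_sum_subtype (· ∈ a)]
  congr!

/-- The coefficient vector with given active and inactive parts. -/
def join (a : Finset (Fin p)) (b : a → ℝ) (γ : {j // j ∉ a} → ℝ) : Fin p → ℝ :=
  fun j => if h : j ∈ a then b ⟨j, h⟩ else γ ⟨j, h⟩

lemma join_of_mem {a : Finset (Fin p)} (b : a → ℝ) (γ : {j // j ∉ a} → ℝ) (j : a) :
    join a b γ j = b j := by
  rw [join, dif_pos j.2]

lemma join_of_notMem {a : Finset (Fin p)} (b : a → ℝ) (γ : {j // j ∉ a} → ℝ) (j : {j // j ∉ a}) :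
    join a b γ j = γ j := by
  rw [join, dif_neg j.2]

lemma integral_eq_integral_join (a : Finset (Fin p)) {F : (Fin p → ℝ) → ℝ} (hF : Integrable F) :
    Integrable (fun γ => ∫ b, F (join a b γ)) ∧
      ∫ β, F β = ∫ γ, ∫ b, F (join a b γ) := by
  have hm := (volume_preserving_piEquivPiSubtypeProd (fun _ : Fin p => ℝ) (· ∈ a)).symm
  have hi := (hm.integrable_comp_emb (MeasurableEquiv.measurableEmbedding _)).2 hF
  have he := hm.integral_comp (MeasurableEquiv.measurableEmbedding _) F
  have e := integral_prod_symm _ hi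
  constructor
  · convert hi.integral_prod_right
    rfl
  · refine (he.symm.trans e).trans ?_
    congr!

/-- The part of a coefficient vector in `z`, with the active part of `a` set to zero. -/
def off (a z : Finset (Fin p)) (γ : {j // j ∉ a} → ℝ) : Fin p → ℝ :=
  fun j => if j ∈ z then join a 0 γ j else 0

lemma off_of_mem {a z : Finset (Fin p)} (γ : {j // j ∉ a} → ℝ) {j : Fin p} (hj : j ∈ a) :
    off a z γ j = 0 := by
  simp [off, join, hj]

lemma off_of_notMem {a z : Finset (Fin p)} (γ : {j // j ∉ a} → ℝ) (j : {j // j ∉ a}) :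
    off a z γ j = if (j : Fin p) ∈ z then γ j else 0 := by
  rw [off, join_of_notMem]

lemma off_eq_zero {a z : Finset (Fin p)} (γ : {j // j ∉ a} → ℝ) {j : Fin p} (hj : j ∉ z \ a) :
    off a z γ j = 0 := by
  by_cases ha : j ∈ a
  · exact off_of_mem γ ha
  · have : j ∉ z := fun h => hj (Finset.mem_sdiff.2 ⟨h, ha⟩)
    simp [off, this]

/-- The condition `φ j 0 = 0` lets the same identity serve both the linear form and the squared
norm, so that both split over the coordinates outside `a`. -/
lemma sum_off (a z : Finset (Fin p)) (γ : {j // j ∉ a} → ℝ) (φ : Fin p → ℝ → ℝ)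
    (h0 : ∀ j, φ j 0 = 0) :
    ∑ j, φ j (off a z γ j) = ∑ j : {j // j ∉ a}, if (j : Fin p) ∈ z then φ j (γ j) else 0 := by
  rw [sum_eq_sum_mem_add a, Finset.sum_eq_zero, zero_add]
  · refine Finset.sum_congr rfl fun j _ => ?_
    rw [off_of_notMem]
    split_ifs <;> simp [h0]
  · rintro j -
    rw [off_of_mem γ j.2, h0]

lemma fit_join (D : Design n p) {a z : Finset (Fin p)} (haz : a ⊆ z) (b : a → ℝ)
    (γ : {j // j ∉ a} → ℝ) :
    D.fit z (join a b γ) = activeCols D.X a *ᵥ b + D.X *ᵥ off a z γ := by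
  ext i
  have h1 := sum_off a z γ (fun j x => D.X i j * x) (by simp)
  have h2 : ∑ j ∈ z, D.X i j * join a b γ j =
      ∑ j, if j ∈ z then D.X i j * join a b γ j else 0 := by simp
  simp only [fit, Pi.add_apply, mulVec, dotProduct]
  rw [h1, h2, sum_eq_sum_mem_add a]
  congr 1
  · refine Finset.sum_congr rfl fun j _ => ?_
    rw [join_of_mem, if_pos (haz j.2)]
    rfl
  · refine Finset.sum_congr rfl fun j _ => ?_
    rw [join_of_notMem]

lemma prod_prior_join (D : Design n p) {a z : Finset (Fin p)} (haz : a ⊆ z) (b : a → ℝ)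
    (γ : {j // j ∉ a} → ℝ) :
    ∏ j, D.prior z j (join a b γ j) =
      (∏ j, D.q * normalDensity 0 D.τ₁ (b j)) * ∏ j : {j // j ∉ a}, D.prior z j (γ j) := by
  rw [prod_eq_prod_mem_mul a]
  congr 1
  · refine Finset.prod_congr rfl fun j _ => ?_
    rw [join_of_mem, prior, if_pos (haz j.2)]
  · refine Finset.prod_congr rfl fun j _ => ?_
    rw [join_of_notMem]

variable (D : Design n p)

/-- The integral of likelihood and slab prior over the active coefficients. -/
def block (a : Finset (Fin p)) (v : Fin n → ℝ) : ℝ :=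
  ∫ b : a → ℝ, D.lik (v - activeCols D.X a *ᵥ b) * ∏ j, D.q * normalDensity 0 D.τ₁ (b j)

variable {D}

lemma block_nonneg (h : D.Pos) (a : Finset (Fin p)) (v : Fin n → ℝ) : 0 ≤ D.block a v :=
  integral_nonneg fun _ => mul_nonneg (h.lik_pos _).le
    (Finset.prod_nonneg fun _ _ => (mul_pos h.q (normalDensity_pos h.τ₁ _ _)).le)

lemma Pos.lik_mul_prior_eq (h : D.Pos) (a : Finset (Fin p)) (v : Fin n → ℝ) (b : a → ℝ) :
    D.lik (v - activeCols D.X a *ᵥ b) * ∏ j, D.q * normalDensity 0 D.τ₁ (b j) =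
      Real.exp (-D.quad a v / (2 * D.σ ^ 2)) *
        (D.lik (0 - activeCols D.X a *ᵥ (b - D.center a v)) *
          ∏ j, D.q * normalDensity 0 D.τ₁ ((b - D.center a v) j)) := by
  have hp : ∀ b : a → ℝ, ∏ j, D.q * normalDensity 0 D.τ₁ (b j) =
      (∏ _j : a, D.q * (√(2 * Real.pi * D.τ₁ ^ 2))⁻¹) *
        Real.exp (-(b ⬝ᵥ b) / (2 * D.τ₁ ^ 2)) := by
    intro b
    simp only [normalDensity_eq, sub_zero, ← mul_assoc]
    rw [Finset.prod_mul_distrib, ← Real.exp_sum, dotProduct, ← Finset.sum_div,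
      Finset.sum_neg_distrib]
    simp only [sq]
  have hs := D.complete_square h.σ.ne' h.τ₁.ne' a v b
  rw [hp, hp, lik_eq, lik_eq, zero_sub, neg_dotProduct, dotProduct_neg, neg_neg]
  set c1 := (√(2 * Real.pi * D.σ ^ 2))⁻¹ ^ n
  set c2 := ∏ _j : a, D.q * (√(2 * Real.pi * D.τ₁ ^ 2))⁻¹
  have e : ∀ x y z : ℝ, z * (c1 * x * (c2 * y)) = c1 * c2 * (z * x * y) := fun x y z => by ring
  have e' : ∀ x y : ℝ, c1 * x * (c2 * y) = c1 * c2 * (x * y) := fun x y => by ring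
  rw [e, e', ← Real.exp_add, ← Real.exp_add, ← Real.exp_add]
  congr 2
  have e2 : ∀ x s : ℝ, -x / (2 * s) = -(1 / 2) * (x / s) := fun x s => by
    rw [neg_div, mul_comm 2 s, ← div_div]; ring
  rw [e2, e2, e2, e2, e2]
  linear_combination -(1 / 2) * hs

/-- After completing the square, `v` enters the integrand only through a scalar factor and a
translation of `b`, and Lebesgue measure is translation invariant. -/
lemma Pos.block_eq (h : D.Pos) (a : Finset (Fin p)) (v : Fin n → ℝ) :
    D.block a v = Real.exp (-D.quad a v / (2 * D.σ ^ 2)) * D.block a 0 := by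
  unfold block
  simp_rw [h.lik_mul_prior_eq a v]
  rw [integral_const_mul, integral_sub_right_eq_self (fun b : a → ℝ =>
    D.lik (0 - activeCols D.X a *ᵥ b) * ∏ j, D.q * normalDensity 0 D.τ₁ (b j)) (D.center a v)]

/-- Moving the data by the contribution `u` of the coefficients outside `a` tilts the block by a
linear minus a quadratic term in `u`. All later comparisons rest on this exponent. -/
lemma Pos.block_sub (h : D.Pos) (a : Finset (Fin p)) (y u : Fin n → ℝ) :
    D.block a (y - u) = D.block a y *
      Real.exp ((((D.A a)⁻¹ *ᵥ y) ⬝ᵥ u) / D.σ ^ 2 - D.quad a u / (2 * D.σ ^ 2)) := by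
  rw [h.block_eq a (y - u), h.block_eq a y, quad_sub, mul_right_comm, ← Real.exp_add]
  congr 2
  have := h.σ
  field_simp
  ring

lemma dotProduct_mulVec_off (a z : Finset (Fin p)) (x : Fin n → ℝ) (γ : {j // j ∉ a} → ℝ) :
    x ⬝ᵥ (D.X *ᵥ off a z γ) =
      ∑ j : {j // j ∉ a}, if (j : Fin p) ∈ z then (D.X.col j ⬝ᵥ x) * γ j else 0 := by
  rw [← sum_off a z γ (fun j x' => (D.X.col j ⬝ᵥ x) * x') (by simp), dotProduct_mulVec, dotProduct]
  refine Finset.sum_congr rfl fun j _ => ?_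
  rw [vecMul, dotProduct_comm]
  rfl

/-- The mass of a model as an integral over the coordinates outside a submodel. -/
lemma Pos.mass_formula (h : D.Pos) (y : Fin n → ℝ) {a z : Finset (Fin p)} (haz : a ⊆ z) :
    Integrable (fun γ : {j // j ∉ a} → ℝ => D.block a y * ((∏ j : {j // j ∉ a}, D.prior z j (γ j)) *
      Real.exp ((((D.A a)⁻¹ *ᵥ y) ⬝ᵥ (D.X *ᵥ off a z γ)) / D.σ ^ 2 -
        D.quad a (D.X *ᵥ off a z γ) / (2 * D.σ ^ 2)))) ∧
    D.mass y z = ∫ γ : {j // j ∉ a} → ℝ, D.block a y * ((∏ j : {j // j ∉ a}, D.prior z j (γ j)) *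
      Real.exp ((((D.A a)⁻¹ *ᵥ y) ⬝ᵥ (D.X *ᵥ off a z γ)) / D.σ ^ 2 -
        D.quad a (D.X *ᵥ off a z γ) / (2 * D.σ ^ 2))) := by
  have hin : ∀ γ : {j // j ∉ a} → ℝ, ∫ b, D.joint y z (join a b γ) =
      D.block a y * ((∏ j : {j // j ∉ a}, D.prior z j (γ j)) *
      Real.exp ((((D.A a)⁻¹ *ᵥ y) ⬝ᵥ (D.X *ᵥ off a z γ)) / D.σ ^ 2 -
        D.quad a (D.X *ᵥ off a z γ) / (2 * D.σ ^ 2))) := by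
    intro γ
    rw [mul_left_comm, ← h.block_sub, mul_comm, block, ← integral_mul_const]
    refine integral_congr_ae (.of_forall fun b => ?_)
    simp only
    rw [joint_eq, fit_join D haz, prod_prior_join D haz, ← mul_assoc, sub_sub,
      add_comm (D.X *ᵥ off a z γ)]
  have := integral_eq_integral_join a (h.integrable_joint y z)
  simp only [hin] at this
  exact this

/-- The parallelogram identity: the geometric mean of two Gaussians of equal variance is the
Gaussian at the midpoint, damped by the distance of their centres. -/
lemma Pos.sqrt_lik_mul_lik (h : D.Pos) (r u : Fin n → ℝ) :
    √(D.lik (r - u) * D.lik r) =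
      D.lik (r - (1 / 2 : ℝ) • u) * Real.exp (-(u ⬝ᵥ u) / (8 * D.σ ^ 2)) := by
  rw [Real.sqrt_eq_iff_mul_self_eq (mul_nonneg (h.lik_pos _).le (h.lik_pos _).le)
    (mul_nonneg (h.lik_pos _).le (Real.exp_pos _).le)]
  rw [lik_eq, lik_eq, lik_eq]
  set c1 := (√(2 * Real.pi * D.σ ^ 2))⁻¹ ^ n
  have e : ∀ x y : ℝ, c1 * x * y * (c1 * x * y) = c1 * c1 * (x * y * x * y) := fun x y => by ring
  have e' : ∀ x y : ℝ, c1 * x * (c1 * y) = c1 * c1 * (x * y) := fun x y => by ring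
  rw [e, e', ← Real.exp_add, ← Real.exp_add, ← Real.exp_add, ← Real.exp_add]
  congr 2
  simp only [sub_dotProduct, dotProduct_sub, smul_dotProduct, dotProduct_smul, smul_eq_mul]
  rw [dotProduct_comm u r]
  have := h.σ
  field_simp
  ring

/-- The overlap of two nested models as an integral over the coordinates outside the smaller. -/
lemma Pos.overlap_formula (h : D.Pos) (y : Fin n → ℝ) {a z : Finset (Fin p)} (haz : a ⊆ z) :
    Integrable (fun γ : {j // j ∉ a} → ℝ => D.block a (y - (1 / 2 : ℝ) • (D.X *ᵥ off a z γ)) *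
      ((∏ j : {j // j ∉ a}, √(D.prior z j (γ j) * D.prior a j (γ j))) *
      Real.exp (-((D.X *ᵥ off a z γ) ⬝ᵥ (D.X *ᵥ off a z γ)) / (8 * D.σ ^ 2)))) ∧
    ∫ β, √(D.joint y z β * D.joint y a β) =
      ∫ γ : {j // j ∉ a} → ℝ, D.block a (y - (1 / 2 : ℝ) • (D.X *ᵥ off a z γ)) *
      ((∏ j : {j // j ∉ a}, √(D.prior z j (γ j) * D.prior a j (γ j))) *
      Real.exp (-((D.X *ᵥ off a z γ) ⬝ᵥ (D.X *ᵥ off a z γ)) / (8 * D.σ ^ 2))) := by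
  have hin : ∀ γ : {j // j ∉ a} → ℝ,
      ∫ b, √(D.joint y z (join a b γ) * D.joint y a (join a b γ)) =
      D.block a (y - (1 / 2 : ℝ) • (D.X *ᵥ off a z γ)) *
      ((∏ j : {j // j ∉ a}, √(D.prior z j (γ j) * D.prior a j (γ j))) *
      Real.exp (-((D.X *ᵥ off a z γ) ⬝ᵥ (D.X *ᵥ off a z γ)) / (8 * D.σ ^ 2))) := by
    intro γ
    rw [block, ← integral_mul_const]
    refine integral_congr_ae (.of_forall fun b => ?_)
    simp only
    have h0 : off a a γ = 0 := by
      ext j; exact off_eq_zero γ (by simp)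
    rw [joint_eq, joint_eq, fit_join D haz, fit_join D (subset_refl a), prod_prior_join D haz,
      prod_prior_join D (subset_refl a), h0, mulVec_zero, add_zero]
    set u := D.X *ᵥ off a z γ
    set r := y - activeCols D.X a *ᵥ b with hr
    have hr1 : y - (activeCols D.X a *ᵥ b + u) = r - u := by rw [hr]; abel
    have hr2 : y - (1 / 2 : ℝ) • u - activeCols D.X a *ᵥ b = r - (1 / 2 : ℝ) • u := by
      rw [hr]; abel
    rw [hr1, hr2]
    set P := ∏ j, D.q * normalDensity 0 D.τ₁ (b j) with hP
    have hP0 : 0 ≤ P := Finset.prod_nonneg fun _ _ =>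
      (mul_pos h.q (normalDensity_pos h.τ₁ _ _)).le
    have e : ∀ l₁ l₂ x₁ x₂ : ℝ, l₁ * (P * x₁) * (l₂ * (P * x₂)) = (P * P) * ((l₁ * l₂) * (x₁ * x₂)) :=
      fun _ _ _ _ => by ring
    rw [e, Real.sqrt_mul (mul_nonneg hP0 hP0), Real.sqrt_mul_self hP0,
      Real.sqrt_mul (mul_nonneg (h.lik_pos _).le (h.lik_pos _).le), h.sqrt_lik_mul_lik,
      ← Finset.prod_mul_distrib, Real.sqrt_prod _ fun j _ =>
        (mul_pos (h.prior_pos z _ _) (h.prior_pos a _ _)).le]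
    ring
  have hint : Integrable fun β => √(D.joint y z β * D.joint y a β) := by
    refine Integrable.mono' ((h.integrable_joint y z).add (h.integrable_joint y a))
      ((D.measurable_joint y z).mul (D.measurable_joint y a)).sqrt.aestronglyMeasurable
      (.of_forall fun β => ?_)
    have h₁ := (h.joint_pos y z β).le
    have h₂ := (h.joint_pos y a β).le
    rw [Real.norm_of_nonneg (Real.sqrt_nonneg _)]
    refine Real.sqrt_le_iff.2 ⟨add_nonneg h₁ h₂, ?_⟩
    simp only [Pi.add_apply]
    nlinarith [mul_nonneg h₁ h₂]
  have := integral_eq_integral_join a hint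
  simp only [hin] at this
  exact this

/-! ### Product bounds -/

/-- A product of functions of the coordinates outside `a`, equal to the spike prior outside `z`. -/
def outer (D : Design n p) (a z : Finset (Fin p)) (k : Fin p → ℝ → ℝ) (γ : {j // j ∉ a} → ℝ) : ℝ :=
  ∏ j : {j // j ∉ a},
    if (j : Fin p) ∈ z then k j (γ j) else (1 - D.q) * normalDensity 0 D.τ₀ (γ j)

lemma Pos.integral_outer (h : D.Pos) (a z : Finset (Fin p)) {k : Fin p → ℝ → ℝ}
    (hk : ∀ j, Integrable (k j)) :
    Integrable (D.outer a z k) ∧ ∫ γ, D.outer a z k γ =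
      ∏ j : {j // j ∉ a}, if (j : Fin p) ∈ z then ∫ x, k j x else 1 - D.q := by
  constructor
  · refine Integrable.fintype_prod (f := fun (j : {j // j ∉ a}) (x : ℝ) =>
      if (j : Fin p) ∈ z then k j x else (1 - D.q) * normalDensity 0 D.τ₀ x) fun j => ?_
    split_ifs
    · exact hk j
    · exact (integrable_normalDensity _ _).const_mul _
  · unfold outer
    rw [integral_fintype_prod_volume_eq_prod (fun (j : {j // j ∉ a}) (x : ℝ) =>
      if (j : Fin p) ∈ z then k j x else (1 - D.q) * normalDensity 0 D.τ₀ x)]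
    refine Finset.prod_congr rfl fun j _ => ?_
    split_ifs
    · rfl
    · rw [integral_const_mul, integral_normalDensity h.τ₀, mul_one]

lemma prod_outer_const (a z : Finset (Fin p)) (u c : ℝ) :
    ∏ j : {j // j ∉ a}, (if (j : Fin p) ∈ z then u * c else u) =
      c ^ (z \ a).card * u ^ (Fintype.card {j // j ∉ a}) := by
  have h1 : ∀ j : {j // j ∉ a}, (if (j : Fin p) ∈ z then u * c else u) =
      (if (j : Fin p) ∈ z then c else 1) * u := fun j => by split_ifs <;> ring
  rw [Finset.prod_congr rfl fun j _ => h1 j, Finset.prod_mul_distrib, Finset.prod_const,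
    Finset.card_univ]
  congr 1
  rw [← Finset.prod_subtype aᶜ (p := fun j => j ∉ a) (fun j => Finset.mem_compl)
    (fun j => if j ∈ z then c else 1), Finset.prod_ite, Finset.prod_const, Finset.prod_const_one,
    mul_one]
  congr 2
  ext j
  simp [and_comm]

lemma Pos.mass_self (h : D.Pos) (y : Fin n → ℝ) (a : Finset (Fin p)) :
    D.mass y a = D.block a y * (1 - D.q) ^ (Fintype.card {j // j ∉ a}) := by
  rw [(h.mass_formula y (subset_refl a)).2, integral_const_mul]
  congr 1
  have h0 : ∀ γ, off a a γ = 0 := fun γ => by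
    ext j; exact off_eq_zero γ (by simp)
  have hp := (h.integral_outer a a (k := fun _ => normalDensity 0 D.τ₀)
    fun _ => integrable_normalDensity _ _).2
  have hne : ∀ j : {j // j ∉ a}, (j : Fin p) ∉ a := fun j => j.2
  simp only [outer, hne, if_false] at hp
  simp [h0, quad, prior, hne, hp]

lemma Pos.integrable_slab_mul_exp (h : D.Pos) {ω : ℝ} (hω : 0 ≤ ω) (w : ℝ) :
    Integrable fun x => normalDensity 0 D.τ₁ x * Real.exp (w * x - ω * x ^ 2) := by
  have := h.τ₁
  have hα : 0 < 1 / (2 * D.τ₁ ^ 2) + ω := by positivity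
  refine ((integrable_exp_quadratic hα w).const_mul (√(2 * Real.pi * D.τ₁ ^ 2))⁻¹).congr
    (.of_forall fun x => ?_)
  simp only [normalDensity_eq]
  rw [mul_assoc _ (Real.exp _) (Real.exp _), ← Real.exp_add]
  congr 2
  ring

lemma Pos.integral_slab_mul_exp (h : D.Pos) {ω : ℝ} (hω : 0 ≤ ω) (w : ℝ) :
    ∫ x, normalDensity 0 D.τ₁ x * Real.exp (w * x - ω * x ^ 2) =
      (√(1 + 2 * D.τ₁ ^ 2 * ω))⁻¹ * Real.exp (w ^ 2 / (4 * (1 / (2 * D.τ₁ ^ 2) + ω))) := by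
  have := h.τ₁
  have hα : 0 < 1 / (2 * D.τ₁ ^ 2) + ω := by positivity
  have e : ∀ x, normalDensity 0 D.τ₁ x * Real.exp (w * x - ω * x ^ 2) =
      (√(2 * Real.pi * D.τ₁ ^ 2))⁻¹ *
        Real.exp (-(1 / (2 * D.τ₁ ^ 2) + ω) * x ^ 2 + w * x) := fun x => by
    simp only [normalDensity_eq]
    rw [mul_assoc, ← Real.exp_add]
    congr 2
    ring
  simp_rw [e]
  rw [integral_const_mul, integral_exp_quadratic hα, ← mul_assoc]
  congr 1
  rw [← Real.sqrt_inv, ← Real.sqrt_inv, ← Real.sqrt_mul (by positivity)]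
  congr 1
  field_simp

/-- The slab prior, tilted by the exponential of a quadratic polynomial. -/
def tilt (D : Design n p) (a : Finset (Fin p)) (y : Fin n → ℝ) (ω : ℝ) (j : Fin p) (x : ℝ) : ℝ :=
  D.q * (normalDensity 0 D.τ₁ x *
    Real.exp ((D.X.col j ⬝ᵥ ((D.A a)⁻¹ *ᵥ y)) / D.σ ^ 2 * x - ω / (2 * D.σ ^ 2) * x ^ 2))

lemma Pos.integrable_tilt (h : D.Pos) (a : Finset (Fin p)) (y : Fin n → ℝ) {ω : ℝ} (hω : 0 ≤ ω)
    (j : Fin p) : Integrable (D.tilt a y ω j) := by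
  have := h.σ
  exact (h.integrable_slab_mul_exp (by positivity) _).const_mul _

lemma Pos.integral_tilt (h : D.Pos) (a : Finset (Fin p)) (y : Fin n → ℝ) {ω : ℝ} (hω : 0 ≤ ω)
    (j : Fin p) : ∫ x, D.tilt a y ω j x =
      D.q * ((√(1 + D.τ₁ ^ 2 * ω / D.σ ^ 2))⁻¹ *
        Real.exp ((D.X.col j ⬝ᵥ ((D.A a)⁻¹ *ᵥ y)) ^ 2 /
          (2 * D.σ ^ 2 * (D.σ ^ 2 / D.τ₁ ^ 2 + ω)))) := by
  have h1 := h.σ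
  have h2 := h.τ₁
  unfold tilt
  rw [integral_const_mul, h.integral_slab_mul_exp (by positivity)]
  congr 3
  · congr 2; field_simp
  · field_simp; ring

lemma outer_tilt (a z : Finset (Fin p)) (y : Fin n → ℝ) (ω : ℝ) (γ : {j // j ∉ a} → ℝ) :
    D.outer a z (D.tilt a y ω) γ = (∏ j : {j // j ∉ a}, D.prior z j (γ j)) *
      Real.exp ((((D.A a)⁻¹ *ᵥ y) ⬝ᵥ (D.X *ᵥ off a z γ)) / D.σ ^ 2 -
        ω / (2 * D.σ ^ 2) * ∑ j, off a z γ j ^ 2) := by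
  rw [dotProduct_mulVec_off, sum_off a z γ (fun _ x => x ^ 2) (by simp), Finset.sum_div,
    Finset.mul_sum, ← Finset.sum_sub_distrib, Real.exp_sum, ← Finset.prod_mul_distrib, outer]
  refine Finset.prod_congr rfl fun j _ => ?_
  rw [prior]
  split_ifs
  · rw [tilt, mul_assoc]
    congr 3
    ring
  · simp

/-- Replacing the quadratic form by its lower bound `ω ‖·‖²` decouples the coordinates. Each one in
`z \ a` then contributes at most `c` relative to the spike factor `1 - q` it carries in the mass of
`a`. -/
lemma Pos.mass_le (h : D.Pos) (y : Fin n → ℝ) {a z : Finset (Fin p)} (haz : a ⊆ z) {ω c : ℝ}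
    (hω : 0 ≤ ω)
    (hQ : ∀ γ, ω * ∑ j, off a z γ j ^ 2 ≤ D.quad a (D.X *ᵥ off a z γ))
    (hI : ∀ j ∈ z \ a, ∫ x, D.tilt a y ω j x ≤ (1 - D.q) * c) :
    D.mass y z ≤ c ^ (z \ a).card * D.mass y a := by
  have hσ := h.σ
  have hk0 : ∀ j x, 0 ≤ D.tilt a y ω j x := fun j x =>
    mul_nonneg h.q.le (mul_nonneg (normalDensity_pos h.τ₁ _ _).le (Real.exp_pos _).le)
  obtain ⟨hint, hval⟩ := h.integral_outer a z (h.integrable_tilt a y hω)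
  have hB := block_nonneg h a y
  rw [(h.mass_formula y haz).2]
  have step : ∀ γ : {j // j ∉ a} → ℝ, (∏ j : {j // j ∉ a}, D.prior z j (γ j)) *
      Real.exp ((((D.A a)⁻¹ *ᵥ y) ⬝ᵥ (D.X *ᵥ off a z γ)) / D.σ ^ 2 -
        D.quad a (D.X *ᵥ off a z γ) / (2 * D.σ ^ 2)) ≤ D.outer a z (D.tilt a y ω) γ := by
    intro γ
    rw [outer_tilt]
    refine mul_le_mul_of_nonneg_left (Real.exp_le_exp.2 ?_)
      (Finset.prod_nonneg fun j _ => (h.prior_pos z _ _).le)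
    have : ω / (2 * D.σ ^ 2) * ∑ j, off a z γ j ^ 2 ≤
        D.quad a (D.X *ᵥ off a z γ) / (2 * D.σ ^ 2) := by
      rw [div_mul_eq_mul_div]
      exact div_le_div_of_nonneg_right (hQ γ) (by positivity)
    linarith
  refine (integral_mono_of_nonneg (.of_forall fun γ => ?_) (hint.const_mul (D.block a y))
    (.of_forall fun γ => mul_le_mul_of_nonneg_left (step γ) hB)).trans ?_
  · exact mul_nonneg hB (mul_nonneg (Finset.prod_nonneg fun j _ => (h.prior_pos z _ _).le)
      (Real.exp_pos _).le)
  rw [integral_const_mul, hval, h.mass_self, mul_left_comm, ← prod_outer_const a z (1 - D.q) c]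
  refine mul_le_mul_of_nonneg_left (Finset.prod_le_prod (fun j _ => ?_) fun j _ => ?_) hB
  · split_ifs
    · exact integral_nonneg (hk0 _)
    · exact h.q'.le
  · split_ifs with hj
    · exact hI j (Finset.mem_sdiff.2 ⟨hj, j.2⟩)
    · exact le_rfl

/-- The reverse decoupling: the quadratic form is at most the squared norm of the fitted vector,
hence at most `ρ ‖·‖²`. -/
lemma Pos.le_mass (h : D.Pos) (y : Fin n → ℝ) {a z : Finset (Fin p)} (haz : a ⊆ z) {ρ c : ℝ}
    (hρ : 0 ≤ ρ) (hc : 0 ≤ c)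
    (hQ : ∀ γ, (D.X *ᵥ off a z γ) ⬝ᵥ (D.X *ᵥ off a z γ) ≤ ρ * ∑ j, off a z γ j ^ 2)
    (hI : ∀ j ∈ z \ a, (1 - D.q) * c ≤ ∫ x, D.tilt a y ρ j x) :
    c ^ (z \ a).card * D.mass y a ≤ D.mass y z := by
  have hσ := h.σ
  obtain ⟨hint, hval⟩ := h.integral_outer a z (h.integrable_tilt a y hρ)
  have hB := block_nonneg h a y
  obtain ⟨hmi, hmv⟩ := h.mass_formula y haz
  rw [hmv]
  have step : ∀ γ : {j // j ∉ a} → ℝ, D.outer a z (D.tilt a y ρ) γ ≤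
      (∏ j : {j // j ∉ a}, D.prior z j (γ j)) *
      Real.exp ((((D.A a)⁻¹ *ᵥ y) ⬝ᵥ (D.X *ᵥ off a z γ)) / D.σ ^ 2 -
        D.quad a (D.X *ᵥ off a z γ) / (2 * D.σ ^ 2)) := by
    intro γ
    rw [outer_tilt]
    refine mul_le_mul_of_nonneg_left (Real.exp_le_exp.2 ?_)
      (Finset.prod_nonneg fun j _ => (h.prior_pos z _ _).le)
    have : D.quad a (D.X *ᵥ off a z γ) / (2 * D.σ ^ 2) ≤
        ρ / (2 * D.σ ^ 2) * ∑ j, off a z γ j ^ 2 := by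
      rw [div_mul_eq_mul_div]
      exact div_le_div_of_nonneg_right ((D.quad_le hσ.ne' h.τ₁.ne' a _).trans (hQ γ))
        (by positivity)
    linarith
  refine le_trans ?_ (integral_mono (hint.const_mul (D.block a y)) hmi
    fun γ => mul_le_mul_of_nonneg_left (step γ) hB)
  rw [integral_const_mul, hval, h.mass_self, mul_left_comm, ← prod_outer_const a z (1 - D.q) c]
  refine mul_le_mul_of_nonneg_left (Finset.prod_le_prod (fun j _ => ?_) fun j _ => ?_) hB
  · have := h.q'
    split_ifs <;> positivity
  · split_ifs with hj
    · exact hI j (Finset.mem_sdiff.2 ⟨hj, j.2⟩)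
    · exact le_rfl

/-- The geometric mean of slab and spike prior, tilted by the exponential of a quadratic
polynomial. -/
def geomTilt (D : Design n p) (a : Finset (Fin p)) (y : Fin n → ℝ) (ρ : ℝ) (j : Fin p) (x : ℝ) :
    ℝ :=
  √((D.q * normalDensity 0 D.τ₁ x) * ((1 - D.q) * normalDensity 0 D.τ₀ x)) *
    Real.exp ((D.X.col j ⬝ᵥ ((D.A a)⁻¹ *ᵥ y)) / (2 * D.σ ^ 2) * x - ρ / (4 * D.σ ^ 2) * x ^ 2)

lemma Pos.geomTilt_eq (h : D.Pos) (a : Finset (Fin p)) (y : Fin n → ℝ) (ρ : ℝ) (j : Fin p)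
    (x : ℝ) : D.geomTilt a y ρ j x =
      √(D.q * (1 - D.q)) * (√(2 * Real.pi * D.τ₀ * D.τ₁))⁻¹ *
        Real.exp (-((1 / D.τ₀ ^ 2 + 1 / D.τ₁ ^ 2) / 4 + ρ / (4 * D.σ ^ 2)) * x ^ 2 +
          (D.X.col j ⬝ᵥ ((D.A a)⁻¹ *ᵥ y)) / (2 * D.σ ^ 2) * x) := by
  have h0 := h.τ₀
  have h1 := h.τ₁
  have hq := h.q
  have hq' := h.q'
  have e : √((D.q * normalDensity 0 D.τ₁ x) * ((1 - D.q) * normalDensity 0 D.τ₀ x)) =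
      √(D.q * (1 - D.q)) * (√(2 * Real.pi * D.τ₀ * D.τ₁))⁻¹ *
        Real.exp (-((1 / D.τ₀ ^ 2 + 1 / D.τ₁ ^ 2) / 4) * x ^ 2) := by
    rw [Real.sqrt_eq_iff_mul_self_eq (mul_nonneg (mul_pos hq (normalDensity_pos h1 _ _)).le
      (mul_pos hq' (normalDensity_pos h0 _ _)).le) (by positivity)]
    have s1 : √(D.q * (1 - D.q)) * √(D.q * (1 - D.q)) = D.q * (1 - D.q) :=
      Real.mul_self_sqrt (by positivity)
    have s2 : (√(2 * Real.pi * D.τ₀ * D.τ₁))⁻¹ * (√(2 * Real.pi * D.τ₀ * D.τ₁))⁻¹ =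
        (√(2 * Real.pi * D.τ₁ ^ 2))⁻¹ * (√(2 * Real.pi * D.τ₀ ^ 2))⁻¹ := by
      rw [← mul_inv, ← mul_inv, Real.mul_self_sqrt (by positivity), ← Real.sqrt_mul (by positivity)]
      congr 1
      rw [eq_comm, Real.sqrt_eq_iff_mul_self_eq (by positivity) (by positivity)]
      ring
    have s3 : Real.exp (-((1 / D.τ₀ ^ 2 + 1 / D.τ₁ ^ 2) / 4) * x ^ 2) *
        Real.exp (-((1 / D.τ₀ ^ 2 + 1 / D.τ₁ ^ 2) / 4) * x ^ 2) =
        Real.exp (-(x - 0) ^ 2 / (2 * D.τ₁ ^ 2)) * Real.exp (-(x - 0) ^ 2 / (2 * D.τ₀ ^ 2)) := by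
      rw [← Real.exp_add, ← Real.exp_add]
      congr 1
      field_simp
      ring
    rw [normalDensity_eq, normalDensity_eq, eq_comm]
    calc _ = (√(D.q * (1 - D.q)) * √(D.q * (1 - D.q))) *
          ((√(2 * Real.pi * D.τ₀ * D.τ₁))⁻¹ * (√(2 * Real.pi * D.τ₀ * D.τ₁))⁻¹) *
          (Real.exp (-((1 / D.τ₀ ^ 2 + 1 / D.τ₁ ^ 2) / 4) * x ^ 2) *
            Real.exp (-((1 / D.τ₀ ^ 2 + 1 / D.τ₁ ^ 2) / 4) * x ^ 2)) := by ring
      _ = _ := by rw [s1, s2, s3]; ring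
  rw [geomTilt, e, mul_assoc _ (Real.exp _) (Real.exp _), ← Real.exp_add]
  congr 2
  ring

lemma Pos.integral_geomTilt (h : D.Pos) (a : Finset (Fin p)) (y : Fin n → ℝ) {ρ : ℝ} (hρ : 0 ≤ ρ)
    (j : Fin p) : Integrable (D.geomTilt a y ρ j) ∧
      √(D.q * (1 - D.q)) *
        √(1 / (2 * D.τ₀ * D.τ₁ * ((1 / D.τ₀ ^ 2 + 1 / D.τ₁ ^ 2) / 4 + ρ / (4 * D.σ ^ 2)))) ≤
        ∫ x, D.geomTilt a y ρ j x := by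
  have h0 := h.τ₀
  have h1 := h.τ₁
  have hσ := h.σ
  have hα : 0 < (1 / D.τ₀ ^ 2 + 1 / D.τ₁ ^ 2) / 4 + ρ / (4 * D.σ ^ 2) := by positivity
  have e : D.geomTilt a y ρ j = fun x => √(D.q * (1 - D.q)) * (√(2 * Real.pi * D.τ₀ * D.τ₁))⁻¹ *
        Real.exp (-((1 / D.τ₀ ^ 2 + 1 / D.τ₁ ^ 2) / 4 + ρ / (4 * D.σ ^ 2)) * x ^ 2 +
          (D.X.col j ⬝ᵥ ((D.A a)⁻¹ *ᵥ y)) / (2 * D.σ ^ 2) * x) :=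
    funext (h.geomTilt_eq a y ρ j)
  rw [e]
  refine ⟨(integrable_exp_quadratic hα _).const_mul _, ?_⟩
  rw [integral_const_mul, integral_exp_quadratic hα, mul_assoc (√(D.q * (1 - D.q))),
    ← mul_assoc (√(2 * Real.pi * D.τ₀ * D.τ₁))⁻¹]
  refine mul_le_mul_of_nonneg_left ?_ (Real.sqrt_nonneg _)
  have s : (√(2 * Real.pi * D.τ₀ * D.τ₁))⁻¹ *
      √(Real.pi / ((1 / D.τ₀ ^ 2 + 1 / D.τ₁ ^ 2) / 4 + ρ / (4 * D.σ ^ 2))) =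
      √(1 / (2 * D.τ₀ * D.τ₁ * ((1 / D.τ₀ ^ 2 + 1 / D.τ₁ ^ 2) / 4 + ρ / (4 * D.σ ^ 2)))) := by
    rw [← Real.sqrt_inv, ← Real.sqrt_mul (by positivity)]
    congr 1
    set α := (1 / D.τ₀ ^ 2 + 1 / D.τ₁ ^ 2) / 4 + ρ / (4 * D.σ ^ 2)
    field_simp
  rw [s]
  -- The linear tilt only increases a centred Gaussian integral, so no information on the
  -- correlations with the data is needed for lower bounds.
  exact le_mul_of_one_le_right (Real.sqrt_nonneg _) (Real.one_le_exp (by positivity))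

lemma Pos.outer_geomTilt (h : D.Pos) (a z : Finset (Fin p)) (y : Fin n → ℝ) (ρ : ℝ)
    (γ : {j // j ∉ a} → ℝ) :
    D.outer a z (D.geomTilt a y ρ) γ =
      (∏ j : {j // j ∉ a}, √(D.prior z j (γ j) * D.prior a j (γ j))) *
      Real.exp ((((D.A a)⁻¹ *ᵥ y) ⬝ᵥ (D.X *ᵥ off a z γ)) / (2 * D.σ ^ 2) -
        ρ / (4 * D.σ ^ 2) * ∑ j, off a z γ j ^ 2) := by
  rw [dotProduct_mulVec_off, sum_off a z γ (fun _ x => x ^ 2) (by simp), Finset.sum_div,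
    Finset.mul_sum, ← Finset.sum_sub_distrib, Real.exp_sum, ← Finset.prod_mul_distrib, outer]
  refine Finset.prod_congr rfl fun j _ => ?_
  rw [prior, prior, if_neg j.2]
  split_ifs
  · rw [geomTilt]
    congr 2
    ring
  · rw [Real.sqrt_mul_self (mul_pos h.q' (normalDensity_pos h.τ₀ _ _)).le]
    simp

lemma Pos.le_overlap (h : D.Pos) (y : Fin n → ℝ) {a z : Finset (Fin p)} (haz : a ⊆ z) {ρ c : ℝ}
    (hρ : 0 ≤ ρ) (hc : 0 ≤ c)
    (hQ : ∀ γ, (D.X *ᵥ off a z γ) ⬝ᵥ (D.X *ᵥ off a z γ) ≤ ρ * ∑ j, off a z γ j ^ 2)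
    (hI : (1 - D.q) * c ≤ √(D.q * (1 - D.q)) *
      √(1 / (2 * D.τ₀ * D.τ₁ * ((1 / D.τ₀ ^ 2 + 1 / D.τ₁ ^ 2) / 4 + ρ / (4 * D.σ ^ 2))))) :
    c ^ (z \ a).card * D.mass y a ≤ ∫ β, √(D.joint y z β * D.joint y a β) := by
  have hσ := h.σ
  obtain ⟨hint, hval⟩ := h.integral_outer a z fun j => (h.integral_geomTilt a y hρ j).1
  have hB := block_nonneg h a y
  obtain ⟨hmi, hmv⟩ := h.overlap_formula y haz
  rw [hmv]
  have step : ∀ γ : {j // j ∉ a} → ℝ, D.block a y * D.outer a z (D.geomTilt a y ρ) γ ≤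
      D.block a (y - (1 / 2 : ℝ) • (D.X *ᵥ off a z γ)) *
      ((∏ j : {j // j ∉ a}, √(D.prior z j (γ j) * D.prior a j (γ j))) *
      Real.exp (-((D.X *ᵥ off a z γ) ⬝ᵥ (D.X *ᵥ off a z γ)) / (8 * D.σ ^ 2))) := by
    intro γ
    rw [h.outer_geomTilt, h.block_sub, mul_assoc (D.block a y), mul_left_comm (Real.exp _),
      ← Real.exp_add, quad_smul, dotProduct_smul, smul_eq_mul]
    refine mul_le_mul_of_nonneg_left (mul_le_mul_of_nonneg_left (Real.exp_le_exp.2 ?_)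
      (Finset.prod_nonneg fun j _ => Real.sqrt_nonneg _)) hB
    have h1 := hQ γ
    have h2 := D.quad_le hσ.ne' h.τ₁.ne' a (D.X *ᵥ off a z γ)
    generalize D.quad a (D.X *ᵥ off a z γ) = Q at h2 ⊢
    generalize (D.X *ᵥ off a z γ) ⬝ᵥ (D.X *ᵥ off a z γ) = U at h1 h2 ⊢
    generalize ∑ j, off a z γ j ^ 2 = V at h1 ⊢
    generalize ((D.A a)⁻¹ *ᵥ y) ⬝ᵥ (D.X *ᵥ off a z γ) = T
    -- The midpoint block gives `-Q / (8 σ²)` and the damping gives `-U / (8 σ²)`; since `Q ≤ U ≤ ρ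
    -- V`, together they are at least `-ρ V / (4 σ²)`, the exponent in `geomTilt`.
    have e : 1 / 2 * T / D.σ ^ 2 - (1 / 2) ^ 2 * Q / (2 * D.σ ^ 2) + -U / (8 * D.σ ^ 2) -
        (T / (2 * D.σ ^ 2) - ρ / (4 * D.σ ^ 2) * V) =
        (2 * (ρ * V - U) + (U - Q)) / (8 * D.σ ^ 2) := by field_simp; ring
    have : 0 ≤ (2 * (ρ * V - U) + (U - Q)) / (8 * D.σ ^ 2) :=
      div_nonneg (by linarith) (by positivity)
    linarith
  refine le_trans ?_ (integral_mono (hint.const_mul (D.block a y)) hmi step)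
  rw [integral_const_mul, hval, h.mass_self, mul_left_comm, ← prod_outer_const a z (1 - D.q) c]
  refine mul_le_mul_of_nonneg_left (Finset.prod_le_prod (fun j _ => ?_) fun j _ => ?_) hB
  · have := h.q'
    split_ifs <;> positivity
  · split_ifs with hj
    · exact hI.trans (h.integral_geomTilt a y hρ j).2
    · exact le_rfl

end Design

end SpikeSlab

end

/-! ### The posterior as an abstract mixture, and bounds specific to the design and the prior
scaling. -/

noncomputable section

namespace SpikeSlab

namespace Mixture

variable {ι Ω : Type*} [Fintype ι] [MeasurableSpace Ω] (M : Mixture ι Ω)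

/-- The density of a component relative to the target. -/
lemma component_eq {z : ι} (hz : 0 < M.w z) :
    M.ν z = M.target.withDensity fun x => ENNReal.ofReal (M.r z x / M.w z) := by
  have h1 : (fun x => ENNReal.ofReal (M.r z x / M.w z)) =
      ENNReal.ofReal (M.w z)⁻¹ • fun x => ENNReal.ofReal (M.r z x) := by
    ext x
    rw [Pi.smul_apply, smul_eq_mul, ← ENNReal.ofReal_mul (by positivity)]
    congr 1
    field_simp
  rw [h1, withDensity_smul _ (M.measurable_r z).ennreal_ofReal, M.bayes, smul_smul,
    ← ENNReal.ofReal_mul (by positivity), inv_mul_cancel₀ hz.ne', ENNReal.ofReal_one, one_smul]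

/-- Model probabilities are at most 1, so a start from one component is as warm as the inverse of
its weight. -/
lemma isDensity_component {z : ι} {B : ℝ} (hz : 0 < M.w z) (hB : 1 / B ≤ M.w z) (hB0 : 0 < B) :
    M.IsDensity B fun x => M.r z x / M.w z where
  meas := (M.measurable_r z).div_const _
  nonneg x := div_nonneg (M.r_nonneg z x) hz.le
  le x := by
    rw [div_le_iff₀ hz]
    rw [div_le_iff₀ hB0] at hB
    linarith [M.r_le_one z x]
  one := by rw [integral_div, M.integral_r, div_self hz.ne']

end Mixture

namespace Design

variable {n p : ℕ} {D : Design n p}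

lemma Pos.sum_mass_pos (h : D.Pos) (y : Fin n → ℝ) : 0 < ∑ z : Finset (Fin p), D.mass y z :=
  Finset.sum_pos (fun z _ => h.mass_pos y z) Finset.univ_nonempty

lemma Pos.sum_joint_pos (h : D.Pos) (y : Fin n → ℝ) (β : Fin p → ℝ) :
    0 < ∑ z : Finset (Fin p), D.joint y z β :=
  Finset.sum_pos (fun z _ => h.joint_pos y z β) Finset.univ_nonempty

lemma Pos.integral_joint_div (h : D.Pos) (y : Fin n → ℝ) (z : Finset (Fin p)) :
    ∫ β, D.joint y z β / D.mass y z = 1 := by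
  rw [integral_div, ← mass, div_self (h.mass_pos y z).ne']

lemma Pos.bayes (h : D.Pos) (y : Fin n → ℝ) (z : Finset (Fin p)) :
    (D.betaPosterior y).withDensity (fun β => ENNReal.ofReal (D.modelGivenBeta y β z)) =
      ENNReal.ofReal (D.modelProb y z) • D.betaGivenModel y z := by
  have hj := D.measurable_joint y
  have m1 : Measurable fun β => ENNReal.ofReal
      ((∑ z : Finset (Fin p), D.joint y z β) / ∑ z : Finset (Fin p), D.mass y z) :=
    ((Finset.measurable_sum _ fun z _ => hj z).div_const _).ennreal_ofReal
  have m2 := (D.measurable_modelGivenBeta y z).ennreal_ofReal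
  have m3 : Measurable fun β => ENNReal.ofReal (D.joint y z β / D.mass y z) :=
    ((hj z).div_const _).ennreal_ofReal
  refine (withDensity_mul volume m1 m2).symm.trans
    (Eq.trans ?_ (withDensity_smul (ENNReal.ofReal (D.modelProb y z)) m3))
  refine congrArg _ (funext fun β => ?_)
  have h1 := h.sum_joint_pos y β
  have h2 := h.sum_mass_pos y
  have h3 := h.mass_pos y z
  have h4 : 0 ≤ D.modelProb y z := div_nonneg h3.le h2.le
  have h5 : 0 ≤ (∑ z : Finset (Fin p), D.joint y z β) / ∑ z : Finset (Fin p), D.mass y z :=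
    div_nonneg h1.le h2.le
  simp only [Pi.mul_apply, Pi.smul_apply, smul_eq_mul]
  rw [← ENNReal.ofReal_mul h5, ← ENNReal.ofReal_mul h4, modelGivenBeta, modelProb]
  congr 1
  field_simp

/-- The posterior as a mixture over models. -/
def Pos.mixture (h : D.Pos) (y : Fin n → ℝ) : Mixture (Finset (Fin p)) (Fin p → ℝ) where
  w := D.modelProb y
  ν := D.betaGivenModel y
  r z β := D.modelGivenBeta y β z
  target := D.betaPosterior y
  prob z := ⟨by
    rw [betaGivenModel, withDensity_apply _ MeasurableSet.univ, Measure.restrict_univ,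
      ← ofReal_integral_eq_lintegral_ofReal ((h.integrable_joint y z).div_const _)
        (.of_forall fun β => div_nonneg (h.joint_pos y z β).le (h.mass_pos y z).le),
      h.integral_joint_div, ENNReal.ofReal_one]⟩
  w_nonneg z := div_nonneg (h.mass_pos y z).le (h.sum_mass_pos y).le
  sum_w := by
    unfold modelProb
    rw [← Finset.sum_div, div_self (h.sum_mass_pos y).ne']
  measurable_r z := D.measurable_modelGivenBeta y z
  r_nonneg z β := div_nonneg (h.joint_pos y z β).le (h.sum_joint_pos y β).le
  sum_r β := by
    unfold modelGivenBeta
    rw [← Finset.sum_div, div_self (h.sum_joint_pos y β).ne']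
  bayes z := h.bayes y z

lemma Pos.integral_betaGivenModel (h : D.Pos) (y : Fin n → ℝ) (z : Finset (Fin p))
    (f : (Fin p → ℝ) → ℝ) :
    ∫ β, f β ∂D.betaGivenModel y z = ∫ β, D.joint y z β / D.mass y z * f β := by
  rw [betaGivenModel, integral_withDensity_eq_integral_toReal_smul
    ((D.measurable_joint y z).div_const _).ennreal_ofReal (.of_forall fun _ => ENNReal.ofReal_lt_top)]
  refine integral_congr_ae (.of_forall fun β => ?_)
  simp only [smul_eq_mul]
  rw [ENNReal.toReal_ofReal (div_nonneg (h.joint_pos y z β).le (h.mass_pos y z).le)]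

/-- Comparison of the means of a density under two models whose masses and overlap are
controlled. -/
lemma Pos.sq_mean_sub_le (h : D.Pos) (y : Fin n → ℝ) {a z : Finset (Fin p)} {B c₁ c₂ R : ℝ}
    (hc₂ : 0 < c₂) (hmass : D.mass y z ≤ c₁ * D.mass y a)
    (hov : c₂ * D.mass y a ≤ ∫ β, √(D.joint y z β * D.joint y a β)) (hR : c₁ ≤ R * c₂ ^ 2)
    {g : (Fin p → ℝ) → ℝ} (hg : (h.mixture y).IsDensity B g) :
    (∫ x, g x ∂(h.mixture y).ν z - ∫ x, g x ∂(h.mixture y).ν a) ^ 2 ≤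
      2 * R * ((∫ x, (g x - ∫ x', g x' ∂(h.mixture y).ν z) ^ 2 ∂(h.mixture y).ν z) +
        ∫ x, (g x - ∫ x', g x' ∂(h.mixture y).ν a) ^ 2 ∂(h.mixture y).ν a) := by
  have hz := h.mass_pos y z
  have ha := h.mass_pos y a
  have key := sq_mean_sub_mul_sq_overlap_le (μ := volume)
    (g₁ := fun β => D.joint y z β / D.mass y z) (g₂ := fun β => D.joint y a β / D.mass y a)
    ((D.measurable_joint y z).div_const _) ((D.measurable_joint y a).div_const _)
    (fun β => div_nonneg (h.joint_pos y z β).le hz.le)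
    (fun β => div_nonneg (h.joint_pos y a β).le ha.le)
    ((h.integrable_joint y z).div_const _) ((h.integrable_joint y a).div_const _)
    (h.integral_joint_div y z) (h.integral_joint_div y a) hg.meas
    (B := B) (fun x => by rw [abs_of_nonneg (hg.nonneg x)]; exact hg.le x)
    (∫ x, g x ∂(h.mixture y).ν z) (∫ x, g x ∂(h.mixture y).ν a)
  rw [← h.integral_betaGivenModel y z (fun x => (g x - ∫ x, g x ∂(h.mixture y).ν z) ^ 2),
    ← h.integral_betaGivenModel y a (fun x => (g x - ∫ x, g x ∂(h.mixture y).ν a) ^ 2)] at key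
  have hs : ∫ β, √(D.joint y z β / D.mass y z * (D.joint y a β / D.mass y a)) =
      (∫ β, √(D.joint y z β * D.joint y a β)) / √(D.mass y z * D.mass y a) := by
    rw [← integral_div]
    refine integral_congr_ae (.of_forall fun β => ?_)
    simp only
    rw [div_mul_div_comm, Real.sqrt_div (mul_pos (h.joint_pos y z β) (h.joint_pos y a β)).le]
  rw [hs, div_pow, Real.sq_sqrt (mul_pos hz ha).le] at key
  set I := ∫ β, √(D.joint y z β * D.joint y a β)
  have hV : 0 ≤ (∫ x, (g x - ∫ x', g x' ∂(h.mixture y).ν z) ^ 2 ∂(h.mixture y).ν z) +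
        ∫ x, (g x - ∫ x', g x' ∂(h.mixture y).ν a) ^ 2 ∂(h.mixture y).ν a :=
    add_nonneg (integral_nonneg fun _ => sq_nonneg _) (integral_nonneg fun _ => sq_nonneg _)
  have hR0 : 0 < R := by
    have : 0 < c₁ := by
      by_contra hc
      have := mul_nonpos_of_nonpos_of_nonneg (not_lt.1 hc) ha.le
      linarith
    by_contra hR'
    have := mul_nonpos_of_nonpos_of_nonneg (not_lt.1 hR') (sq_nonneg c₂)
    linarith
  -- The squared overlap of the normalised densities is at least `1 / R`: one factor of the mass of
  -- `z` is traded for the mass of `a`, which then cancels.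
  have hI : 1 ≤ R * (I ^ 2 / (D.mass y z * D.mass y a)) := by
    rw [← mul_div_assoc, le_div_iff₀ (mul_pos hz ha), one_mul]
    have h1 : (c₂ * D.mass y a) ^ 2 ≤ I ^ 2 :=
      pow_le_pow_left₀ (mul_pos hc₂ ha).le hov 2
    calc D.mass y z * D.mass y a ≤ (c₁ * D.mass y a) * D.mass y a :=
          mul_le_mul_of_nonneg_right hmass ha.le
      _ ≤ (R * c₂ ^ 2 * D.mass y a) * D.mass y a :=
          mul_le_mul_of_nonneg_right (mul_le_mul_of_nonneg_right hR ha.le) ha.le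
      _ = R * (c₂ * D.mass y a) ^ 2 := by ring
      _ ≤ R * I ^ 2 := mul_le_mul_of_nonneg_left h1 hR0.le
  set d := (∫ x, g x ∂(h.mixture y).ν z - ∫ x, g x ∂(h.mixture y).ν a) ^ 2
  have hd : 0 ≤ d := sq_nonneg _
  calc d ≤ d * (R * (I ^ 2 / (D.mass y z * D.mass y a))) := le_mul_of_one_le_right hd hI
    _ = R * (d * (I ^ 2 / (D.mass y z * D.mass y a))) := by ring
    _ ≤ R * _ := mul_le_mul_of_nonneg_left key hR0.le
    _ = _ := by
      show _ = 2 * R * (∫ x, _ ∂D.betaGivenModel y z + ∫ x, _ ∂D.betaGivenModel y a)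
      ring

/-! ### Restricted eigenvalues and coherence -/

lemma restrictedEigenvalue_mul_le (m : ℕ) {z : Finset (Fin p)} (hz : z.card ≤ m) {v : Fin p → ℝ}
    (hv : ∀ j ∈ z, v j = 0) (hc : (Finset.univ.filter fun j => v j ≠ 0).card ≤ m) :
    D.restrictedEigenvalue m * ∑ j, v j ^ 2 ≤ D.quad z (D.X *ᵥ v) := by
  -- The infimum runs over unit vectors, so the zero vector is treated apart and every other one is
  -- rescaled.
  rcases (Finset.sum_nonneg fun j (_ : j ∈ Finset.univ) => sq_nonneg (v j)).eq_or_lt with h0 | h0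
  · rw [← h0, mul_zero]
    exact D.quad_nonneg _ _
  have hbdd : BddBelow {e : ℝ | ∃ (z : Finset (Fin p)) (v : Fin p → ℝ), z.card ≤ m ∧
      (∀ j ∈ z, v j = 0) ∧ (Finset.univ.filter fun j => v j ≠ 0).card ≤ m ∧ ∑ j, v j ^ 2 = 1 ∧
      e = (D.X *ᵥ v) ⬝ᵥ ((D.A z)⁻¹ *ᵥ (D.X *ᵥ v))} := by
    refine ⟨0, ?_⟩
    rintro e ⟨z, v, -, -, -, -, rfl⟩
    exact D.quad_nonneg z _
  set r := √(∑ j, v j ^ 2) with hr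
  have hr0 : 0 < r := Real.sqrt_pos.2 h0
  have hr2 : r ^ 2 = ∑ j, v j ^ 2 := Real.sq_sqrt h0.le
  have := csInf_le hbdd ⟨z, r⁻¹ • v, hz, fun j hj => by simp [hv j hj], ?_, ?_, rfl⟩
  · change D.restrictedEigenvalue m ≤ D.quad z (D.X *ᵥ (r⁻¹ • v)) at this
    rw [mulVec_smul, quad_smul] at this
    rw [← hr2]
    calc D.restrictedEigenvalue m * r ^ 2 ≤ (r⁻¹ ^ 2 * D.quad z (D.X *ᵥ v)) * r ^ 2 :=
          mul_le_mul_of_nonneg_right this (by positivity)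
      _ = _ := by field_simp
  · simpa [hr0.ne'] using hc
  · simp only [Pi.smul_apply, smul_eq_mul, mul_pow]
    rw [← Finset.mul_sum, ← hr2]
    field_simp

lemma coherence_nonneg (m : ℕ) : 0 ≤ D.coherence m := by
  refine Real.sSup_nonneg ?_
  rintro c ⟨z, i, j, -, -, -, rfl⟩
  exact abs_nonneg _

lemma le_coherence (m : ℕ) {z : Finset (Fin p)} (hz : z.card ≤ m) {i j : Fin p} (hij : j ≠ i)
    (hj : j ∉ z) : |D.X.col j ⬝ᵥ ((D.A z)⁻¹ *ᵥ D.X.col i)| ≤ D.coherence m := by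
  refine le_csSup ?_ ⟨z, i, j, hz, hij, hj, rfl⟩
  refine ((Set.finite_range fun x : Finset (Fin p) × Fin p × Fin p =>
    |D.X.col x.2.2 ⬝ᵥ ((D.A x.1)⁻¹ *ᵥ D.X.col x.2.1)|).subset ?_).bddAbove
  rintro c ⟨z, i, j, -, -, -, rfl⟩
  exact ⟨(z, i, j), rfl⟩

lemma mem_supp (β : Fin p → ℝ) (j : Fin p) : j ∈ supp β ↔ β j ≠ 0 := by simp [supp]

/-- The signal part is a combination of columns in the support of `βs`. As `j` lies outside it, all
of them differ from column `j` and their correlations are bounded by the coherence; the noise part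
is bounded by `e`. -/
lemma abs_correlation_le (βs : Fin p → ℝ) (ε : Fin n → ℝ) (m : ℕ) (hm : (supp βs).card ≤ m)
    {e : ℝ} {j : Fin p} (hj : j ∉ supp βs)
    (he : |((D.A (supp βs))⁻¹ *ᵥ D.X.col j) ⬝ᵥ ε| ≤ e) :
    |D.X.col j ⬝ᵥ ((D.A (supp βs))⁻¹ *ᵥ (D.X *ᵥ βs + ε))| ≤
      e + (∑ j, |βs j|) * D.coherence m := by
  have hX : D.X *ᵥ βs = ∑ i, βs i • D.X.col i := by
    ext l
    simp [mulVec, dotProduct, mul_comm]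
  rw [mulVec_add, dotProduct_add, dotProduct_inv_comm D _ _ ε, hX, mulVec_sum, dotProduct_sum,
    add_comm e]
  refine (abs_add_le _ _).trans (add_le_add ((Finset.abs_sum_le_sum_abs _ _).trans ?_) he)
  rw [Finset.sum_mul]
  refine Finset.sum_le_sum fun i _ => ?_
  rw [mulVec_smul, dotProduct_smul, smul_eq_mul, abs_mul]
  by_cases hi : βs i = 0
  · simp [hi]
  · refine mul_le_mul_of_nonneg_left (le_coherence m hm ?_ hj) (abs_nonneg _)
    rintro rfl
    exact hj ((mem_supp βs _).2 hi)

/-- Cauchy–Schwarz in each row over the active coordinates `z \ a`, then the column norms are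
summed. -/
lemma dotProduct_mulVec_off_le (hX : ∀ j, ∑ i, D.X i j ^ 2 = n) (a z : Finset (Fin p))
    (γ : {j // j ∉ a} → ℝ) :
    (D.X *ᵥ off a z γ) ⬝ᵥ (D.X *ᵥ off a z γ) ≤
      ((z \ a).card * n : ℝ) * ∑ j, off a z γ j ^ 2 := by
  have h1 : ∀ φ : Fin p → ℝ → ℝ, (∀ j, φ j 0 = 0) →
      ∑ j, φ j (off a z γ j) = ∑ j ∈ z \ a, φ j (off a z γ j) := fun φ h0 =>
    (Finset.sum_subset (Finset.subset_univ _) fun j _ hj => by rw [off_eq_zero γ hj, h0]).symm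
  have h2 : ∀ i, (D.X *ᵥ off a z γ) i * (D.X *ᵥ off a z γ) i ≤
      (∑ j ∈ z \ a, D.X i j ^ 2) * ∑ j, off a z γ j ^ 2 := by
    intro i
    rw [mulVec, dotProduct, h1 (fun j x => D.X i j * x) (by simp), h1 (fun _ x => x ^ 2) (by simp),
      ← sq]
    exact Finset.sum_mul_sq_le_sq_mul_sq _ _ _
  calc (D.X *ᵥ off a z γ) ⬝ᵥ (D.X *ᵥ off a z γ)
      ≤ ∑ i, (∑ j ∈ z \ a, D.X i j ^ 2) * ∑ j, off a z γ j ^ 2 :=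
        Finset.sum_le_sum fun i _ => h2 i
    _ = _ := by
      rw [← Finset.sum_mul, Finset.sum_comm]
      simp [hX]

/-! ### Numerical consequences of the prior scaling -/

lemma Scaling.pos {δ : ℝ} (hS : D.Scaling δ) (hn : 0 < n) (hp : 0 < p) (hσ : 0 < D.σ)
    (hq : 0 < D.q) (hq1 : D.q < 1) : D.Pos where
  σ := hσ
  τ₀ := by rw [hS.spike]; positivity
  τ₁ := by rw [hS.slab]; positivity
  q := hq
  q' := by linarith

lemma Scaling.slab_sq {δ : ℝ} (hS : D.Scaling δ) : D.τ₁ ^ 2 = D.σ ^ 2 * p ^ 2 / n := by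
  rw [hS.slab, div_pow, mul_pow, Real.sq_sqrt (Nat.cast_nonneg n)]

lemma Scaling.spike_sq {δ : ℝ} (hS : D.Scaling δ) : D.τ₀ ^ 2 = D.σ ^ 2 / n := by
  rw [hS.spike, div_pow, Real.sq_sqrt (Nat.cast_nonneg n)]

lemma Scaling.spike_mul_slab {δ : ℝ} (hS : D.Scaling δ) : D.τ₀ * D.τ₁ = D.σ ^ 2 * p / n := by
  rw [hS.spike, hS.slab, div_mul_div_comm, Real.mul_self_sqrt (Nat.cast_nonneg n)]
  ring

/-- Upper bound for the mass of an overfitted model. -/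
lemma Scaling.mass_le {δ : ℝ} (hS : D.Scaling δ) (h : D.Pos) (hn : 0 < n) (hp : 0 < p)
    (y : Fin n → ℝ) {a z : Finset (Fin p)} (haz : a ⊆ z) {m : ℕ} (hz : z.card ≤ m)
    (hω : 0 < D.restrictedEigenvalue m) {E : ℝ}
    (hE : ∀ j ∈ z \ a, |D.X.col j ⬝ᵥ ((D.A a)⁻¹ *ᵥ y)| ≤ E) :
    D.mass y z ≤ (D.q / (1 - D.q) * ((p * √(D.restrictedEigenvalue m / n))⁻¹ *
      Real.exp (E ^ 2 / (2 * D.σ ^ 2 * D.restrictedEigenvalue m)))) ^ (z \ a).card * D.mass y a := by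
  set ω := D.restrictedEigenvalue m with hωdef
  have hσ := h.σ
  have hτ := h.τ₁
  have hq := h.q
  have hq' := h.q'
  have hn' : (0 : ℝ) < n := by exact_mod_cast hn
  have hp' : (0 : ℝ) < p := by exact_mod_cast hp
  refine h.mass_le y haz hω.le (fun γ => ?_) fun j hj => ?_
  · refine restrictedEigenvalue_mul_le m ((Finset.card_le_card haz).trans hz)
      (fun j hj => off_of_mem γ hj) ((Finset.card_le_card fun j hj => ?_).trans hz)
    by_contra hjz
    exact (Finset.mem_filter.1 hj).2 (off_eq_zero γ fun h => hjz (Finset.mem_sdiff.1 h).1)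
  · rw [h.integral_tilt a y hω.le]
    have h1 : (√(1 + D.τ₁ ^ 2 * ω / D.σ ^ 2))⁻¹ ≤ (p * √(ω / n))⁻¹ := by
      refine inv_anti₀ (by positivity) (Real.le_sqrt_of_sq_le ?_)
      rw [mul_pow, Real.sq_sqrt (by positivity), hS.slab_sq]
      have : D.σ ^ 2 * (p : ℝ) ^ 2 / n * ω / D.σ ^ 2 = (p : ℝ) ^ 2 * (ω / n) := by field_simp
      linarith
    have h2 : (D.X.col j ⬝ᵥ ((D.A a)⁻¹ *ᵥ y)) ^ 2 / (2 * D.σ ^ 2 * (D.σ ^ 2 / D.τ₁ ^ 2 + ω)) ≤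
        E ^ 2 / (2 * D.σ ^ 2 * ω) := by
      refine div_le_div₀ (sq_nonneg E) ?_ (by positivity) ?_
      · rw [← sq_abs]; exact pow_le_pow_left₀ (abs_nonneg _) (hE j hj) 2
      · have : 0 ≤ D.σ ^ 2 / D.τ₁ ^ 2 := by positivity
        gcongr
        linarith
    rw [div_mul_eq_mul_div, mul_div_cancel₀ _ hq'.ne']
    gcongr

/-- Lower bound for the mass of an overfitted model. -/
lemma Scaling.le_mass {δ : ℝ} (hS : D.Scaling δ) (h : D.Pos) (hn : 0 < n)
    (y : Fin n → ℝ) {a z : Finset (Fin p)} (haz : a ⊆ z) {t : ℕ} (ht : (z \ a).card ≤ t) :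
    (D.q / (1 - D.q) * (√(1 + t * (p : ℝ) ^ 2))⁻¹) ^ (z \ a).card * D.mass y a ≤ D.mass y z := by
  have hσ := h.σ
  have hq := h.q
  have hq' := h.q'
  have hn' : (0 : ℝ) < n := by exact_mod_cast hn
  refine h.le_mass y haz (ρ := t * n) (by positivity) (by positivity) (fun γ => ?_) fun j hj => ?_
  · refine (dotProduct_mulVec_off_le hS.cols a z γ).trans ?_
    have : ((z \ a).card : ℝ) ≤ t := by exact_mod_cast ht
    have := Finset.sum_nonneg fun j (_ : j ∈ Finset.univ) => sq_nonneg (off a z γ j)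
    gcongr
  · have hτ := h.τ₁
    rw [h.integral_tilt a y (by positivity), div_mul_eq_mul_div, mul_div_cancel₀ _ hq'.ne',
      hS.slab_sq]
    have : D.σ ^ 2 * (p : ℝ) ^ 2 / n * (t * n) / D.σ ^ 2 = t * (p : ℝ) ^ 2 := by field_simp
    rw [this]
    refine mul_le_mul_of_nonneg_left (le_mul_of_one_le_right (by positivity)
      (Real.one_le_exp ?_)) hq.le
    positivity

/-- Lower bound for the overlap of two nested models. -/
lemma Scaling.le_overlap {δ : ℝ} (hS : D.Scaling δ) (h : D.Pos) (hn : 0 < n) (hp : 0 < p)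
    (y : Fin n → ℝ) {a z : Finset (Fin p)} (haz : a ⊆ z) {s : ℕ} (hs : (z \ a).card ≤ s) :
    √(D.q / (1 - D.q) * (2 / (p * (s + 2)))) ^ (z \ a).card * D.mass y a ≤
      ∫ β, √(D.joint y z β * D.joint y a β) := by
  have hσ := h.σ
  have hq := h.q
  have hq' := h.q'
  have hn' : (0 : ℝ) < n := by exact_mod_cast hn
  have hp' : (1 : ℝ) ≤ p := by exact_mod_cast hp
  refine h.le_overlap y haz (ρ := s * n) (by positivity) (by positivity) (fun γ => ?_) ?_
  · refine (dotProduct_mulVec_off_le hS.cols a z γ).trans ?_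
    have : ((z \ a).card : ℝ) ≤ s := by exact_mod_cast hs
    have := Finset.sum_nonneg fun j (_ : j ∈ Finset.univ) => sq_nonneg (off a z γ j)
    gcongr
  · have h1 : 2 * D.τ₀ * D.τ₁ * ((1 / D.τ₀ ^ 2 + 1 / D.τ₁ ^ 2) / 4 + s * n / (4 * D.σ ^ 2)) =
        p * (s + 1 + 1 / (p : ℝ) ^ 2) / 2 := by
      rw [mul_assoc 2, hS.spike_mul_slab, hS.spike_sq, hS.slab_sq]
      field_simp
      ring
    have h2 : p * (s + 1 + 1 / (p : ℝ) ^ 2) / 2 ≤ p * (s + 2) / 2 := by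
      have : 1 / (p : ℝ) ^ 2 ≤ 1 := by
        rw [div_le_one (by positivity)]; exact one_le_pow₀ hp'
      have : (s : ℝ) + 1 + 1 / (p : ℝ) ^ 2 ≤ s + 2 := by linarith
      gcongr
    rw [h1, ← Real.sqrt_mul (by positivity)]
    refine Real.le_sqrt_of_sq_le ?_
    rw [mul_pow, Real.sq_sqrt (by positivity)]
    have h3 : (1 - D.q) ^ 2 * (D.q / (1 - D.q) * (2 / (p * (s + 2)))) =
        D.q * (1 - D.q) * (1 / (p * (s + 2) / 2)) := by field_simp
    rw [h3]
    gcongr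

/-- The exponential factor in the mixing time dominates the inverse squared overlap. -/
lemma overlap_rate_le {ν ω σ E s : ℝ} (hω : 0 < ω) (hων : ω ≤ ν) (hσ : 0 < σ)
    (hE : 0 ≤ E) (hs : 1 ≤ s) :
    s * (s / 2 + ν / (2 * ω) + E ^ 2 / (2 * σ ^ 2 * ω)) ≤
      ν * s ^ 2 / σ ^ 2 * (σ / √ω + E / ω) ^ 2 := by
  have h1 : σ ^ 2 / ω + E ^ 2 / ω ^ 2 ≤ (σ / √ω + E / ω) ^ 2 := by
    have : (σ / √ω) ^ 2 = σ ^ 2 / ω := by rw [div_pow, Real.sq_sqrt hω.le]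
    have h0 : 0 ≤ σ / √ω * (E / ω) := by positivity
    rw [add_sq, this, div_pow]
    linarith
  have h2 : ν * s ^ 2 / σ ^ 2 * (σ ^ 2 / ω + E ^ 2 / ω ^ 2) =
      s ^ 2 * (ν / ω + ν / ω * (E ^ 2 / (σ ^ 2 * ω))) := by field_simp
  have hν : 0 < ν := hω.trans_le hων
  have h3 : ν * s ^ 2 / σ ^ 2 * (σ ^ 2 / ω + E ^ 2 / ω ^ 2) ≤
      ν * s ^ 2 / σ ^ 2 * (σ / √ω + E / ω) ^ 2 := mul_le_mul_of_nonneg_left h1 (by positivity)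
  have h4 : 1 ≤ ν / ω := (one_le_div hω).2 hων
  have h5 : ν / (2 * ω) = ν / ω / 2 := by field_simp
  have h6 : E ^ 2 / (2 * σ ^ 2 * ω) = E ^ 2 / (σ ^ 2 * ω) / 2 := by field_simp
  have h7 : 0 ≤ E ^ 2 / (σ ^ 2 * ω) := by positivity
  refine le_trans ?_ (h2 ▸ h3)
  rw [h5, h6]
  generalize ν / ω = x at h4 ⊢
  generalize E ^ 2 / (σ ^ 2 * ω) = e at h7 ⊢
  have h8 : e ≤ x * e := le_mul_of_one_le_left h7 h4
  have h9 : s ≤ s ^ 2 := by nlinarith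
  calc s * (s / 2 + x / 2 + e / 2) = s ^ 2 / 2 + s * (x / 2 + e / 2) := by ring
    _ ≤ s ^ 2 / 2 + s ^ 2 * (x / 2 + e / 2) := by
        have : 0 ≤ x / 2 + e / 2 := by linarith
        gcongr
    _ = s ^ 2 * (1 / 2 + x / 2 + e / 2) := by ring
    _ ≤ s ^ 2 * (x + x * e) := by
        have : 1 / 2 + x / 2 + e / 2 ≤ x + x * e := by linarith
        gcongr

end Design

end SpikeSlab

end

/-! ### Comparison with the true model, warm start and mixing time. -/

noncomputable section

namespace SpikeSlab

namespace Design

variable {n p : ℕ} {D : Design n p}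

lemma eta_nonneg (hσ : 0 < D.σ) (βs : Fin p → ℝ) (s : ℕ)
    (hω : 0 < D.restrictedEigenvalue ((supp βs).card + s)) : 0 ≤ D.eta βs s := by
  have := coherence_nonneg (D := D) ((supp βs).card + s)
  have : 0 ≤ ∑ j, |βs j| := Finset.sum_nonneg fun _ _ => abs_nonneg _
  unfold eta
  positivity

/-- The means of a density under the true model and under an overfitted one are comparable. -/
lemma Scaling.sq_mean_sub_le {δ : ℝ} (hS : D.Scaling δ) (h : D.Pos) (hn : 0 < n) (hp : 0 < p)
    (βs : Fin p → ℝ) (s : ℕ) (ε : Fin n → ℝ)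
    (hω : 0 < D.restrictedEigenvalue ((supp βs).card + s)) (hε : ε ∈ D.event βs s δ)
    {z : Finset (Fin p)} (hz : supp βs ⊆ z) (hzs : z.card ≤ (supp βs).card + s)
    {B : ℝ} {g : (Fin p → ℝ) → ℝ} (hg : (h.mixture (D.X *ᵥ βs + ε)).IsDensity B g) :
    (∫ x, g x ∂(h.mixture (D.X *ᵥ βs + ε)).ν z -
        ∫ x, g x ∂(h.mixture (D.X *ᵥ βs + ε)).ν (supp βs)) ^ 2 ≤
      2 * Real.exp (n * (s : ℝ) ^ 2 / D.σ ^ 2 * D.eta βs s ^ 2) *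
      ((∫ x, (g x - ∫ x', g x' ∂(h.mixture (D.X *ᵥ βs + ε)).ν z) ^ 2
          ∂(h.mixture (D.X *ᵥ βs + ε)).ν z) +
        ∫ x, (g x - ∫ x', g x' ∂(h.mixture (D.X *ᵥ βs + ε)).ν (supp βs)) ^ 2
          ∂(h.mixture (D.X *ᵥ βs + ε)).ν (supp βs)) := by
  set y := D.X *ᵥ βs + ε with hy
  set a := supp βs with ha
  set ω := D.restrictedEigenvalue (a.card + s) with hωdef
  set E := D.σ * √(2 * (s + 1) * n * Real.log p) + (∑ j, |βs j|) * D.coherence (a.card + s) with hE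
  have hσ := h.σ
  have hq := h.q
  have hq' := h.q'
  have hn' : (0 : ℝ) < n := by exact_mod_cast hn
  have hp' : (0 : ℝ) < p := by exact_mod_cast hp
  have hE0 : 0 ≤ E := by
    have := coherence_nonneg (D := D) (a.card + s)
    have : 0 ≤ ∑ j, |βs j| := Finset.sum_nonneg fun _ _ => abs_nonneg _
    positivity
  have hcard : (z \ a).card ≤ s := by
    rw [Finset.card_sdiff_of_subset hz]; omega
  have hcor : ∀ j ∈ z \ a, |D.X.col j ⬝ᵥ ((D.A a)⁻¹ *ᵥ y)| ≤ E := fun j hj =>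
    abs_correlation_le βs ε _ (Nat.le_add_right _ _) (Finset.mem_sdiff.1 hj).2
      (hε.2.2 a subset_rfl (Nat.le_add_right _ _) j (Finset.mem_sdiff.1 hj).2)
  have hup := hS.mass_le h hn hp y hz hzs hω hcor
  have hov := hS.le_overlap h hn hp y hz hcard
  refine h.sq_mean_sub_le y (by positivity) hup hov ?_ hg
  rw [← pow_mul, mul_comm (z \ a).card 2, pow_mul, Real.sq_sqrt (by positivity)]
  -- For `z` equal to the support both powers are 1. Otherwise there is an extra column, which gives
  -- `s ≥ 1` and, tested as a basis vector in the restricted eigenvalue, `ω ≤ n`.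
  rcases Nat.eq_zero_or_pos (z \ a).card with h0 | h0
  · rw [h0, pow_zero, pow_zero, mul_one]
    exact Real.one_le_exp (by positivity)
  have hs1 : (1 : ℝ) ≤ s := by exact_mod_cast h0.trans_le hcard
  have hωn : ω ≤ n := by
    obtain ⟨j, hj⟩ := Finset.card_pos.1 h0
    have hja := (Finset.mem_sdiff.1 hj).2
    have h1 := restrictedEigenvalue_mul_le (D := D) (a.card + s) (z := a) (Nat.le_add_right _ _)
      (v := Pi.single j 1)
      (fun i hi => Pi.single_eq_of_ne (by rintro rfl; exact hja hi) _)
      (by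
        have : (Finset.univ.filter fun i => (Pi.single j (1 : ℝ) : Fin p → ℝ) i ≠ 0) = {j} := by
          ext i; simp [Pi.single_apply]
        rw [this, Finset.card_singleton]
        omega)
    have h2 : ∑ i, (Pi.single j (1 : ℝ) : Fin p → ℝ) i ^ 2 = 1 := by
      rw [Finset.sum_eq_single j] <;> simp +contextual
    have h3 := D.quad_le hσ.ne' h.τ₁.ne' a (D.X *ᵥ Pi.single j 1)
    have h4 : (D.X *ᵥ Pi.single j 1) ⬝ᵥ (D.X *ᵥ Pi.single j 1) = (n : ℝ) := by
      rw [← hS.cols j]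
      simp [dotProduct, sq]
    rw [h2, mul_one] at h1
    linarith
  set k := (z \ a).card with hk
  have hks : (k : ℝ) ≤ s := by exact_mod_cast hcard
  have hrate := overlap_rate_le hω hωn hσ hE0 hs1
  set L := (s : ℝ) / 2 + n / (2 * ω) + E ^ 2 / (2 * D.σ ^ 2 * ω) with hL
  have hL0 : 0 ≤ L := by positivity
  -- The three summands of `L` absorb in turn `(s + 2) / 2`, `√(n / ω)` and the exponential of the
  -- correlations, using `1 + u ≤ exp u`; the odds and `p` are common to both sides.
  have hbase : D.q / (1 - D.q) * ((p * √(ω / n))⁻¹ * Real.exp (E ^ 2 / (2 * D.σ ^ 2 * ω))) ≤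
      Real.exp L * (D.q / (1 - D.q) * (2 / (p * (s + 2)))) := by
    have e1 : ((s : ℝ) + 2) / 2 ≤ Real.exp (s / 2) := by
      have := Real.add_one_le_exp ((s : ℝ) / 2)
      linarith
    have e2 : (√(ω / n))⁻¹ ≤ Real.exp (n / (2 * ω)) := by
      rw [← Real.sqrt_inv, inv_div]
      refine Real.sqrt_le_iff.2 ⟨(Real.exp_pos _).le, ?_⟩
      rw [← Real.exp_nat_mul]
      have := Real.add_one_le_exp ((n : ℝ) / ω)
      have e : ((2 : ℕ) : ℝ) * (n / (2 * ω)) = n / ω := by push_cast; field_simp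
      rw [e]
      linarith
    have e3 : D.q / (1 - D.q) * ((p * √(ω / n))⁻¹ * Real.exp (E ^ 2 / (2 * D.σ ^ 2 * ω))) =
        (((s : ℝ) + 2) / 2 * (√(ω / n))⁻¹ * Real.exp (E ^ 2 / (2 * D.σ ^ 2 * ω))) *
          (D.q / (1 - D.q) * (2 / (p * (s + 2)))) := by
      have : 0 < √(ω / n) := Real.sqrt_pos.2 (by positivity)
      field_simp
    rw [e3, hL, Real.exp_add, Real.exp_add]
    gcongr
  calc (D.q / (1 - D.q) * ((p * √(ω / n))⁻¹ * Real.exp (E ^ 2 / (2 * D.σ ^ 2 * ω)))) ^ k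
      ≤ (Real.exp L * (D.q / (1 - D.q) * (2 / (p * (s + 2))))) ^ k :=
        pow_le_pow_left₀ (by positivity) hbase k
    _ = Real.exp (k * L) * (D.q / (1 - D.q) * (2 / (p * (s + 2)))) ^ k := by
        rw [mul_pow, ← Real.exp_nat_mul]
    _ ≤ _ := by
        refine mul_le_mul_of_nonneg_right (Real.exp_le_exp.2 ?_) (by positivity)
        exact (mul_le_mul_of_nonneg_right hks hL0).trans hrate

/-- Lower bound for the posterior probability of a model with few false positives. -/
lemma Scaling.le_modelProb {δ : ℝ} (hS : D.Scaling δ) (h : D.Pos) (hn : 0 < n) (hp : 0 < p)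
    (hδ : 0 < δ) (y : Fin n → ℝ) {a z : Finset (Fin p)} (haz : a ⊆ z) {t : ℕ}
    (ht : (z \ a).card ≤ t) :
    D.modelProb y a ≤
      (p : ℝ) ^ ((1 + δ) * t) * (1 + t * (p : ℝ) ^ 2) ^ ((t : ℝ) / 2) * D.modelProb y z := by
  have hp' : (1 : ℝ) ≤ p := by exact_mod_cast hp
  have hm := hS.le_mass h hn y haz ht
  have e1 : (p : ℝ) ^ ((1 + δ) * t) = ((p : ℝ) ^ (1 + δ)) ^ t := by
    rw [Real.rpow_mul (by positivity), Real.rpow_natCast]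
  have e2 : (1 + t * (p : ℝ) ^ 2) ^ ((t : ℝ) / 2) = √(1 + t * (p : ℝ) ^ 2) ^ t := by
    rw [Real.sqrt_eq_rpow, ← Real.rpow_mul_natCast (by positivity)]
    congr 1; ring
  -- The price of one false positive. As `w ≥ 1`, the actual number of false positives may be
  -- replaced by its bound `t`.
  set w := (p : ℝ) ^ (1 + δ) * √(1 + t * (p : ℝ) ^ 2) with hw
  have hw1 : 1 ≤ w := by
    have h1 : 1 ≤ (p : ℝ) ^ (1 + δ) := Real.one_le_rpow hp' (by linarith)
    have h2 : 1 ≤ √(1 + t * (p : ℝ) ^ 2) := Real.one_le_sqrt.2 (by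
      have : (0 : ℝ) ≤ t * (p : ℝ) ^ 2 := by positivity
      linarith)
    exact one_le_mul_of_one_le_of_one_le h1 h2
  have e3 : D.q / (1 - D.q) * (√(1 + t * (p : ℝ) ^ 2))⁻¹ = w⁻¹ := by
    rw [hS.odds, hw, mul_inv, one_div, add_comm δ]
  rw [e3] at hm
  rw [e1, e2, ← mul_pow, ← hw, modelProb, modelProb, ← mul_div_assoc]
  refine div_le_div_of_nonneg_right ?_ (h.sum_mass_pos y).le
  have ha := h.mass_pos y a
  calc D.mass y a = w ^ (z \ a).card * (w⁻¹ ^ (z \ a).card * D.mass y a) := by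
        rw [← mul_assoc, ← mul_pow, mul_inv_cancel₀ (by positivity), one_pow, one_mul]
    _ ≤ w ^ t * D.mass y z :=
        mul_le_mul (pow_le_pow_right₀ hw1 ht) hm (by positivity) (by positivity)

/-- Mixing time of the lazy blocked Gibbs sampler. -/
theorem Scaling.tvDist_gibbsLaw_le {δ : ℝ} (hS : D.Scaling δ) (h : D.Pos) (hn : 0 < n)
    (hp : 0 < p) (hδ : 0 < δ) (βs : Fin p → ℝ) (s t : ℕ) (ε : Fin n → ℝ)
    (hω : 0 < D.restrictedEigenvalue ((supp βs).card + s)) (hε : ε ∈ D.event βs s δ)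
    {z₀ : Finset (Fin p)} (hz₀ : supp βs ⊆ z₀) (ht : (z₀ \ supp βs).card ≤ t)
    {ζ₀ : ℝ} (hζ : 0 < ζ₀) (hζ1 : ζ₀ < 1)
    (hcond : 20 / ((p : ℝ) ^ (δ / 2 * (s + 1)) * ζ₀ ^ 2) ≤
      (1 / (p : ℝ)) ^ (2 * (1 + δ) * t) * (1 / (1 + t * (p : ℝ) ^ 2)) ^ t) {N : ℕ}
    (hN : 280 * ((p : ℝ) ^ ((1 + δ) * t) * (1 + t * (p : ℝ) ^ 2) ^ ((t : ℝ) / 2) *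
      Real.exp (n * (s : ℝ) ^ 2 / D.σ ^ 2 * D.eta βs s ^ 2) * Real.log (1 / ζ₀)) ≤ N) :
    tvDist (D.gibbsLaw (D.X *ᵥ βs + ε) (D.betaGivenModel (D.X *ᵥ βs + ε) z₀) N)
      (D.betaPosterior (D.X *ᵥ βs + ε)) ≤ ζ₀ := by
  have hprob := hS.le_modelProb h hn hp hδ (D.X *ᵥ βs + ε) hz₀ ht
  have hp' : (1 : ℝ) ≤ p := by exact_mod_cast hp
  set b := (p : ℝ) ^ ((1 + δ) * t) * (1 + t * (p : ℝ) ^ 2) ^ ((t : ℝ) / 2) with hb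
  have hT : (1 : ℝ) ≤ 1 + t * (p : ℝ) ^ 2 := by
    have : (0 : ℝ) ≤ t * (p : ℝ) ^ 2 := by positivity
    linarith
  have hb1 : 1 ≤ b := one_le_mul_of_one_le_of_one_le (Real.one_le_rpow hp' (by positivity))
    (Real.one_le_rpow hT (by positivity))
  -- The tolerance condition is thereby `20 b² ≤ P ζ₀²`, which gives `(2 b)² * (4 / P) ≤ (4 / 5)
  -- ζ₀²`.
  have hb2 : (1 / (p : ℝ)) ^ (2 * (1 + δ) * t) * (1 / (1 + t * (p : ℝ) ^ 2)) ^ t = (b ^ 2)⁻¹ := by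
    rw [hb, mul_pow, mul_inv, one_div, one_div, Real.inv_rpow (by positivity), inv_pow,
      ← Real.rpow_mul_natCast (by positivity), ← Real.rpow_mul_natCast (by positivity),
      ← Real.rpow_natCast _ t]
    push_cast
    congr 3 <;> ring
  rw [hb2] at hcond
  set P := (p : ℝ) ^ (δ / 2 * (s + 1)) with hP
  have hP0 : 0 < P := by positivity
  obtain ⟨hM, ha, -⟩ := id hε
  set M := h.mixture (D.X *ᵥ βs + ε) with hMdef
  -- The true model has probability at least 1/2, and passing to `z₀` loses at most the factor `b`;
  -- hence the density bound `2 * b`.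
  have hz : 1 / (2 * b) ≤ M.w z₀ := by
    rw [div_le_iff₀ (by positivity)]
    have : (1 : ℝ) / 2 ≤ b * M.w z₀ := ha.trans hprob
    linarith
  have hz0 : 0 < M.w z₀ := lt_of_lt_of_le (by positivity) hz
  have hdens := M.isDensity_component hz0 hz (by positivity)
  have hlaw : D.gibbsLaw (D.X *ᵥ βs + ε) (D.betaGivenModel (D.X *ᵥ βs + ε) z₀) N =
      M.target.withDensity fun x => ENNReal.ofReal ((M.step^[N] fun x => M.r z₀ x / M.w z₀) x) := by
    rw [← M.iterate_bind_withDensity hdens (D.gibbsKernel (D.X *ᵥ βs + ε)) (fun _ => rfl) N,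
      ← M.component_eq hz0]
    rfl
  rw [hlaw]
  have hR : 1 ≤ Real.exp (n * (s : ℝ) ^ 2 / D.σ ^ 2 * D.eta βs s ^ 2) :=
    Real.one_le_exp (by positivity)
  refine M.tvDist_iterate_le hb1 hdens (Finset.univ.filter (fun z : Finset (Fin p) =>
    supp βs ⊆ z ∧ z.card ≤ (supp βs).card + s)) (a := supp βs) ha hR
    (fun g hg z hz => ?_) (e := 4 / P) (by positivity) hM hζ hζ1 ?_ hN
  · obtain ⟨h1, h2⟩ := (Finset.mem_filter.1 hz).2
    exact hS.sq_mean_sub_le h hn hp βs s ε hω hε h1 h2 hg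
  · have h1 : 20 * b ^ 2 ≤ P * ζ₀ ^ 2 := by
      rw [div_le_iff₀ (by positivity), inv_mul_eq_div, le_div_iff₀ (by positivity)] at hcond
      exact hcond
    rw [← mul_div_assoc, div_le_iff₀ hP0]
    linarith

end Design

end SpikeSlab

end
-- Assembly of the two claims.
open SpikeSlab Design in
theorem mainTheorem2 :
    (∀ c₀ : ℝ, 0 < c₀ → ∃ C : ℝ, 0 < C ∧
      ∀ (n p s t : ℕ) (D : Design n p) (βs : Fin p → ℝ) (ε : Fin n → ℝ)
        (z₀ : Finset (Fin p)) (δ ζ₀ : ℝ),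
        0 < n → 0 < p → 0 < D.σ → 0 < D.q → D.q < 1 → 0 < δ → 0 < ζ₀ → ζ₀ < 1 →
        D.Scaling δ →
        0 < D.restrictedEigenvalue ((supp βs).card + s) →
        D.BetaMin c₀ βs →
        ε ∈ D.event βs s δ →
        supp βs ⊆ z₀ → (z₀ \ supp βs).card ≤ t →
        20 / ((p : ℝ) ^ (δ / 2 * (s + 1)) * ζ₀ ^ 2) ≤
          (1 / (p : ℝ)) ^ (2 * (1 + δ) * t) * (1 / (1 + t * (p : ℝ) ^ 2)) ^ t →
        (∀ N : ℕ,
          C * ((s + 1) * (p : ℝ) ^ ((1 + δ) * t) * (1 + t * (p : ℝ) ^ 2) ^ ((t : ℝ) / 2) *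
            Real.exp (n * (s : ℝ) ^ 2 / D.σ ^ 2 * D.eta βs s ^ 2 +
              2 * √(n * Real.log p) / D.σ * D.eta βs s +
              n / (2 * D.σ ^ 2) * D.eta βs s ^ 2) * Real.log (1 / ζ₀)) ≤ N →
          tvDist
            (D.gibbsLaw (D.X *ᵥ βs + ε) (D.betaGivenModel (D.X *ᵥ βs + ε) z₀) N)
            (D.betaPosterior (D.X *ᵥ βs + ε)) ≤ ζ₀) ∧
        (s = 0 → δ = 1 → ∀ k : ℕ, k = (supp βs).card → ∀ N : ℕ,
          C * ((p : ℝ) ^ (2 * t) * (1 + t * (p : ℝ) ^ 2) ^ ((t : ℝ) / 2) *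
            Real.exp (
              max (√n / √(D.restrictedEigenvalue k)) (n ^ 2 / D.restrictedEigenvalue k ^ 2) *
                Real.log p +
              max (k * D.coherence k / D.restrictedEigenvalue k)
                (k ^ 2 * D.coherence k ^ 2 / D.restrictedEigenvalue k ^ 2) * Real.log p) *
            Real.log (1 / ζ₀)) ≤ N →
          tvDist
            (D.gibbsLaw (D.X *ᵥ βs + ε) (D.betaGivenModel (D.X *ᵥ βs + ε) z₀) N)
            (D.betaPosterior (D.X *ᵥ βs + ε)) ≤ ζ₀)) ∧
    (∃ c C : ℝ, 0 < c ∧ 0 < C ∧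
      ∀ (n p : ℕ) (D : Design n p) (y : Fin n → ℝ) (z : Finset (Fin p))
        (r : z → ℝ) (ζ : Fin n → ℝ), 0 < n → 0 < D.σ → 0 < D.τ₁ →
        (sampleActive D y z r ζ).val =
          D.σ • (r + (D.τ₁ ^ 2 / D.σ ^ 2) • ((activeCols D.X z)ᵀ *ᵥ
            ((D.A z)⁻¹ *ᵥ ((1 / D.σ) • y - (activeCols D.X z *ᵥ r + ζ))))) ∧
        ((sampleActive D y z r ζ).cost : ℝ) ≤
          C * max ((n : ℝ) ^ 2 * z.card) ((n : ℝ) ^ 3) ∧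
        ∀ zs : Finset (Fin p), zs ⊆ z →
          c * max ((n : ℝ) ^ 2 * zs.card) ((n : ℝ) ^ 3) ≤
            ((sampleActive D y z r ζ).cost : ℝ)) := by
  refine ⟨fun c₀ _ => ⟨280, by norm_num, ?_⟩, sampleActive_spec⟩
  intro n p s t D βs ε z₀ δ ζ₀ hn hp hσ hq hq1 hδ hζ hζ1 hS hω _ hε hz₀ ht hcond
  have hpos := hS.pos hn hp hσ hq hq1
  have hL : 0 ≤ Real.log (1 / ζ₀) := Real.log_nonneg (by rw [le_div_iff₀ hζ]; linarith)
  have hlogp : 0 ≤ Real.log p := Real.log_natCast_nonneg p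
  refine ⟨fun N hN => ?_, ?_⟩
  · refine hS.tvDist_gibbsLaw_le hpos hn hp hδ βs s t ε hω hε hz₀ ht hζ hζ1 hcond
      (le_trans ?_ hN)
    have hη := eta_nonneg hσ βs s hω
    refine mul_le_mul_of_nonneg_left (mul_le_mul_of_nonneg_right ?_ hL) (by norm_num)
    refine mul_le_mul ?_ (Real.exp_le_exp.2 ?_) (Real.exp_pos _).le (by positivity)
    · refine mul_le_mul_of_nonneg_right (le_mul_of_one_le_left (by positivity) ?_) (by positivity)
      have : (0 : ℝ) ≤ s := Nat.cast_nonneg s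
      linarith
    · have h1 : 0 ≤ 2 * √(n * Real.log p) / D.σ * D.eta βs s := by positivity
      have h2 : 0 ≤ n / (2 * D.σ ^ 2) * D.eta βs s ^ 2 := by positivity
      linarith
  · rintro rfl rfl k - N hN
    refine hS.tvDist_gibbsLaw_le hpos hn hp hδ βs 0 t ε hω hε hz₀ ht hζ hζ1 hcond
      (le_trans ?_ hN)
    have e1 : (p : ℝ) ^ (((1 : ℝ) + 1) * t) = (p : ℝ) ^ (2 * t) := by
      rw [← Real.rpow_natCast]; push_cast; norm_num
    rw [e1]
    refine mul_le_mul_of_nonneg_left (mul_le_mul_of_nonneg_right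
      (mul_le_mul_of_nonneg_left (Real.exp_le_exp.2 ?_) (by positivity)) hL) (by norm_num)
    -- For `s = 0` the only good model is the true one, so the overlap exponent vanishes and any
    -- nonnegative exponent in the claimed number of steps suffices.
    have h1 : (n : ℝ) * ((0 : ℕ) : ℝ) ^ 2 / D.σ ^ 2 * D.eta βs 0 ^ 2 = 0 := by simp
    rw [h1]
    have h2 : 0 ≤ max (√n / √(D.restrictedEigenvalue k)) (n ^ 2 / D.restrictedEigenvalue k ^ 2) :=
      le_max_of_le_left (by positivity)
    have h3 : 0 ≤ max (k * D.coherence k / D.restrictedEigenvalue k)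
        (k ^ 2 * D.coherence k ^ 2 / D.restrictedEigenvalue k ^ 2) :=
      le_max_of_le_right (by positivity)
    positivity
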